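/- Let $d>2$ be an integer. For $f:\mathbb Z^d\to\mathbb R$ write $\hat f(k)=\sum_{x\in\mathbb Z^d}f(x)e^{ik\cdot x}$ for $k\in\mathbb T^d=(-\pi,\pi]^d$, and $f^{(m)}(x)=f(x)e^{mx_1}$ for $m\ge 0$; let $|\cdot|$ be the Euclidean norm. Let $z_c,\delta_0>0$ and, for each $z\in[z_c-\delta_0,z_c)$, let $F_z:\mathbb Z^d\to\mathbb R$ be invariant under reflections in the coordinate hyperplanes and rotations by $\pi/2$ in the coordinate planes. Let $m:[z_c-\delta_0,z_c)\to(0,\infty)$. Assume: (i) there are $\varepsilon>0$ and $K_1>0$ such that $\sum_{x\in\mathbb Z^d}|x|^{2+\varepsilon}|F_z^{(s)}(x)|\le K_1$ for all $z\in[z_c-\delta_0,z_c)$ and all $s\in[0,m(z))$; (ii) $\hat F_z^{(s)}(0)\ge 0$ for all $z\in[z_c-\delta_0,z_c)$ and all $s\in[0,m(z))$, and $\hat F_z(0)\to 0$ as $z\to z_c^-$; (iii) there is $K_2>0$ such that $\hat F_z(k)-\hat F_z(0)\ge K_2|k|^2$ for all $k\in\mathbb T^d$ and all $z\in[z_c-\delta_0,z_c)$;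 (iv) $m(z)\to 0$ as $z\to z_c^-$; (v) if $d>4$, then for some real $p$ with $1\le p<d/4$, $$\sup_{z\in[z_c-\delta_0,z_c)}\ \sup_{0\le s<m(z)}\big\|\,|x|^{d-2}F_z^{(s)}(x)\big\|_{\ell^{\min(p,2)}(\mathbb Z^d)}<\infty .$$ For $z\in[z_c-\delta_0,z_c)$ let $$G_z(x)=\int_{\mathbb T^d}\frac{e^{-ik\cdot x}}{\hat F_z(k)}\,\frac{dk}{(2\pi)^d}\qquad(x\in\mathbb Z^d).$$ This integral converges absolutely, is real, and satisfies $\sum_{y\in\mathbb Z^d}F_z(y)G_z(x-y)=\mathbf 1\{x=0\}$ for all $x\in\mathbb Z^d$. Moreover, there are constants $c_0>0$, $c_1\in(0,1)$ and $\delta\in(0,\delta_0]$ such that for all $z\in[z_c-\delta,z_c)$ and all $x\in\mathbb Z^d$, $$G_z(x)\le\frac{c_0}{\max\{|x|,1\}^{d-2}}\,e^{-c_1m(z)|x|}.$$ -/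

import Mathlib

namespace NearCritical

open MeasureTheory Filter Topology

noncomputable section

/-- Euclidean norm of a vector given by its coordinates. -/
def euclNorm {d : ℕ} (v : Fin d → ℝ) : ℝ := ‖WithLp.toLp 2 v‖

/-- Euclidean norm `|x|` of a lattice point. -/
def latNorm {d : ℕ} (x : Fin d → ℤ) : ℝ := euclNorm fun i => (x i : ℝ)

/-- The inner product `k · x` of a wave vector and a lattice point. -/
def phase {d : ℕ} (k : Fin d → ℝ) (x : Fin d → ℤ) : ℝ := ∑ i, k i * (x i : ℝ)

/-- The torus `(ℝ/2πℤ)^d`, identified with `(-π, π]^d`. -/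
def torus (d : ℕ) : Set (Fin d → ℝ) :=
  Set.univ.pi fun _ => Set.Ioc (-Real.pi) Real.pi

/-- Fourier transform `∑_x f(x) e^{i k·x}` of a function on the lattice. -/
def fourier {d : ℕ} (f : (Fin d → ℤ) → ℝ) (k : Fin d → ℝ) : ℂ :=
  ∑' x, (f x : ℂ) * Complex.exp (Complex.I * (phase k x : ℂ))

/-- Exponential tilting `f^{(m)}(x) = f(x) e^{m x_1}`; the first coordinate has index `0`. -/
def tilt {d : ℕ} [NeZero d] (m : ℝ) (f : (Fin d → ℤ) → ℝ) (x : Fin d → ℤ) : ℝ :=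
  f x * Real.exp (m * (x 0 : ℝ))

/-- Reflection in the `i`-th coordinate hyperplane. -/
def reflect {d : ℕ} (i : Fin d) (x : Fin d → ℤ) : Fin d → ℤ :=
  Function.update x i (-x i)

/-- Rotation by `π/2` in the plane of the coordinates `i ≠ j`. -/
def rotate {d : ℕ} (i j : Fin d) (x : Fin d → ℤ) : Fin d → ℤ :=
  Function.update (Function.update x i (-x j)) j (x i)

/-- Invariance under reflections in coordinate hyperplanes and rotations by `π/2`. -/
structure IsLatticeSymmetric {d : ℕ} (f : (Fin d → ℤ) → ℝ) : Prop where
  reflect : ∀ i x, f (reflect i x) = f x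
  rotate : ∀ i j, i ≠ j → ∀ x, f (rotate i j x) = f x

/-- The standing assumption on the family `F z`, `z ∈ [zc - δ, zc)`, and the function `mass`.
For a lattice-symmetric real `F z` the values `fourier (F z) k` and
`fourier (tilt m (F z)) 0` are real, so that the inequalities are stated for real parts. -/
structure NearCriticalFamily {d : ℕ} [NeZero d] (zc δ : ℝ)
    (F : ℝ → (Fin d → ℤ) → ℝ) (mass : ℝ → ℝ) : Prop where
  zc_pos : 0 < zc
  delta_pos : 0 < δ
  symm : ∀ z ∈ Set.Ico (zc - δ) zc, IsLatticeSymmetric (F z)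
  mass_pos : ∀ z ∈ Set.Ico (zc - δ) zc, 0 < mass z
  moment : ∃ ε > 0, ∃ K₁ > 0, ∀ z ∈ Set.Ico (zc - δ) zc, ∀ m ∈ Set.Ico 0 (mass z),
    Summable (fun x : Fin d → ℤ => latNorm x ^ (2 + ε : ℝ) * |tilt m (F z) x|) ∧
    ∑' x : Fin d → ℤ, latNorm x ^ (2 + ε : ℝ) * |tilt m (F z) x| ≤ K₁
  fourier_zero_nonneg : ∀ z ∈ Set.Ico (zc - δ) zc, ∀ m ∈ Set.Ico 0 (mass z),
    0 ≤ (fourier (tilt m (F z)) 0).re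
  fourier_zero_tendsto : Tendsto (fun z => fourier (F z) 0) (𝓝[<] zc) (𝓝 0)
  infrared : ∃ K₂ > 0, ∀ z ∈ Set.Ico (zc - δ) zc, ∀ k ∈ torus d,
    K₂ * euclNorm k ^ 2 ≤ (fourier (F z) k).re - (fourier (F z) 0).re
  mass_tendsto : Tendsto mass (𝓝[<] zc) (𝓝 0)
  lp_bound : 4 < d → ∃ p : ℝ, 1 ≤ p ∧ p < (d : ℝ) / 4 ∧ ∃ K₃ : ℝ,
    ∀ z ∈ Set.Ico (zc - δ) zc, ∀ m ∈ Set.Ico 0 (mass z),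
      Summable (fun x : Fin d → ℤ => |latNorm x ^ (d - 2) * tilt m (F z) x| ^ min p 2) ∧
      (∑' x : Fin d → ℤ, |latNorm x ^ (d - 2) * tilt m (F z) x| ^ min p 2) ^ (1 / min p 2) ≤ K₃

/-- The function `x ↦ ∫_{T^d} e^{-i k·x} / f̂(k) dk/(2π)^d`. -/
def greenIntegral {d : ℕ} (f : (Fin d → ℤ) → ℝ) (x : Fin d → ℤ) : ℂ :=
  ((2 * Real.pi : ℝ) ^ d : ℂ)⁻¹ *
    ∫ k in torus d, Complex.exp (-(Complex.I * (phase k x : ℂ))) / fourier f k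

end

end NearCritical

/-! The exponential factor and the power of |x| come from two separate arguments, and both estimate
|G_z|.

Exponential factor. Write m for m(z), s for the tilt and S = Σ y₁² F(y). By reflection symmetry the
first moment of F vanishes, so the tilted transform at 0 equals F̂(0) + s² S / 2 up to O(s^{2+ε}),
and the infrared bound forces S ≤ -K₂. This concave parabola is still nonnegative at s = 3m/4, so
for s ≤ m/2 it is at least of order m² (`re_fourier_tilt_zero_ge`). The infrared bound survives
tilting with half its constant (`re_fourier_tilt_sub_ge`). Hence the real part of the tilted
transform is at least a constant times |k|² + m², so 1/F̂ extends holomorphically to a strip. Moving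
the first momentum component to imaginary part -m/2 extracts exp(-m x₁/2) (`integral_shift`).
Lattice symmetry lets x₁ be the largest coordinate in modulus.

Power law. It remains to bound ∫ e^{-ik·x} / f̂(k) dk by C / x₁^{d-2} uniformly in m, where f is F
tilted by m/2 (`exists_integral_inv_le`). Since f̂ need not be smooth enough for integration by
parts, f is cut off at a box of radius N = x₁. This changes f̂ by at most K/N², so adding a =
(K+1)/N² keeps the truncated symbol invertible. The resolvent expansion `inv_eq_sum_add` writes 1/f̂
through powers of 1/(f̂ + a), with an absolutely small remainder. In these powers f̂ is replaced by
the truncated symbol, and the result is integrated by parts many times in k₁.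

Taylor coefficients of order below T are bounded pointwise, by the second moment and the small
drift. Those of order at least T, and the discarded tail, are small only in a weighted L¹ sense,
`HighOrderBound`, and every estimate is arranged to be linear in them. By scaling, each contribution
is then of order N^{-(d-2)}. For d ≤ 4 `HighOrderBound` follows from the 2+ε moment. For d > 4 it
follows from the ℓ^p hypothesis: a level splitting with Parseval on dyadic boxes makes |k|^{-4}
integrable against the transform exactly because p < d/4. -/

namespace NearCritical

open MeasureTheory Filter Topology

noncomputable section

/-! ### Fourier analysis on the lattice and the torus -/

section Basic

variable {d : ℕ}

lemma abs_coord_le_latNorm (x : Fin d → ℤ) (i : Fin d) : |(x i : ℝ)| ≤ latNorm x := by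
  have := PiLp.norm_apply_le (p := 2) (WithLp.toLp 2 fun i => (x i : ℝ)) i
  simpa [latNorm, euclNorm] using this

lemma latNorm_nonneg (x : Fin d → ℤ) : 0 ≤ latNorm x := norm_nonneg _

lemma one_le_latNorm {x : Fin d → ℤ} (hx : x ≠ 0) : 1 ≤ latNorm x := by
  obtain ⟨i, hi⟩ := Function.ne_iff.1 hx
  refine le_trans ?_ (abs_coord_le_latNorm x i)
  have : (1 : ℤ) ≤ |x i| := Int.one_le_abs hi
  exact_mod_cast this

lemma latNorm_zero : latNorm (0 : Fin d → ℤ) = 0 := by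
  have : (fun i : Fin d => (((0 : Fin d → ℤ) i : ℤ) : ℝ)) = 0 := by ext; simp
  simp only [latNorm, euclNorm, this]
  simp

lemma norm_le_euclNorm (k : Fin d → ℝ) : ‖k‖ ≤ euclNorm k := by
  refine (pi_norm_le_iff_of_nonneg (norm_nonneg _)).2 fun i => ?_
  exact PiLp.norm_apply_le (p := 2) (WithLp.toLp 2 k) i

lemma latNorm_le_sqrt_mul {x : Fin d → ℤ} {r : ℝ} (hr : ∀ i, |(x i : ℝ)| ≤ r) :
    latNorm x ≤ √d * r := by
  rcases Nat.eq_zero_or_pos d with rfl | hd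
  · have : x = 0 := Subsingleton.elim _ _
    rw [this, latNorm_zero]; simp
  have hr0 : 0 ≤ r := (abs_nonneg _).trans (hr ⟨0, hd⟩)
  rw [latNorm, euclNorm, EuclideanSpace.norm_eq]
  calc √(∑ i, ‖(x i : ℝ)‖ ^ 2) ≤ √(∑ _i : Fin d, r ^ 2) := by
        gcongr with i
        exact hr i
    _ = √d * r := by simp [Real.sqrt_sq hr0]

lemma abs_phase_le (k : Fin d → ℝ) (x : Fin d → ℤ) : |phase k x| ≤ d * ‖k‖ * latNorm x := by
  calc |phase k x| ≤ ∑ i, |k i * x i| := Finset.abs_sum_le_sum_abs _ _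
    _ ≤ ∑ _i : Fin d, ‖k‖ * latNorm x := by
        gcongr with i
        rw [abs_mul]
        gcongr
        · exact norm_le_pi_norm k i
        · exact abs_coord_le_latNorm x i
    _ = _ := by simp; ring

@[fun_prop]
lemma continuous_phase (x : Fin d → ℤ) : Continuous fun k : Fin d → ℝ => phase k x := by
  unfold phase; fun_prop

lemma phase_sub (k : Fin d → ℝ) (x y : Fin d → ℤ) : phase k (x - y) = phase k x - phase k y := by
  simp [phase, mul_sub, Finset.sum_sub_distrib]

lemma phase_neg (k : Fin d → ℝ) (x : Fin d → ℤ) : phase k (-x) = -phase k x := by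
  simp [phase]

lemma phase_neg_left (k : Fin d → ℝ) (x : Fin d → ℤ) : phase (-k) x = -phase k x := by
  simp [phase]

lemma phase_zero_left (x : Fin d → ℤ) : phase 0 x = 0 := by simp [phase]

lemma norm_exp_I_phase (k : Fin d → ℝ) (x : Fin d → ℤ) :
    ‖Complex.exp (Complex.I * (phase k x : ℂ))‖ = 1 := by
  rw [mul_comm]; exact Complex.norm_exp_ofReal_mul_I _

lemma norm_exp_neg_I_phase (k : Fin d → ℝ) (x : Fin d → ℤ) :
    ‖Complex.exp (-(Complex.I * (phase k x : ℂ)))‖ = 1 := by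
  rw [← norm_exp_I_phase k (-x), phase_neg]; push_cast; ring_nf

lemma summable_fourier {f : (Fin d → ℤ) → ℝ} (hf : Summable fun x => |f x|) (k : Fin d → ℝ) :
    Summable fun x => (f x : ℂ) * Complex.exp (Complex.I * (phase k x : ℂ)) := by
  refine Summable.of_norm ?_
  simpa [norm_exp_I_phase] using hf

lemma norm_fourier_le {f : (Fin d → ℤ) → ℝ} (hf : Summable fun x => |f x|) (k : Fin d → ℝ) :
    ‖fourier f k‖ ≤ ∑' x, |f x| := by
  refine (norm_tsum_le_tsum_norm ?_).trans_eq ?_ <;> simp [hf]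

lemma continuous_fourier {f : (Fin d → ℤ) → ℝ} (hf : Summable fun x => |f x|) :
    Continuous (fourier f) := by
  refine continuous_tsum (fun x => by fun_prop) hf fun x k => ?_
  simp

lemma phase_add_two_pi (k : Fin d → ℝ) (n x : Fin d → ℤ) :
    Complex.exp (Complex.I * (phase (fun i => k i + n i * (2 * Real.pi)) x : ℂ))
      = Complex.exp (Complex.I * (phase k x : ℂ)) := by
  rw [Complex.exp_eq_exp_iff_exists_int]
  refine ⟨∑ i, n i * x i, ?_⟩
  simp only [phase]
  push_cast
  simp only [add_mul, Finset.sum_add_distrib, Finset.mul_sum, Finset.sum_mul, mul_add]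
  congr 1
  refine Finset.sum_congr rfl fun i _ => ?_
  ring

lemma fourier_add_two_pi (f : (Fin d → ℤ) → ℝ) (k : Fin d → ℝ) (n : Fin d → ℤ) :
    fourier f (fun i => k i + n i * (2 * Real.pi)) = fourier f k := by
  simp only [fourier, phase_add_two_pi]

lemma exists_torus_representative (k : Fin d → ℝ) :
    ∃ k₀ ∈ torus d, ∃ n : Fin d → ℤ, k = fun i => k₀ i + n i * (2 * Real.pi) := by
  have hp : (0 : ℝ) < 2 * Real.pi := Real.two_pi_pos
  refine ⟨fun i => toIocMod hp (-Real.pi) (k i), fun i _ => ?_,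
    fun i => toIocDiv hp (-Real.pi) (k i), ?_⟩
  · have := toIocMod_mem_Ioc hp (-Real.pi) (k i)
    convert this using 1
    ring_nf
  · ext i
    simp

/-- Periodicity by 2π. Continuity of the inverse symbols and the absence of zeros in the strip need
information at all k, while the hypotheses speak of the half-open torus only. -/
lemma forall_fourier_of_torus {f : (Fin d → ℤ) → ℝ} {p : ℂ → Prop}
    (h : ∀ k ∈ torus d, p (fourier f k)) (k : Fin d → ℝ) : p (fourier f k) := by
  obtain ⟨k₀, hk₀, n, rfl⟩ := exists_torus_representative k
  rw [fourier_add_two_pi]; exact h _ hk₀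

lemma measurableSet_torus : MeasurableSet (torus d) :=
  MeasurableSet.univ_pi fun _ => measurableSet_Ioc

lemma norm_le_pi_of_mem_torus {k : Fin d → ℝ} (hk : k ∈ torus d) : ‖k‖ ≤ Real.pi := by
  refine (pi_norm_le_iff_of_nonneg Real.pi_pos.le).2 fun i => ?_
  have := hk i trivial
  rw [Real.norm_eq_abs, abs_le]
  exact ⟨this.1.le, this.2⟩

lemma torus_subset_closedBall : torus d ⊆ Metric.closedBall 0 Real.pi := fun _ hk => by
  simpa using norm_le_pi_of_mem_torus hk

lemma volume_torus : volume (torus d) = ENNReal.ofReal ((2 * Real.pi) ^ d) := by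
  rw [torus, Real.volume_pi_Ioc]
  simp only [Finset.prod_const, Finset.card_univ, Fintype.card_fin]
  rw [← ENNReal.ofReal_pow (by linarith [Real.pi_pos])]
  congr 2; ring

lemma integrableOn_torus_of_continuous {E : Type*} [NormedAddCommGroup E]
    {f : (Fin d → ℝ) → E} (hf : Continuous f) :
    IntegrableOn f (torus d) :=
  (hf.continuousOn.integrableOn_compact (isCompact_closedBall 0 Real.pi)).mono_set
    torus_subset_closedBall

lemma integral_torus_exp (x : Fin d → ℤ) :
    ∫ k in torus d, Complex.exp (Complex.I * (phase k x : ℂ))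
      = if x = 0 then ((2 * Real.pi : ℝ) ^ d : ℂ) else 0 := by
  have h1 : ∀ n : ℤ, ∫ t in Set.Ioc (-Real.pi) Real.pi, Complex.exp (Complex.I * n * (t : ℂ))
      = if n = 0 then (2 * Real.pi : ℂ) else 0 := by
    intro n
    rw [← intervalIntegral.integral_of_le (by linarith [Real.pi_pos])]
    split_ifs with hn
    · subst hn; simp; norm_cast; ring
    · rw [integral_exp_mul_complex (by simp [hn])]
      rw [div_eq_zero_iff]; left
      rw [sub_eq_zero, Complex.exp_eq_exp_iff_exists_int]
      exact ⟨n, by push_cast; ring⟩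
  have h2 : ∀ k : Fin d → ℝ, Complex.exp (Complex.I * (phase k x : ℂ))
      = ∏ i, Complex.exp (Complex.I * (x i : ℤ) * (k i : ℂ)) := by
    intro k
    rw [← Complex.exp_sum, phase]
    push_cast
    rw [Finset.mul_sum]
    congr 1
    exact Finset.sum_congr rfl fun i _ => by ring
  simp_rw [h2]
  rw [torus, volume_pi, Measure.restrict_pi_pi]
  rw [integral_fintype_prod_eq_prod (fun i (t : ℝ) => Complex.exp (Complex.I * (x i : ℤ) * (t : ℂ)))]
  simp_rw [h1]
  split_ifs with hx
  · subst hx; simp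
  · obtain ⟨i, hi⟩ := Function.ne_iff.1 hx
    exact Finset.prod_eq_zero (Finset.mem_univ i) (if_neg hi)

/-- Sum and integral are exchanged by absolute convergence. Different choices of φ give Fourier
inversion, Parseval's identity and the convolution equation for the Green function. -/
lemma hasSum_mul_integral {g : (Fin d → ℤ) → ℝ} (hg : Summable fun x => |g x|)
    {φ : (Fin d → ℝ) → ℂ} (hφ : IntegrableOn φ (torus d)) :
    HasSum (fun y => (g y : ℂ) * ∫ k in torus d, Complex.exp (Complex.I * (phase k y : ℂ)) * φ k)
      (∫ k in torus d, fourier g k * φ k) := by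
  have hm : ∀ y, Integrable (fun k => (g y : ℂ) * (Complex.exp (Complex.I * (phase k y : ℂ)) * φ k))
      (volume.restrict (torus d)) := fun y => by
    refine Integrable.const_mul ?_ _
    refine hφ.bdd_mul (c := 1) (Continuous.aestronglyMeasurable (by fun_prop)) ?_
    exact Eventually.of_forall fun k => (norm_exp_I_phase k y).le
  have := hasSum_integral_of_summable_integral_norm hm ?_
  · simp_rw [integral_const_mul] at this
    have h2 : ∀ k, fourier g k * φ k =
        ∑' y, (g y : ℂ) * (Complex.exp (Complex.I * (phase k y : ℂ)) * φ k) := fun k => by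
      simp only [fourier, ← tsum_mul_right, mul_assoc]
    simpa only [h2] using this
  · simp only [norm_mul, norm_exp_I_phase, one_mul, integral_const_mul]
    simpa using hg.mul_right _

lemma integral_fourier_mul_exp {g : (Fin d → ℤ) → ℝ} (hg : Summable fun x => |g x|)
    (x : Fin d → ℤ) :
    ∫ k in torus d, fourier g k * Complex.exp (-(Complex.I * (phase k x : ℂ)))
      = ((2 * Real.pi : ℝ) ^ d : ℂ) * g x := by
  have h := hasSum_mul_integral hg (φ := fun k => Complex.exp (-(Complex.I * (phase k x : ℂ))))
    (integrableOn_torus_of_continuous (by fun_prop))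
  refine h.unique ?_
  have : ∀ y, ∫ k in torus d, Complex.exp (Complex.I * (phase k y : ℂ)) *
      Complex.exp (-(Complex.I * (phase k x : ℂ)))
      = if y = x then ((2 * Real.pi : ℝ) ^ d : ℂ) else 0 := by
    intro y
    have h0 := integral_torus_exp (y - x)
    simp only [sub_eq_zero] at h0
    rw [← h0]
    congr 1; ext k
    rw [← Complex.exp_add, phase_sub]; push_cast; ring_nf
  simp_rw [this]
  convert hasSum_ite_eq x (((2 * Real.pi : ℝ) ^ d : ℂ) * g x) using 2 with y
  split_ifs with h
  · subst h; ring
  · simp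

lemma integral_norm_fourier_sq {g : (Fin d → ℤ) → ℝ} (hg : Summable fun x => |g x|) :
    ∫ k in torus d, ‖fourier g k‖ ^ 2 = (2 * Real.pi) ^ d * ∑' x, g x ^ 2 := by
  have hc := continuous_fourier hg
  have h := hasSum_mul_integral hg (φ := fun k => starRingEnd ℂ (fourier g k))
    (integrableOn_torus_of_continuous (Complex.continuous_conj.comp hc))
  have h2 : ∀ y, ∫ k in torus d, Complex.exp (Complex.I * (phase k y : ℂ)) *
      starRingEnd ℂ (fourier g k) = ((2 * Real.pi : ℝ) ^ d : ℂ) * g y := by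
    intro y
    have := congrArg (starRingEnd ℂ) (integral_fourier_mul_exp hg y)
    rw [← integral_conj] at this
    simp only [map_mul, map_pow, Complex.conj_ofReal] at this
    rw [← this]
    congr 1; ext k
    rw [← Complex.exp_conj, mul_comm]
    simp
  simp_rw [h2] at h
  have h3 : ∀ k, fourier g k * starRingEnd ℂ (fourier g k) = ((‖fourier g k‖ ^ 2 : ℝ) : ℂ) := by
    intro k; rw [Complex.mul_conj, Complex.normSq_eq_norm_sq]
  simp_rw [h3] at h
  rw [integral_complex_ofReal] at h
  have h4 : HasSum (fun y => (2 * Real.pi) ^ d * g y ^ 2) (∫ k in torus d, ‖fourier g k‖ ^ 2) := by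
    rw [← Complex.hasSum_ofReal]
    convert h using 2 with y
    push_cast; ring
  rw [← tsum_mul_left]
  exact h4.tsum_eq.symm

/-- Fubini, isolating the first momentum component, in which both the integration by parts and the
contour shift take place. -/
lemma integral_torus_succ {n : ℕ} {f : (Fin (n + 1) → ℝ) → ℂ}
    (hf : IntegrableOn f (torus (n + 1))) :
    ∫ k in torus (n + 1), f k =
      ∫ k' in torus n, ∫ t in (-Real.pi)..Real.pi, f (Matrix.vecCons t k') := by
  have hmp := (volume_preserving_piFinSuccAbove (fun _ : Fin (n + 1) => ℝ) 0).symm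
  have hpre : (MeasurableEquiv.piFinSuccAbove (fun _ : Fin (n + 1) => ℝ) 0).symm ⁻¹' torus (n + 1)
      = Set.Ioc (-Real.pi) Real.pi ×ˢ torus n := by
    ext ⟨t, k'⟩
    simp [torus, MeasurableEquiv.piFinSuccAbove, Fin.forall_fin_succ]
  have hemb := (MeasurableEquiv.piFinSuccAbove (fun _ : Fin (n + 1) => ℝ) 0).symm.measurableEmbedding
  rw [← hmp.setIntegral_preimage_emb hemb, hpre]
  have hInt : IntegrableOn
      (f ∘ (MeasurableEquiv.piFinSuccAbove (fun _ : Fin (n + 1) => ℝ) 0).symm)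
      (Set.Ioc (-Real.pi) Real.pi ×ˢ torus n) (volume.prod volume) := by
    rw [← hpre]
    exact (hmp.integrableOn_comp_preimage hemb).2 hf
  rw [Measure.volume_eq_prod, ← setIntegral_prod_swap, setIntegral_prod]
  · refine setIntegral_congr_fun measurableSet_torus fun k' _ => ?_
    rw [intervalIntegral.integral_of_le (by linarith [Real.pi_pos])]
    refine integral_congr_ae (Eventually.of_forall fun t => ?_)
    simp [MeasurableEquiv.piFinSuccAbove, Matrix.vecCons]
    rfl
  · exact hInt.swap

end Basic

end

end NearCritical

namespace NearCritical

open MeasureTheory Filter Topology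

noncomputable section

/-! ### Singular integrals over the torus and L¹ bounds near k = 0 -/

section Singular

variable {d : ℕ}

lemma integrableOn_torus_norm_rpow (hd : 1 ≤ d) {s : ℝ} (hs : s < d) :
    IntegrableOn (fun k : Fin d → ℝ => ‖k‖ ^ (-s)) (torus d) := by
  have h := locallyIntegrable_of_norm_le_rpow (μ := (volume : Measure (Fin d → ℝ)))
    (f := fun k : Fin d → ℝ => ‖k‖ ^ (-s)) (C := 1) (α := s) (by simpa using hd)
    (by simpa using hs) (Eventually.of_forall fun k => by
      rw [one_mul, Real.norm_of_nonneg (by positivity)])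
    (Measurable.aestronglyMeasurable (by fun_prop))
  exact (h.integrableOn_isCompact (isCompact_closedBall 0 Real.pi)).mono_set
    torus_subset_closedBall

/-- The scale-invariant profile dominating the low-frequency contributions. -/
lemma integrable_profile (hd : 2 < d) :
    Integrable fun k : Fin d → ℝ => (‖k‖ ^ 2)⁻¹ * ((1 + ‖k‖ ^ 2) ^ d)⁻¹ := by
  have hmeas : AEStronglyMeasurable
      (fun k : Fin d → ℝ => (‖k‖ ^ 2)⁻¹ * ((1 + ‖k‖ ^ 2) ^ d)⁻¹) volume :=
    Measurable.aestronglyMeasurable (by fun_prop)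
  have hd' : (2 : ℝ) < d := by exact_mod_cast hd
  rw [← integrableOn_univ, ← Set.union_compl_self (Metric.ball (0 : Fin d → ℝ) 1)]
  refine IntegrableOn.union ?_ ?_
  · refine integrableOn_ball_of_norm_le_rpow (C := 1) (α := 2) (by simp; omega)
      (by simpa using hd') (Eventually.of_forall fun k => ?_) hmeas
    rw [Real.norm_of_nonneg (by positivity), Real.rpow_neg (norm_nonneg _), one_mul]
    norm_cast
    refine mul_le_of_le_one_right (by positivity) (inv_le_one_of_one_le₀ (one_le_pow₀ ?_))
    nlinarith [sq_nonneg ‖k‖]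
  · have h := integrable_rpow_neg_one_add_norm_sq (E := Fin d → ℝ) (μ := volume)
      (r := 2 * d) (by simp; linarith)
    refine Integrable.mono' h.integrableOn hmeas.restrict ?_
    refine (ae_restrict_iff' Metric.isOpen_ball.measurableSet.compl).2
      (Eventually.of_forall fun k hk => ?_)
    have hk1 : 1 ≤ ‖k‖ := by simpa using hk
    rw [Real.norm_of_nonneg (by positivity)]
    have : (-(2 * (d : ℝ)) / 2) = -(d : ℝ) := by ring
    rw [this, Real.rpow_neg (by positivity), Real.rpow_natCast]
    exact mul_le_of_le_one_left (by positivity) (inv_le_one_of_one_le₀ (one_le_pow₀ hk1))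

/-- Scaling k ↦ Rk: the inverse square contributes R² and the Jacobian R^{-d}. -/
lemma exists_integral_profile_le (hd : 2 < d) :
    ∃ C > 0, ∀ R : ℝ, 0 < R →
      IntegrableOn (fun k : Fin d → ℝ => (‖k‖ ^ 2)⁻¹ * ((1 + R ^ 2 * ‖k‖ ^ 2) ^ d)⁻¹) (torus d) ∧
      ∫ k in torus d, (‖k‖ ^ 2)⁻¹ * ((1 + R ^ 2 * ‖k‖ ^ 2) ^ d)⁻¹ ≤ C / R ^ (d - 2) := by
  set φ := fun k : Fin d → ℝ => (‖k‖ ^ 2)⁻¹ * ((1 + ‖k‖ ^ 2) ^ d)⁻¹ with hφ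
  have hφi : Integrable φ := integrable_profile hd
  have hφ0 : ∀ k, 0 ≤ φ k := fun k => by positivity
  refine ⟨(∫ k, φ k) + 1, by have : 0 ≤ ∫ k, φ k := integral_nonneg hφ0; linarith, fun R hR => ?_⟩
  have heq : (fun k : Fin d → ℝ => (‖k‖ ^ 2)⁻¹ * ((1 + R ^ 2 * ‖k‖ ^ 2) ^ d)⁻¹)
      = fun k => R ^ 2 * φ (R • k) := by
    funext k
    simp only [hφ, norm_smul, Real.norm_of_nonneg hR.le, mul_pow]
    rw [mul_inv (R ^ 2)]
    have : R ^ 2 ≠ 0 := by positivity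
    rw [← mul_assoc, ← mul_assoc, mul_inv_cancel₀ this, one_mul]
  have hInt : Integrable fun k => R ^ 2 * φ (R • k) := (hφi.comp_smul hR.ne').const_mul _
  rw [heq]
  refine ⟨hInt.integrableOn, ?_⟩
  calc ∫ k in torus d, R ^ 2 * φ (R • k) ≤ ∫ k, R ^ 2 * φ (R • k) :=
        setIntegral_le_integral hInt (Eventually.of_forall fun k => by
          have := hφ0 (R • k); positivity)
    _ = R ^ 2 * ((R ^ d)⁻¹ * ∫ k, φ k) := by
        rw [integral_const_mul, Measure.integral_comp_smul_of_nonneg _ _ R (hR := hR.le)]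
        simp
    _ = (∫ k, φ k) / R ^ (d - 2) := by
        have : R ^ d = R ^ (d - 2) * R ^ 2 := by rw [← pow_add]; congr 1; omega
        rw [this]; field_simp
    _ ≤ _ := by gcongr; linarith

/-- The ℓ¹ half of the splitting of an ℓ^q function at level l; the next lemma is the ℓ² half. -/
lemma summable_abs_rpow_gt {g : (Fin d → ℤ) → ℝ} {q l : ℝ} (hq : 1 ≤ q) (hl : 0 < l)
    (hgq : Summable fun x => |g x| ^ q) :
    ∑' x, |if l < |g x| then g x else 0| ≤ l ^ (1 - q) * ∑' x, |g x| ^ q ∧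
    Summable fun x => |if l < |g x| then g x else 0| := by
  have hle : ∀ x, |if l < |g x| then g x else 0| ≤ l ^ (1 - q) * |g x| ^ q := fun x => by
    split_ifs with h
    · have hg : 0 < |g x| := hl.trans h
      calc |g x| = |g x| ^ (1 - q) * |g x| ^ q := by
            rw [← Real.rpow_add hg]; simp
        _ ≤ l ^ (1 - q) * |g x| ^ q := by
            gcongr ?_ * _
            exact Real.rpow_le_rpow_of_nonpos hl h.le (by linarith)
    · simp; positivity
  have hs := Summable.of_nonneg_of_le (fun x => abs_nonneg _) hle (hgq.mul_left _)
  refine ⟨?_, hs⟩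
  rw [← tsum_mul_left]
  exact hs.tsum_le_tsum hle (hgq.mul_left _)

lemma tsum_sq_le_rpow {g : (Fin d → ℤ) → ℝ} {q l : ℝ} (hq2 : q ≤ 2) (hl : 0 < l)
    (hgq : Summable fun x => |g x| ^ q) :
    ∑' x, (if l < |g x| then 0 else g x) ^ 2 ≤ l ^ (2 - q) * ∑' x, |g x| ^ q := by
  have hle : ∀ x, (if l < |g x| then 0 else g x) ^ 2 ≤ l ^ (2 - q) * |g x| ^ q := fun x => by
    split_ifs with h
    · simp; positivity
    · rcases eq_or_lt_of_le (abs_nonneg (g x)) with h0 | h0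
      · rw [eq_comm, abs_eq_zero] at h0
        simp [h0]; positivity
      calc (g x) ^ 2 = |g x| ^ (2 - q) * |g x| ^ q := by
            rw [← Real.rpow_add h0]; simp
        _ ≤ l ^ (2 - q) * |g x| ^ q := by
            gcongr ?_ * _
            exact Real.rpow_le_rpow h0.le (not_lt.1 h) (by linarith)
  have hs := Summable.of_nonneg_of_le (fun x => sq_nonneg _) hle (hgq.mul_left _)
  rw [← tsum_mul_left]
  exact hs.tsum_le_tsum hle (hgq.mul_left _)

lemma fourier_add {f g : (Fin d → ℤ) → ℝ} (hf : Summable fun x => |f x|)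
    (hg : Summable fun x => |g x|) (k : Fin d → ℝ) :
    fourier (fun x => f x + g x) k = fourier f k + fourier g k := by
  simp only [fourier]
  rw [← (summable_fourier hf k).tsum_add (summable_fourier hg k)]
  refine tsum_congr fun x => ?_
  push_cast; ring

lemma volume_closedBall_pi {r : ℝ} (hr : 0 ≤ r) :
    volume.real (Metric.closedBall (0 : Fin d → ℝ) (Real.pi * r)) = (2 * Real.pi) ^ d * r ^ d := by
  rw [measureReal_def, Real.volume_pi_closedBall _ (by positivity), ENNReal.toReal_ofReal
    (by positivity)]
  simp only [Fintype.card_fin]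
  rw [← mul_pow]; ring

/-- Local `L¹` bound on small boxes; it replaces the Hausdorff–Young inequality. -/
lemma setIntegral_norm_fourier_le {g : (Fin d → ℤ) → ℝ} {q l r S : ℝ} (hq : 1 ≤ q) (hq2 : q ≤ 2)
    (hl : 0 < l) (hr : 0 ≤ r) (hlr : r ^ d = l ^ q) (hg : Summable fun x => |g x|)
    (hgq : Summable fun x => |g x| ^ q) (hS : ∑' x, |g x| ^ q ≤ S) :
    ∫ k in torus d ∩ Metric.closedBall 0 (Real.pi * r), ‖fourier g k‖
      ≤ (2 * Real.pi) ^ d * (1 + 2 * S) * l := by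
  have hS0 : 0 ≤ S := (tsum_nonneg fun x => by positivity).trans hS
  set g₁ := fun x => if l < |g x| then g x else 0 with hg₁
  set g₂ := fun x => if l < |g x| then 0 else g x with hg₂
  obtain ⟨h1, hs1⟩ := summable_abs_rpow_gt hq hl hgq
  have h2 := tsum_sq_le_rpow hq2 hl hgq
  have hs2 : Summable fun x => |g₂ x| := by
    refine Summable.of_nonneg_of_le (fun x => abs_nonneg _) (fun x => ?_) hg
    simp only [hg₂]; split_ifs <;> simp
  have hsum : ∀ k, fourier g k = fourier g₁ k + fourier g₂ k := fun k => by
    rw [← fourier_add hs1 hs2]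
    congr 1; funext x
    simp only [hg₂]; split_ifs <;> simp
  have hP := integral_norm_fourier_sq hs2
  set U := torus d ∩ Metric.closedBall (0 : Fin d → ℝ) (Real.pi * r) with hU
  have hUm : MeasurableSet U := measurableSet_torus.inter Metric.isClosed_closedBall.measurableSet
  have hlq : 0 < l ^ (1 - q) := by positivity
  -- The large values are bounded in sup norm, the small ones by AM-GM with weight l^(1-q), which
  -- prepares for Parseval. On a box of volume proportional to l^q both contributions have order l.
  have hpt : ∀ k, ‖fourier g k‖ ≤ l ^ (1 - q) * (S + 1 / 2) +
      (l ^ (q - 1) / 2) * ‖fourier g₂ k‖ ^ 2 := fun k => by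
    have e1 : ‖fourier g₁ k‖ ≤ l ^ (1 - q) * S :=
      (norm_fourier_le hs1 k).trans (h1.trans (by gcongr))
    have e2 : ‖fourier g₂ k‖ ≤ l ^ (1 - q) / 2 + (l ^ (q - 1) / 2) * ‖fourier g₂ k‖ ^ 2 := by
      have : l ^ (q - 1) = (l ^ (1 - q))⁻¹ := by rw [← Real.rpow_neg hl.le]; ring_nf
      rw [this]
      set μ := l ^ (1 - q)
      have := sq_nonneg (μ - ‖fourier g₂ k‖)
      rw [← sub_nonneg]
      have e : μ / 2 + μ⁻¹ / 2 * ‖fourier g₂ k‖ ^ 2 - ‖fourier g₂ k‖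
        = (μ - ‖fourier g₂ k‖) ^ 2 / (2 * μ) := by field_simp; ring
      rw [e]; positivity
    have := norm_add_le (fourier g₁ k) (fourier g₂ k)
    rw [hsum]; linarith
  have hi2 : IntegrableOn (fun k => ‖fourier g₂ k‖ ^ 2) (torus d) :=
    integrableOn_torus_of_continuous ((continuous_fourier hs2).norm.pow 2)
  have hUt : U ⊆ torus d := Set.inter_subset_left
  have : IsFiniteMeasure (volume.restrict U) :=
    ⟨by rw [Measure.restrict_apply_univ]
        exact (measure_mono hUt).trans_lt (by rw [volume_torus]; exact ENNReal.ofReal_lt_top)⟩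
  have hvol : volume.real U ≤ (2 * Real.pi) ^ d * l ^ q := by
    rw [← hlr, ← volume_closedBall_pi hr]
    exact measureReal_mono Set.inter_subset_right (by
      exact (isCompact_closedBall (0 : Fin d → ℝ) _).measure_lt_top.ne)
  calc ∫ k in U, ‖fourier g k‖
      ≤ ∫ k in U, (l ^ (1 - q) * (S + 1 / 2) + (l ^ (q - 1) / 2) * ‖fourier g₂ k‖ ^ 2) := by
        refine setIntegral_mono_on ?_ ?_ hUm fun k _ => hpt k
        · exact (integrableOn_torus_of_continuous (continuous_fourier hg).norm).mono_set hUt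
        · exact (integrable_const _).add ((hi2.mono_set hUt).const_mul _)
    _ = volume.real U * (l ^ (1 - q) * (S + 1 / 2)) +
          (l ^ (q - 1) / 2) * ∫ k in U, ‖fourier g₂ k‖ ^ 2 := by
        rw [integral_add (integrable_const _) ((hi2.mono_set hUt).const_mul _),
          setIntegral_const, smul_eq_mul, integral_const_mul]
    _ ≤ ((2 * Real.pi) ^ d * l ^ q) * (l ^ (1 - q) * (S + 1 / 2)) +
          (l ^ (q - 1) / 2) * ((2 * Real.pi) ^ d * (l ^ (2 - q) * S)) := by
        gcongr
        refine (setIntegral_mono_set hi2 (Eventually.of_forall fun k => by positivity)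
          (Eventually.of_forall hUt)).trans ?_
        rw [hP]
        gcongr
        exact h2.trans (by gcongr)
    _ = (2 * Real.pi) ^ d * (1 / 2 + 3 / 2 * S) * l := by
        have e1 : l ^ q * l ^ (1 - q) = l := by rw [← Real.rpow_add hl]; simp
        have e2 : l ^ (q - 1) * l ^ (2 - q) = l := by rw [← Real.rpow_add hl]; ring_nf; simp
        calc _ = (2 * Real.pi) ^ d * (S + 1 / 2) * (l ^ q * l ^ (1 - q)) +
              (2 * Real.pi) ^ d * S / 2 * (l ^ (q - 1) * l ^ (2 - q)) := by ring
          _ = _ := by rw [e1, e2]; ring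
    _ ≤ _ := by gcongr <;> linarith

/-- Dyadic decomposition around 0: on the box of radius π 2^{-n} the weight costs 16^n and the local
L¹ bound gains b^n. The geometric series converges because q < d/4. -/
lemma exists_integral_fourier_mul_norm_inv_le {q S : ℝ} (hq : 1 ≤ q) (hq2 : q ≤ 2)
    (hqd : q < d / 4) (hS0 : 0 ≤ S) :
    ∃ C > 0, ∀ g : (Fin d → ℤ) → ℝ, (Summable fun x => |g x|) → (Summable fun x => |g x| ^ q) →
      ∑' x, |g x| ^ q ≤ S →
      IntegrableOn (fun k => ‖fourier g k‖ * (‖k‖ ^ 4)⁻¹) (torus d) ∧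
      ∫ k in torus d, ‖fourier g k‖ * (‖k‖ ^ 4)⁻¹ ≤ C := by
  have hd : (4 : ℝ) < d / q := by
    rw [lt_div_iff₀ (by linarith)]; linarith
  -- With r = 2^{-n} and l = b^n this is the value for which r^d = l^q, as the local bound requires.
  set b : ℝ := 2 ^ (-(d / q) : ℝ) with hb
  have hb0 : 0 < b := by positivity
  have hb1 : 16 * b < 1 := by
    have : b < 2 ^ (-4 : ℝ) := Real.rpow_lt_rpow_of_exponent_lt (by norm_num) (by linarith)
    have e : (2 : ℝ) ^ (-4 : ℝ) = 1 / 16 := by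
      rw [Real.rpow_neg (by norm_num)]; norm_num
    rw [e] at this; linarith
  set A : ℝ := (2 * Real.pi) ^ d * (1 + 2 * S) with hA
  have hA0 : 0 < A := by positivity
  set u : ℕ → ℝ := fun n => 16 / Real.pi ^ 4 * A * (16 * b) ^ n with hu
  have hus : Summable u := (summable_geometric_of_lt_one (by positivity) hb1).mul_left _
  have hu0 : ∀ n, 0 ≤ u n := fun n => by positivity
  refine ⟨∑' n, u n, hus.tsum_pos hu0 0 (by simp [hu]; positivity), fun g hg hgq hgS => ?_⟩
  have hpos : ∀ k : Fin d → ℝ, 0 ≤ ‖fourier g k‖ * (‖k‖ ^ 4)⁻¹ := fun k => by positivity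
  have hm : Measurable fun k : Fin d → ℝ => ‖fourier g k‖ * (‖k‖ ^ 4)⁻¹ := by
    have := (continuous_fourier hg).measurable
    fun_prop
  set W : ℕ → Set (Fin d → ℝ) := fun n => Metric.closedBall 0 (Real.pi * (1 / 2) ^ n) with hW
  have hWm : ∀ n, MeasurableSet (W n) := fun n => Metric.isClosed_closedBall.measurableSet
  have hgm : Measurable (fourier g) := (continuous_fourier hg).measurable
  have key : ∫⁻ k in torus d, ENNReal.ofReal (‖fourier g k‖ * (‖k‖ ^ 4)⁻¹)
      ≤ ENNReal.ofReal (∑' n, u n) := by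
    calc ∫⁻ k in torus d, ENNReal.ofReal (‖fourier g k‖ * (‖k‖ ^ 4)⁻¹)
        ≤ ∫⁻ k in torus d, ∑' n, (W n).indicator
            (fun k => ENNReal.ofReal (16 / Real.pi ^ 4 * 16 ^ n) * ENNReal.ofReal ‖fourier g k‖) k := by
          refine setLIntegral_mono' measurableSet_torus fun k hk => ?_
          -- At the origin the integrand is 0, by the convention 0⁻¹ = 0.
          rcases eq_or_ne k 0 with rfl | hk0
          · simp
          have hkp : 0 < ‖k‖ := norm_pos_iff.2 hk0
          obtain ⟨n, hn1, hn2⟩ := exists_nat_pow_near_of_lt_one (x := ‖k‖ / Real.pi)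
            (y := (1 / 2 : ℝ)) (by positivity)
            ((div_le_one Real.pi_pos).2 (norm_le_pi_of_mem_torus hk)) (by norm_num) (by norm_num)
          refine le_trans ?_ (ENNReal.le_tsum n)
          have hkW : k ∈ W n := by
            simp only [hW, mem_closedBall_zero_iff]
            rwa [div_le_iff₀' Real.pi_pos] at hn2
          rw [Set.indicator_of_mem hkW, ← ENNReal.ofReal_mul (by positivity), mul_comm]
          refine ENNReal.ofReal_le_ofReal ?_
          gcongr
          rw [lt_div_iff₀ Real.pi_pos] at hn1
          have : ((1 / 2 : ℝ) ^ (n + 1) * Real.pi) ^ 4 ≤ ‖k‖ ^ 4 := by gcongr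
          calc (‖k‖ ^ 4)⁻¹ ≤ (((1 / 2 : ℝ) ^ (n + 1) * Real.pi) ^ 4)⁻¹ := by gcongr
            _ = 16 / Real.pi ^ 4 * 16 ^ n := by
              rw [mul_pow, ← pow_mul, mul_comm (n + 1) 4, pow_mul, mul_inv, ← inv_pow]
              norm_num
              rw [pow_succ]; ring
      _ = ∑' n, ∫⁻ k in torus d, (W n).indicator
            (fun k => ENNReal.ofReal (16 / Real.pi ^ 4 * 16 ^ n) * ENNReal.ofReal ‖fourier g k‖) k := by
          refine lintegral_tsum fun n => ?_
          refine (Measurable.indicator ?_ (hWm n)).aemeasurable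
          fun_prop
      _ ≤ ∑' n, ENNReal.ofReal (u n) := by
          refine ENNReal.tsum_le_tsum fun n => ?_
          rw [lintegral_indicator (hWm n), Measure.restrict_restrict (hWm n), Set.inter_comm,
            lintegral_const_mul _ (by fun_prop)]
          have hInt : IntegrableOn (fun k => ‖fourier g k‖) (torus d ∩ W n) :=
            (integrableOn_torus_of_continuous (continuous_fourier hg).norm).mono_set
              Set.inter_subset_left
          rw [← ofReal_integral_eq_lintegral_ofReal hInt (Eventually.of_forall fun k => norm_nonneg _),
            ← ENNReal.ofReal_mul (by positivity)]
          refine ENNReal.ofReal_le_ofReal ?_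
          have hbd := setIntegral_norm_fourier_le (r := (1 / 2 : ℝ) ^ n) (l := b ^ n) hq hq2
            (by positivity) (by positivity) (by
              rw [← Real.rpow_natCast b n, ← Real.rpow_mul hb0.le, hb, ← Real.rpow_mul (by norm_num),
                ← pow_mul, ← Real.rpow_natCast, one_div, Real.inv_rpow (by norm_num),
                ← Real.rpow_neg (by norm_num)]
              congr 1; push_cast; field_simp) hg hgq hgS
          calc _ ≤ 16 / Real.pi ^ 4 * 16 ^ n * (A * b ^ n) := by gcongr
            _ = u n := by simp only [hu, mul_pow]; ring
      _ = _ := (ENNReal.ofReal_tsum_of_nonneg hu0 hus).symm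
  have hInt : IntegrableOn (fun k => ‖fourier g k‖ * (‖k‖ ^ 4)⁻¹) (torus d) := by
    refine ⟨hm.aestronglyMeasurable, ?_⟩
    rw [hasFiniteIntegral_iff_ofReal (Eventually.of_forall hpos)]
    exact key.trans_lt ENNReal.ofReal_lt_top
  refine ⟨hInt, ?_⟩
  rw [integral_eq_lintegral_of_nonneg_ae (Eventually.of_forall hpos) hm.aestronglyMeasurable]
  exact ENNReal.toReal_le_of_le_ofReal (tsum_nonneg hu0) key

end Singular

end

end NearCritical

namespace NearCritical

open MeasureTheory Filter Topology

noncomputable section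

/-! ### Formal Taylor series in the first momentum component and integration by parts -/

section Taylor

open PowerSeries

/-- A family of formal power series indexed by wave vectors whose `j`-th coefficient is `R⁻ʲ / j!`
times the `j`-th partial derivative of the constant coefficient in the first coordinate. -/
structure IsTaylorFamily {n : ℕ} (R : ℝ) (P : (Fin (n + 1) → ℝ) → PowerSeries ℂ) : Prop where
  cont : ∀ j, Continuous fun k => coeff j (P k)
  deriv : ∀ j k' t, HasDerivAt (fun t : ℝ => coeff j (P (Matrix.vecCons t k')))
    (R * coeff j (d⁄dX ℂ (P (Matrix.vecCons t k')))) t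
  periodic : ∀ j k', coeff j (P (Matrix.vecCons Real.pi k')) =
    coeff j (P (Matrix.vecCons (-Real.pi) k'))

namespace IsTaylorFamily

variable {n : ℕ} {R : ℝ} {P Q : (Fin (n + 1) → ℝ) → PowerSeries ℂ}

/-- The Leibniz rule for the formal derivative, read off at one coefficient. -/
lemma sum_antidiagonal_derivative (f g : PowerSeries ℂ) (j : ℕ) :
    ∑ p ∈ Finset.HasAntidiagonal.antidiagonal j, (R * coeff p.1 (d⁄dX ℂ f) * coeff p.2 g +
      coeff p.1 f * (R * coeff p.2 (d⁄dX ℂ g))) = R * coeff j (d⁄dX ℂ (f * g)) := by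
  rw [Derivation.leibniz, smul_eq_mul, smul_eq_mul, map_add, mul_comm g, coeff_mul, coeff_mul,
    ← Finset.sum_add_distrib, Finset.mul_sum]
  exact Finset.sum_congr rfl fun p _ => by ring

lemma mul (hP : IsTaylorFamily R P) (hQ : IsTaylorFamily R Q) :
    IsTaylorFamily R fun k => P k * Q k where
  cont j := by
    simp_rw [coeff_mul]
    exact continuous_finsetSum _ fun p _ => (hP.cont _).mul (hQ.cont _)
  deriv j k' t := by
    rw [← sum_antidiagonal_derivative]
    simp_rw [coeff_mul]
    exact HasDerivAt.fun_sum fun p _ => (hP.deriv _ _ _).mul (hQ.deriv _ _ _)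
  periodic j k' := by simp_rw [coeff_mul, hP.periodic, hQ.periodic]

lemma pow_succ (hP : IsTaylorFamily R P) (j : ℕ) : IsTaylorFamily R fun k => P k ^ (j + 1) := by
  induction j with
  | zero => simpa using hP
  | succ j ih => simpa only [_root_.pow_succ _ (j + 1)] using ih.mul hP

/-- The recursion for the coefficients of an inverse gives continuity, differentiability and
periodicity by strong induction. It would give the derivative only in an unwieldy form, so the
derivative is identified by differentiating P P⁻¹ = 1 instead. -/
lemma inv (hP : IsTaylorFamily R P) (h0 : ∀ k, constantCoeff (P k) ≠ 0) :
    IsTaylorFamily R fun k => (P k)⁻¹ where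
  cont j := by
    induction j using Nat.strong_induction_on with
    | _ j ih =>
    have hc : Continuous fun k => (constantCoeff (P k))⁻¹ := by
      have := hP.cont 0
      simp only [coeff_zero_eq_constantCoeff] at this
      exact this.inv₀ h0
    rw [funext fun k => coeff_inv j (P k)]
    split_ifs
    · exact hc
    · refine hc.neg.mul (continuous_finsetSum _ fun p _ => ?_)
      split_ifs with hp
      · exact (hP.cont _).mul (ih _ hp)
      · exact continuous_const
  deriv j k' := by
    induction j using Nat.strong_induction_on with
    | _ j ih =>
    intro t
    have hc : Differentiable ℝ fun t : ℝ => (constantCoeff (P (Matrix.vecCons t k')))⁻¹ :=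
      fun t => by
        have := hP.deriv 0 k' t
        simp only [coeff_zero_eq_constantCoeff] at this
        exact this.differentiableAt.fun_inv (h0 _)
    have hd : DifferentiableAt ℝ (fun t : ℝ => coeff j (P (Matrix.vecCons t k'))⁻¹) t := by
      rw [funext fun t : ℝ => coeff_inv j (P (Matrix.vecCons t k'))]
      split_ifs
      · exact hc t
      · refine (hc t).fun_neg.fun_mul (DifferentiableAt.fun_sum fun p _ => ?_)
        split_ifs with hp
        · exact (hP.deriv _ _ _).differentiableAt.fun_mul (ih _ hp t).differentiableAt
        · exact differentiableAt_const _
    obtain ⟨D, hD⟩ : ∃ D, HasDerivAt (fun t : ℝ => coeff j (P (Matrix.vecCons t k'))⁻¹) D t :=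
      ⟨_, hd.hasDerivAt⟩
    set f := P (Matrix.vecCons t k') with hf
    have hall : ∀ p ∈ Finset.HasAntidiagonal.antidiagonal j,
        HasDerivAt (fun t : ℝ => coeff p.1 (P (Matrix.vecCons t k')) *
          coeff p.2 (P (Matrix.vecCons t k'))⁻¹)
        (R * coeff p.1 (d⁄dX ℂ f) * coeff p.2 f⁻¹ + coeff p.1 f *
          (if p.2 < j then R * coeff p.2 (d⁄dX ℂ f⁻¹) else D)) t := by
      intro p hp
      refine (hP.deriv _ _ _).mul ?_
      split_ifs with hlt
      · exact ih _ hlt t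
      · have : p.2 = j := by have := Finset.HasAntidiagonal.mem_antidiagonal.1 hp; omega
        rw [this]; exact hD
    have hsum := HasDerivAt.fun_sum hall
    have hconst : (fun t : ℝ => ∑ p ∈ Finset.HasAntidiagonal.antidiagonal j,
        coeff p.1 (P (Matrix.vecCons t k')) * coeff p.2 (P (Matrix.vecCons t k'))⁻¹)
        = fun _ => coeff j (1 : PowerSeries ℂ) := by
      funext s
      rw [← coeff_mul, PowerSeries.mul_inv_cancel _ (h0 _)]
    rw [hconst] at hsum
    -- Differentiating P P⁻¹ = 1 in t and formally gives two vanishing sums. By induction they agree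
    -- in every term except (0, j), so these terms agree as well, and the nonzero constant
    -- coefficient can be cancelled.
    have e1 := hsum.unique (hasDerivAt_const _ _)
    have e2 := sum_antidiagonal_derivative (R := R) f f⁻¹ j
    rw [PowerSeries.mul_inv_cancel _ (h0 _), Derivation.map_one_eq_zero, map_zero, mul_zero,
      ← e1, ← sub_eq_zero, ← Finset.sum_sub_distrib,
      Finset.sum_eq_single_of_mem (0, j) (by simp)] at e2
    · simp only [lt_irrefl, if_false, coeff_zero_eq_constantCoeff] at e2
      have : constantCoeff f * (R * coeff j (d⁄dX ℂ f⁻¹) - D) = 0 := by linear_combination e2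
      rcases mul_eq_zero.1 this with h | h
      · exact absurd h (h0 _)
      · rw [sub_eq_zero] at h
        rw [h]; exact hD
    · intro p hp hne
      have hlt : p.2 < j := by
        have h1 := Finset.HasAntidiagonal.mem_antidiagonal.1 hp
        rcases Nat.eq_zero_or_pos p.1 with h | h
        · exact absurd (Prod.ext h (by simp; omega)) hne
        · omega
      simp [hlt]
  periodic j k' := by
    induction j using Nat.strong_induction_on with
    | _ j ih =>
    have h := hP.periodic 0 k'
    simp only [coeff_zero_eq_constantCoeff] at h
    rw [coeff_inv, coeff_inv, h]
    split_ifs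
    · rfl
    · congr 1
      refine Finset.sum_congr rfl fun p _ => ?_
      split_ifs with hp
      · rw [hP.periodic, ih _ hp]
      · rfl

/-- Boundary terms cancel by periodicity, which for the exponential uses that the first coordinate
of x is an integer. Since this coordinate equals the scale R, all powers of R cancel and only the
combinatorial factor j + 1 is left. -/
lemma integral_exp_mul_coeff (hP : IsTaylorFamily R P) {x : Fin (n + 1) → ℤ} (hx : (x 0 : ℝ) = R)
    (hR : R ≠ 0) (j : ℕ) :
    ∫ k in torus (n + 1), Complex.exp (-(Complex.I * (phase k x : ℂ))) * coeff j (P k) =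
      ((j + 1) / Complex.I) *
        ∫ k in torus (n + 1), Complex.exp (-(Complex.I * (phase k x : ℂ))) * coeff (j + 1) (P k) := by
  have hRc : (R : ℂ) ≠ 0 := by exact_mod_cast hR
  have hc := hP.cont
  have hi : ∀ j, IntegrableOn
      (fun k => Complex.exp (-(Complex.I * (phase k x : ℂ))) * coeff j (P k)) (torus (n + 1)) :=
    fun j => integrableOn_torus_of_continuous (by have := hc j; fun_prop)
  rw [integral_torus_succ (hi j), integral_torus_succ (hi (j + 1)), ← integral_const_mul]
  refine integral_congr_ae (Eventually.of_forall fun k' => ?_)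
  dsimp only
  have hph : ∀ t : ℝ, Complex.exp (-(Complex.I * (phase (Matrix.vecCons t k') x : ℂ))) =
      Complex.exp (-(Complex.I * (∑ i, k' i * (x i.succ : ℝ) : ℝ))) *
        Complex.exp (-(Complex.I * R) * t) := by
    intro t
    rw [← Complex.exp_add, phase, Fin.sum_univ_succ]
    simp only [Matrix.cons_val_zero, Matrix.cons_val_succ, hx]
    push_cast; congr 1; ring
  simp_rw [hph, mul_assoc, intervalIntegral.integral_const_mul]
  rw [mul_left_comm]
  congr 1
  have hder : ∀ t ∈ Set.uIcc (-Real.pi) Real.pi,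
      HasDerivAt (fun t : ℝ => coeff j (P (Matrix.vecCons t k')))
        (R * coeff j (d⁄dX ℂ (P (Matrix.vecCons t k')))) t := fun t _ => hP.deriv j k' t
  have hexp : ∀ t ∈ Set.uIcc (-Real.pi) Real.pi,
      HasDerivAt (fun t : ℝ => Complex.exp (-(Complex.I * R) * t) / (-(Complex.I * R)))
        (Complex.exp (-(Complex.I * R) * t)) t := fun t _ => by
    have h1 : HasDerivAt (fun t : ℝ => -(Complex.I * R) * (t : ℂ)) (-(Complex.I * R) * 1) t :=
      (Complex.ofRealCLM.hasDerivAt (x := t)).const_mul _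
    have := h1.cexp.div_const (-(Complex.I * R))
    rwa [mul_one, mul_div_cancel_right₀ _
      (neg_ne_zero.2 (mul_ne_zero Complex.I_ne_zero hRc))] at this
  have hcv : ∀ j, Continuous fun t : ℝ => coeff j (P (Matrix.vecCons t k')) := fun j =>
    (hc j).comp (by fun_prop)
  have key := intervalIntegral.integral_mul_deriv_eq_deriv_mul hder hexp ?_ ?_
  · have hper : Complex.exp (-(Complex.I * R) * (Real.pi : ℝ))
        = Complex.exp (-(Complex.I * R) * ((-Real.pi : ℝ) : ℂ)) := by
      rw [← hx, Complex.exp_eq_exp_iff_exists_int]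
      exact ⟨-(x 0), by push_cast; ring⟩
    rw [hP.periodic, hper, sub_self, zero_sub] at key
    calc ∫ t in (-Real.pi)..Real.pi, Complex.exp (-(Complex.I * R) * t) *
          coeff j (P (Matrix.vecCons t k'))
        = ∫ t in (-Real.pi)..Real.pi, coeff j (P (Matrix.vecCons t k')) *
            Complex.exp (-(Complex.I * R) * t) := by simp_rw [mul_comm]
      _ = _ := by
        rw [key, ← intervalIntegral.integral_neg, ← intervalIntegral.integral_const_mul]
        refine intervalIntegral.integral_congr fun t _ => ?_
        simp only [coeff_derivative]
        field_simp
  · refine Continuous.intervalIntegrable ?_ _ _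
    simp only [coeff_derivative]
    have := hcv (j + 1)
    fun_prop
  · exact Continuous.intervalIntegrable (by fun_prop) _ _

/-- Repeated integration by parts. -/
lemma norm_integral_exp_mul_constantCoeff_le (hP : IsTaylorFamily R P) {x : Fin (n + 1) → ℤ}
    (hx : (x 0 : ℝ) = R) (hR : R ≠ 0) (M : ℕ) :
    ‖∫ k in torus (n + 1), Complex.exp (-(Complex.I * (phase k x : ℂ))) * constantCoeff (P k)‖ ≤
      (M.factorial : ℝ) * ∫ k in torus (n + 1), ‖coeff M (P k)‖ := by
  have h : ‖∫ k in torus (n + 1), Complex.exp (-(Complex.I * (phase k x : ℂ))) * coeff 0 (P k)‖ =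
      (M.factorial : ℝ) * ‖∫ k in torus (n + 1),
        Complex.exp (-(Complex.I * (phase k x : ℂ))) * coeff M (P k)‖ := by
    induction M with
    | zero => simp
    | succ M ih =>
      rw [ih, hP.integral_exp_mul_coeff hx hR M, norm_mul, norm_div, Complex.norm_I, div_one,
        ← mul_assoc, Nat.factorial_succ]
      congr 1
      have : ‖((M : ℂ) + 1)‖ = M + 1 := by
        rw [← Nat.cast_succ, Complex.norm_natCast]; push_cast; rfl
      rw [this]; push_cast; ring
  simp only [← coeff_zero_eq_constantCoeff_apply]
  rw [h]
  gcongr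
  refine (norm_integral_le_integral_norm _).trans_eq ?_
  simp only [norm_mul, norm_exp_neg_I_phase, one_mul]

end IsTaylorFamily

/-- In the recursion for the inverse, coefficients of order below T gain σ^i relative to the
constant one, the others only H. Since H ≤ C and σ ≤ 1, a product containing several factors H is
bounded by a constant times a single H. The result is therefore linear in H, as it must be when H is
controlled only in L¹. Each step costs a factor 1 + C, and the geometric sum of these gives (2 +
C)^j. -/
lemma norm_coeff_inv_le {f : PowerSeries ℂ} {C σ H : ℝ} {T M : ℕ} (hC : 0 ≤ C)
    (hσ0 : 0 ≤ σ) (hσ1 : σ ≤ 1) (hH : 0 ≤ H)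
    (hlow : ∀ i, 1 ≤ i → i < T → ‖coeff i f‖ * ‖(constantCoeff f)⁻¹‖ ≤ C * σ ^ i)
    (hhigh : ∀ i, T ≤ i → i ≤ M → ‖coeff i f‖ * ‖(constantCoeff f)⁻¹‖ ≤ H)
    (hHC : H ≤ C) (j : ℕ) (hj : j ≤ M) :
    ‖coeff j f⁻¹‖ ≤ (2 + C) ^ j * (‖(constantCoeff f)⁻¹‖ * (σ ^ j + H)) := by
  set v := ‖(constantCoeff f)⁻¹‖ with hv
  have hv0 : 0 ≤ v := norm_nonneg _
  induction j using Nat.strong_induction_on with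
  | _ j ih =>
  rw [coeff_inv]
  split_ifs with h0
  · subst h0
    simp only [pow_zero, one_mul]
    rw [← hv]
    nlinarith
  have hstep : ∀ i, 1 ≤ i → i ≤ j → v * (‖coeff i f‖ * ‖coeff (j - i) f⁻¹‖) ≤
      (1 + C) * (2 + C) ^ (j - i) * (v * (σ ^ j + H)) := by
    intro i hi hij
    have hI := ih (j - i) (by omega) (by omega)
    have hσj : σ ^ (j - i) ≤ 1 := pow_le_one₀ hσ0 hσ1
    have hσj0 : 0 ≤ σ ^ (j - i) := by positivity
    calc v * (‖coeff i f‖ * ‖coeff (j - i) f⁻¹‖)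
        ≤ v * (‖coeff i f‖ * ((2 + C) ^ (j - i) * (v * (σ ^ (j - i) + H)))) := by gcongr
      _ = (2 + C) ^ (j - i) * v * ((‖coeff i f‖ * v) * (σ ^ (j - i) + H)) := by ring
      _ ≤ (2 + C) ^ (j - i) * v * ((1 + C) * (σ ^ j + H)) := by
        gcongr ?_ * ?_
        rcases lt_or_ge i T with hiT | hiT
        · have hs : σ ^ j = σ ^ i * σ ^ (j - i) := by rw [← pow_add]; congr 1; omega
          have hσi : σ ^ i ≤ 1 := pow_le_one₀ hσ0 hσ1
          calc ‖coeff i f‖ * v * (σ ^ (j - i) + H) ≤ (C * σ ^ i) * (σ ^ (j - i) + H) := by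
                gcongr ?_ * _; exact hlow i hi hiT
            _ = C * σ ^ j + C * H * σ ^ i := by rw [hs]; ring
            _ ≤ C * σ ^ j + C * H * 1 := by gcongr
            _ ≤ _ := by have : 0 ≤ σ ^ j := by positivity
                        nlinarith
        · calc ‖coeff i f‖ * v * (σ ^ (j - i) + H) ≤ H * (1 + C) := by
                gcongr ?_ * (?_ + ?_)
                exact hhigh i hiT (by omega)
            _ ≤ _ := by have : 0 ≤ σ ^ j := by positivity
                        nlinarith
      _ = _ := by ring
  have hgeom : ∑ i ∈ Finset.range j, (1 + C) * (2 + C) ^ i ≤ (2 + C) ^ j := by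
    have := geom_sum_mul (2 + C) j
    rw [← Finset.mul_sum]
    have e : (1 + C) * ∑ i ∈ Finset.range j, (2 + C) ^ i = (2 + C) ^ j - 1 := by
      rw [← this]; ring
    rw [e]; linarith
  rw [norm_mul, norm_neg, ← hv]
  calc v * ‖∑ p ∈ Finset.HasAntidiagonal.antidiagonal j, if p.2 < j then coeff p.1 f * coeff p.2 f⁻¹ else 0‖
      ≤ v * ∑ p ∈ Finset.HasAntidiagonal.antidiagonal j, if p.2 < j then ‖coeff p.1 f‖ * ‖coeff p.2 f⁻¹‖ else 0 := by
        gcongr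
        refine (norm_sum_le _ _).trans_eq (Finset.sum_congr rfl fun p _ => ?_)
        split_ifs <;> simp
    _ = ∑ p ∈ Finset.HasAntidiagonal.antidiagonal j,
          if p.2 < j then v * (‖coeff p.1 f‖ * ‖coeff p.2 f⁻¹‖) else 0 := by
        rw [Finset.mul_sum]
        exact Finset.sum_congr rfl fun p _ => by split_ifs <;> simp
    _ ≤ ∑ p ∈ Finset.HasAntidiagonal.antidiagonal j,
          if p.2 < j then (1 + C) * (2 + C) ^ p.2 * (v * (σ ^ j + H)) else 0 := by
        refine Finset.sum_le_sum fun p hp => ?_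
        have hp' := Finset.HasAntidiagonal.mem_antidiagonal.1 hp
        split_ifs with hlt
        · have h2 : p.2 = j - p.1 := by omega
          rw [h2]; exact hstep p.1 (by omega) (by omega)
        · exact le_rfl
    _ = ∑ i ∈ Finset.range j, (1 + C) * (2 + C) ^ i * (v * (σ ^ j + H)) := by
        rw [Finset.Nat.sum_antidiagonal_eq_sum_range_succ_mk, ← Finset.sum_range_reflect,
          Finset.sum_range_succ]
        have e : ∀ i ∈ Finset.range j, (if j - (j + 1 - 1 - i) < j then
            (1 + C) * (2 + C) ^ (j - (j + 1 - 1 - i)) * (v * (σ ^ j + H)) else 0)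
            = (1 + C) * (2 + C) ^ i * (v * (σ ^ j + H)) := fun i hi => by
          have := Finset.mem_range.1 hi
          have e2 : j - (j + 1 - 1 - i) = i := by omega
          rw [e2, if_pos this]
        rw [Finset.sum_congr rfl e]
        simp
    _ = (∑ i ∈ Finset.range j, (1 + C) * (2 + C) ^ i) * (v * (σ ^ j + H)) := by
        rw [Finset.sum_mul]
    _ ≤ _ := by gcongr

/-- The form σ^i + H is stable under products: (σ^a + H)(σ^b + H) ≤ (2 + C)(σ^{a+b} + H), because H
≤ C. The factor M + 1 bounds the number of terms of the Cauchy product. -/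
lemma norm_coeff_pow_succ_le {f : PowerSeries ℂ} {A v σ H C : ℝ} {M : ℕ} (hC : 0 ≤ C)
    (hA : 0 ≤ A) (hv : 0 ≤ v) (hσ0 : 0 ≤ σ) (hσ1 : σ ≤ 1) (hH : 0 ≤ H) (hHC : H ≤ C)
    (hf : ∀ i ≤ M, ‖coeff i f‖ ≤ A * (v * (σ ^ i + H))) (j : ℕ) (i : ℕ) (hi : i ≤ M) :
    ‖coeff i (f ^ (j + 1))‖ ≤
      A ^ (j + 1) * ((M + 1) * (2 + C)) ^ j * (v ^ (j + 1) * (σ ^ i + H)) := by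
  induction j generalizing i with
  | zero => simpa using hf i hi
  | succ j ih =>
    rw [pow_succ _ (j + 1), coeff_mul]
    calc ‖∑ p ∈ Finset.HasAntidiagonal.antidiagonal i, coeff p.1 (f ^ (j + 1)) * coeff p.2 f‖
        ≤ ∑ p ∈ Finset.HasAntidiagonal.antidiagonal i, ‖coeff p.1 (f ^ (j + 1))‖ * ‖coeff p.2 f‖ := by
          refine (norm_sum_le _ _).trans_eq (Finset.sum_congr rfl fun p _ => norm_mul _ _)
      _ ≤ ∑ _p ∈ Finset.HasAntidiagonal.antidiagonal i, A ^ (j + 2) * ((M + 1) * (2 + C)) ^ j *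
            (v ^ (j + 2) * ((2 + C) * (σ ^ i + H))) := by
          refine Finset.sum_le_sum fun p hp => ?_
          have hp' := Finset.HasAntidiagonal.mem_antidiagonal.1 hp
          have hs : σ ^ i = σ ^ p.1 * σ ^ p.2 := by rw [← pow_add, hp']
          have h1 : σ ^ p.1 ≤ 1 := pow_le_one₀ hσ0 hσ1
          have h2 : σ ^ p.2 ≤ 1 := pow_le_one₀ hσ0 hσ1
          have h10 : 0 ≤ σ ^ p.1 := by positivity
          have h20 : 0 ≤ σ ^ p.2 := by positivity
          calc ‖coeff p.1 (f ^ (j + 1))‖ * ‖coeff p.2 f‖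
              ≤ (A ^ (j + 1) * ((M + 1) * (2 + C)) ^ j * (v ^ (j + 1) * (σ ^ p.1 + H))) *
                (A * (v * (σ ^ p.2 + H))) := by
                gcongr
                · exact ih p.1 (by omega)
                · exact hf p.2 (by omega)
            _ = A ^ (j + 2) * ((M + 1) * (2 + C)) ^ j *
                (v ^ (j + 2) * ((σ ^ p.1 + H) * (σ ^ p.2 + H))) := by ring
            _ ≤ _ := by
                gcongr _ * (_ * ?_)
                rw [hs]
                nlinarith [mul_nonneg h10 h20, mul_nonneg hH (sub_nonneg.2 h1),
                  mul_nonneg hH (sub_nonneg.2 h2), mul_nonneg hH (sub_nonneg.2 hHC)]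
      _ = (i + 1) * (A ^ (j + 2) * ((M + 1) * (2 + C)) ^ j *
            (v ^ (j + 2) * ((2 + C) * (σ ^ i + H)))) := by
          rw [Finset.sum_const, Finset.Nat.card_antidiagonal, nsmul_eq_mul]; push_cast; ring
      _ ≤ (M + 1) * (A ^ (j + 2) * ((M + 1) * (2 + C)) ^ j *
            (v ^ (j + 2) * ((2 + C) * (σ ^ i + H)))) := by
          gcongr
      _ = _ := by ring

end Taylor

end

end NearCritical

namespace NearCritical

open MeasureTheory Filter Topology

noncomputable section

/-! ### Massive symbols and their truncation to a box -/

section Symbol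

open PowerSeries

/-- The weight may vanish at the origin, so that single term is added separately. -/
lemma summable_of_summable_weight_mul {d : ℕ} {w g : (Fin d → ℤ) → ℝ} (hg : ∀ y, 0 ≤ g y)
    (hw : ∀ y, y ≠ 0 → 1 ≤ w y) (hs : Summable fun y => w y * g y) : Summable g := by
  have h0 : Summable fun y : Fin d → ℤ => if y = 0 then g 0 + |w 0 * g 0| else 0 :=
    (hasSum_ite_eq 0 _).summable
  refine Summable.of_nonneg_of_le hg (fun y => ?_) (hs.add h0)
  split_ifs with h
  · subst h
    linarith [neg_abs_le (w 0 * g 0)]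
  · have := hw y h
    have := hg y
    nlinarith

/-- A summable function on the lattice whose Fourier transform vanishes at most like
`‖k‖² + m²` at the origin. -/
structure IsMassiveSymbol {n : ℕ} (K c m : ℝ) (f : (Fin (n + 1) → ℤ) → ℝ) : Prop where
  K_pos : 0 < K
  c_pos : 0 < c
  c_le_one : c ≤ 1
  m_pos : 0 < m
  moment_summable : Summable fun y => latNorm y ^ 2 * |f y|
  moment_le : ∑' y, latNorm y ^ 2 * |f y| ≤ K
  drift_le : |∑' y, (y 0 : ℝ) * f y| ≤ K * m
  lower : ∀ k ∈ torus (n + 1), c * (‖k‖ ^ 2 + m ^ 2) ≤ (fourier f k).re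

/-- The lattice box of radius `N`. -/
def box (d N : ℕ) : Finset (Fin d → ℤ) := Fintype.piFinset fun _ => Finset.Icc (-(N : ℤ)) N

/-- The weighted restriction of `f` to a box. -/
def near {n : ℕ} (N j : ℕ) (f : (Fin (n + 1) → ℤ) → ℝ) (y : Fin (n + 1) → ℤ) : ℝ :=
  if y ∈ box (n + 1) N then f y * ((y 0 : ℝ) / N) ^ j / j.factorial else 0

/-- The restriction of `f` to the complement of a box. -/
def far {n : ℕ} (N : ℕ) (f : (Fin (n + 1) → ℤ) → ℝ) (y : Fin (n + 1) → ℤ) : ℝ :=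
  if y ∈ box (n + 1) N then 0 else f y

variable {n N : ℕ} {f : (Fin (n + 1) → ℤ) → ℝ}

lemma abs_coord_le_of_mem_box {d : ℕ} {y : Fin d → ℤ} (hy : y ∈ box d N) (i : Fin d) :
    |(y i : ℝ)| ≤ N := by
  have h := Fintype.mem_piFinset.1 hy i
  rw [Finset.mem_Icc] at h
  rw [abs_le]
  exact ⟨by exact_mod_cast h.1, by exact_mod_cast h.2⟩

lemma le_latNorm_of_notMem_box {d : ℕ} {y : Fin d → ℤ} (hy : y ∉ box d N) : (N : ℝ) ≤ latNorm y := by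
  simp only [box, Fintype.mem_piFinset, not_forall, Finset.mem_Icc, ← abs_le, not_le] at hy
  obtain ⟨i, hi⟩ := hy
  refine le_trans ?_ (abs_coord_le_latNorm y i)
  exact_mod_cast hi.le

lemma abs_near_le_pow (hN : 0 < N) (j : ℕ) {y : Fin (n + 1) → ℤ} (hy : y ∈ box (n + 1) N) :
    |near N j f y| ≤ (|(y 0 : ℝ)| / N) ^ j * |f y| := by
  rw [near, if_pos hy, abs_div, abs_mul, abs_pow, abs_div, Nat.abs_cast, Nat.abs_cast]
  rw [mul_comm]
  exact div_le_self (by positivity) (by exact_mod_cast Nat.factorial_pos j)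

lemma div_le_one_of_mem_box (hN : 0 < N) {y : Fin (n + 1) → ℤ} (hy : y ∈ box (n + 1) N) :
    |(y 0 : ℝ)| / N ≤ 1 :=
  (div_le_one (by exact_mod_cast hN)).2 (abs_coord_le_of_mem_box hy 0)

lemma abs_near_le (hN : 0 < N) (j : ℕ) (y : Fin (n + 1) → ℤ) : |near N j f y| ≤ |f y| := by
  by_cases hy : y ∈ box (n + 1) N
  · refine (abs_near_le_pow hN j hy).trans (mul_le_of_le_one_left (abs_nonneg _) ?_)
    exact pow_le_one₀ (by positivity) (div_le_one_of_mem_box hN hy)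
  · simp [near, hy]

lemma abs_near_le_rpow (hN : 0 < N) {j : ℕ} {θ : ℝ} (h0 : 0 ≤ θ) (hj : θ ≤ j)
    (y : Fin (n + 1) → ℤ) : |near N j f y| ≤ (latNorm y / N) ^ θ * |f y| := by
  have := latNorm_nonneg y
  by_cases hy : y ∈ box (n + 1) N
  · refine (abs_near_le_pow hN j hy).trans ?_
    gcongr
    rw [← Real.rpow_natCast]
    refine (Real.rpow_le_rpow_of_exponent_ge' (by positivity) (div_le_one_of_mem_box hN hy) h0
      hj).trans ?_
    gcongr
    exact abs_coord_le_latNorm y 0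
  · simp only [near, hy, if_false, abs_zero]; positivity

lemma abs_far_le (y : Fin (n + 1) → ℤ) : |far N f y| ≤ |f y| := by
  rw [far]; split_ifs <;> simp

lemma abs_far_le_rpow (hN : 0 < N) {θ : ℝ} (h0 : 0 ≤ θ) (y : Fin (n + 1) → ℤ) :
    |far N f y| ≤ (latNorm y / N) ^ θ * |f y| := by
  have := latNorm_nonneg y
  have hN' : (0 : ℝ) < N := by exact_mod_cast hN
  rw [far]
  split_ifs with hy
  · simp; positivity
  · refine le_mul_of_one_le_left (abs_nonneg _) (Real.one_le_rpow ?_ h0)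
    rw [one_le_div hN']
    exact le_latNorm_of_notMem_box hy

lemma fourier_near (j : ℕ) (k : Fin (n + 1) → ℝ) :
    fourier (near N j f) k = ∑ y ∈ box (n + 1) N,
      ((f y * ((y 0 : ℝ) / N) ^ j / j.factorial : ℝ) : ℂ) * Complex.exp (Complex.I * (phase k y : ℂ)) := by
  rw [fourier, tsum_eq_sum (s := box (n + 1) N)]
  · exact Finset.sum_congr rfl fun y hy => by rw [near, if_pos hy]
  · intro y hy; simp [near, hy]

/-- The Taylor family of the Fourier transform of `f` restricted to a box, shifted by `a`. -/
def truncSeries (N : ℕ) (a : ℝ) (f : (Fin (n + 1) → ℤ) → ℝ) (k : Fin (n + 1) → ℝ) : PowerSeries ℂ :=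
  PowerSeries.mk fun j => Complex.I ^ j * fourier (near N j f) k + if j = 0 then (a : ℂ) else 0

lemma phase_vecCons (t : ℝ) (k' : Fin n → ℝ) (y : Fin (n + 1) → ℤ) :
    phase (Matrix.vecCons t k') y = t * y 0 + ∑ i, k' i * (y i.succ : ℝ) := by
  rw [phase, Fin.sum_univ_succ]; simp

lemma fourier_vecCons_pi (g : (Fin (n + 1) → ℤ) → ℝ) (k' : Fin n → ℝ) :
    fourier g (Matrix.vecCons Real.pi k') = fourier g (Matrix.vecCons (-Real.pi) k') := by
  rw [← fourier_add_two_pi g (Matrix.vecCons (-Real.pi) k') (Matrix.vecCons 1 0)]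
  congr 1
  funext i
  refine Fin.cases ?_ (fun i => ?_) i
  · simp; ring
  · simp

/-- The truncated transform is a finite trigonometric sum. Each derivative brings down i y₀ = N · i
(y₀/N), that is, the scale N and the weight of the next coefficient; the shift a affects only the
constant coefficient. -/
lemma isTaylorFamily_truncSeries (hN : 0 < N) (a : ℝ) :
    IsTaylorFamily (N : ℝ) (truncSeries N a f) where
  cont j := by
    simp only [truncSeries, coeff_mk, fourier_near]
    fun_prop
  deriv j k' t := by
    have hN' : (N : ℂ) ≠ 0 := by exact_mod_cast hN.ne'
    simp only [truncSeries, coeff_mk, fourier_near, coeff_derivative]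
    have h1 : ∀ y : Fin (n + 1) → ℤ, HasDerivAt
        (fun t : ℝ => Complex.exp (Complex.I * (phase (Matrix.vecCons t k') y : ℂ)))
        (Complex.exp (Complex.I * (phase (Matrix.vecCons t k') y : ℂ)) * (Complex.I * (y 0 : ℝ)))
        t := fun y => by
      have h2 : HasDerivAt (fun t : ℝ => phase (Matrix.vecCons t k') y) (y 0 : ℝ) t := by
        simp only [phase_vecCons]
        simpa using ((hasDerivAt_id t).mul_const (y 0 : ℝ)).add_const (∑ i, k' i * (y i.succ : ℝ))
      exact ((h2.ofReal_comp).const_mul Complex.I).cexp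
    have h3 := ((HasDerivAt.fun_sum (u := box (n + 1) N) fun y _ => (h1 y).const_mul
      ((f y * ((y 0 : ℝ) / N) ^ j / j.factorial : ℝ) : ℂ)).const_mul (Complex.I ^ j)).add_const
      (if j = 0 then (a : ℂ) else 0)
    refine h3.congr_deriv ?_
    simp only [Nat.succ_ne_zero, if_false, add_zero, Finset.mul_sum, Finset.sum_mul]
    refine Finset.sum_congr rfl fun y _ => ?_
    have hj : (j.factorial : ℂ) ≠ 0 := by exact_mod_cast j.factorial_ne_zero
    have hj1 : (j : ℂ) + 1 ≠ 0 := by exact_mod_cast j.succ_ne_zero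
    rw [Nat.factorial_succ]
    obtain ⟨q, hq⟩ : ∃ q : ℂ, (y 0 : ℂ) = N * q := ⟨y 0 / N, by field_simp⟩
    push_cast
    rw [hq, mul_div_cancel_left₀ _ hN']
    field_simp
    ring
  periodic j k' := by
    simp only [truncSeries, coeff_mk, fourier_vecCons_pi]

lemma coeff_truncSeries {j : ℕ} (hj : j ≠ 0) (a : ℝ) (k : Fin (n + 1) → ℝ) :
    ‖coeff j (truncSeries N a f k)‖ = ‖fourier (near N j f) k‖ := by
  simp [truncSeries, hj]

lemma constantCoeff_truncSeries (a : ℝ) (k : Fin (n + 1) → ℝ) :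
    constantCoeff (truncSeries N a f k) = fourier (near N 0 f) k + a := by
  rw [← coeff_zero_eq_constantCoeff_apply]
  simp [truncSeries]

namespace IsMassiveSymbol

variable {K c m : ℝ}

lemma summable (hf : IsMassiveSymbol K c m f) : Summable fun y => |f y| :=
  summable_of_summable_weight_mul (fun _ => abs_nonneg _)
    (fun _ hy => one_le_pow₀ (one_le_latNorm hy)) hf.moment_summable

lemma summable_near (hf : IsMassiveSymbol K c m f) (hN : 0 < N) (j : ℕ) : Summable fun y => |near N j f y| :=
  Summable.of_nonneg_of_le (fun _ => abs_nonneg _) (abs_near_le hN j) hf.summable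

lemma summable_far (hf : IsMassiveSymbol K c m f) : Summable fun y => |far N f y| :=
  Summable.of_nonneg_of_le (fun _ => abs_nonneg _) abs_far_le hf.summable

lemma fourier_eq (hf : IsMassiveSymbol K c m f) (hN : 0 < N) (k : Fin (n + 1) → ℝ) :
    fourier f k = fourier (near N 0 f) k + fourier (far N f) k := by
  rw [← fourier_add (hf.summable_near hN 0) hf.summable_far]
  congr 1; funext y
  simp only [near, far]; split_ifs <;> simp

lemma tsum_le_of_weight (hf : IsMassiveSymbol K c m f) {g : (Fin (n + 1) → ℤ) → ℝ} {b : ℝ}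
    (hg : ∀ y, |g y| ≤ b * (latNorm y ^ 2 * |f y|)) (hb : 0 ≤ b) :
    (Summable fun y => |g y|) ∧ ∑' y, |g y| ≤ b * K := by
  have hs := Summable.of_nonneg_of_le (fun y => abs_nonneg (g y)) hg
    (hf.moment_summable.mul_left b)
  refine ⟨hs, (hs.tsum_le_tsum hg (hf.moment_summable.mul_left b)).trans ?_⟩
  rw [tsum_mul_left]
  exact mul_le_mul_of_nonneg_left hf.moment_le hb

/-- Outside the box |y| ≥ N, so the second moment pays N^{-2}. -/
lemma norm_fourier_far_le (hf : IsMassiveSymbol K c m f) (hN : 0 < N) (k : Fin (n + 1) → ℝ) :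
    ‖fourier (far N f) k‖ ≤ K / N ^ 2 := by
  have hN' : (0 : ℝ) < N := by exact_mod_cast hN
  refine (norm_fourier_le hf.summable_far k).trans ?_
  have := hf.tsum_le_of_weight (g := far N f) (b := ((N : ℝ) ^ 2)⁻¹) (fun y => ?_) (by positivity)
  · rw [div_eq_inv_mul]; exact this.2
  · refine (abs_far_le_rpow hN (θ := 2) (by norm_num) y).trans_eq ?_
    rw [Real.rpow_two, div_pow]; ring

lemma norm_fourier_near_le (hf : IsMassiveSymbol K c m f) (hN : 0 < N) {j : ℕ} (hj : 2 ≤ j) (k : Fin (n + 1) → ℝ) :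
    ‖fourier (near N j f) k‖ ≤ K / N ^ 2 := by
  have hN' : (0 : ℝ) < N := by exact_mod_cast hN
  refine (norm_fourier_le (hf.summable_near hN j) k).trans ?_
  have := hf.tsum_le_of_weight (g := near N j f) (b := ((N : ℝ) ^ 2)⁻¹) (fun y => ?_)
    (by positivity)
  · rw [div_eq_inv_mul]; exact this.2
  · refine (abs_near_le_rpow hN (θ := 2) (by norm_num) (by exact_mod_cast hj) y).trans_eq ?_
    rw [Real.rpow_two, div_pow]; ring

/-- Second moments alone would give only order 1/N. The extra smallness comes from splitting y₀ f(y)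
e^{ik·y} over the box into the drift (order m), the increment e^{ik·y} - 1 (order |k|) and the tail
outside the box (order 1/N). -/
lemma norm_fourier_near_one_le (hf : IsMassiveSymbol K c m f) (hN : 0 < N) (k : Fin (n + 1) → ℝ) :
    ‖fourier (near N 1 f) k‖ ≤ K * (m + (n + 1) * ‖k‖ + (N : ℝ)⁻¹) / N := by
  have hN' : (0 : ℝ) < N := by exact_mod_cast hN
  set e : (Fin (n + 1) → ℤ) → ℂ := fun y => Complex.exp (Complex.I * (phase k y : ℂ)) with he
  have hlat : ∀ y : Fin (n + 1) → ℤ, |(y 0 : ℝ)| ≤ latNorm y := fun y => abs_coord_le_latNorm y 0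
  -- first moment
  have hw1 : ∀ y : Fin (n + 1) → ℤ, |(y 0 : ℝ) * f y| ≤ 1 * (latNorm y ^ 2 * |f y|) := fun y => by
    rw [abs_mul, one_mul]
    gcongr
    rcases eq_or_ne y 0 with rfl | hy
    · simp [latNorm_zero]
    · have := one_le_latNorm hy
      exact (hlat y).trans (by nlinarith)
  obtain ⟨hs1, -⟩ := hf.tsum_le_of_weight hw1 zero_le_one
  have hs1' : Summable fun y : Fin (n + 1) → ℤ => ((((y 0 : ℝ) * f y : ℝ)) : ℂ) :=
    Summable.of_norm (by simpa using hs1)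
  -- increments of the exponential
  have hexp : ∀ y, ‖e y - 1‖ ≤ (n + 1) * ‖k‖ * latNorm y := fun y => by
    have h := Real.norm_exp_I_mul_ofReal_sub_one_le (x := phase k y)
    have := abs_phase_le k y
    push_cast at this
    exact h.trans this
  have hw2 : ∀ y : Fin (n + 1) → ℤ, |‖(((y 0 : ℝ) * f y : ℝ) : ℂ) * (e y - 1)‖| ≤
      ((n + 1) * ‖k‖) * (latNorm y ^ 2 * |f y|) := fun y => by
    rw [abs_norm, norm_mul, Complex.norm_real, Real.norm_eq_abs, abs_mul]
    have := latNorm_nonneg y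
    calc |(y 0 : ℝ)| * |f y| * ‖e y - 1‖ ≤ latNorm y * |f y| * ((n + 1) * ‖k‖ * latNorm y) := by
          gcongr
          · exact hlat y
          · exact hexp y
      _ = _ := by ring
  obtain ⟨hs2, hb2⟩ := hf.tsum_le_of_weight hw2 (by positivity)
  simp only [abs_norm] at hs2 hb2
  have hw3 : ∀ y : Fin (n + 1) → ℤ, |‖(((y 0 : ℝ) * far N f y : ℝ) : ℂ) * e y‖| ≤
      (N : ℝ)⁻¹ * (latNorm y ^ 2 * |f y|) := fun y => by
    have := latNorm_nonneg y
    rw [abs_norm, norm_mul, he, norm_exp_I_phase, mul_one, Complex.norm_real, Real.norm_eq_abs,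
      abs_mul]
    calc |(y 0 : ℝ)| * |far N f y| ≤ latNorm y * ((latNorm y / N) ^ (1 : ℝ) * |f y|) := by
          gcongr
          · exact hlat y
          · exact abs_far_le_rpow hN zero_le_one y
      _ = _ := by rw [Real.rpow_one]; ring
  obtain ⟨hs3, hb3⟩ := hf.tsum_le_of_weight hw3 (by positivity)
  simp only [abs_norm] at hs3 hb3
  have hsplit : fourier (near N 1 f) k = ((N : ℝ)⁻¹ : ℝ) *
      ((∑' y, (((y 0 : ℝ) * f y : ℝ) : ℂ) * (e y - 1)) + (∑' y, (((y 0 : ℝ) * f y : ℝ) : ℂ)) -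
        ∑' y, (((y 0 : ℝ) * far N f y : ℝ) : ℂ) * e y) := by
    rw [← hs2.of_norm.tsum_add hs1', ← (hs2.of_norm.add hs1').tsum_sub hs3.of_norm,
      ← tsum_mul_left, fourier]
    refine tsum_congr fun y => ?_
    simp only [near, far, he]
    split_ifs
    · push_cast; simp; ring
    · push_cast; ring
  rw [hsplit, norm_mul, Complex.norm_real, Real.norm_of_nonneg (by positivity), div_eq_inv_mul]
  gcongr
  calc _ ≤ ‖∑' y, (((y 0 : ℝ) * f y : ℝ) : ℂ) * (e y - 1)‖ + ‖∑' y, (((y 0 : ℝ) * f y : ℝ) : ℂ)‖ +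
        ‖∑' y, (((y 0 : ℝ) * far N f y : ℝ) : ℂ) * e y‖ :=
        (norm_sub_le _ _).trans (by gcongr; exact norm_add_le _ _)
    _ ≤ ((n + 1) * ‖k‖) * K + K * m + (N : ℝ)⁻¹ * K := by
        gcongr
        · exact (norm_tsum_le_tsum_norm hs2).trans hb2
        · rw [← Complex.ofReal_tsum, Complex.norm_real]
          exact hf.drift_le
        · exact (norm_tsum_le_tsum_norm hs3).trans hb3
    _ = _ := by ring

end IsMassiveSymbol

end Symbol

end

end NearCritical

namespace NearCritical

open MeasureTheory Filter Topology

noncomputable section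

/-! ### Resolvent expansion and pointwise bounds on high derivatives -/

section Deconvolution

open PowerSeries

lemma norm_pow_sub_pow_le' {u w : ℂ} {r : ℝ} (hu : ‖u‖ ≤ r) (hw : ‖w‖ ≤ r) (j : ℕ) :
    ‖u ^ (j + 1) - w ^ (j + 1)‖ ≤ (j + 1) * r ^ j * ‖u - w‖ := by
  have hr : 0 ≤ r := (norm_nonneg _).trans hu
  induction j with
  | zero => simp
  | succ j ih =>
    have e : u ^ (j + 1 + 1) - w ^ (j + 1 + 1) = u * (u ^ (j + 1) - w ^ (j + 1)) +
        w ^ (j + 1) * (u - w) := by ring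
    rw [e]
    calc _ ≤ ‖u‖ * ‖u ^ (j + 1) - w ^ (j + 1)‖ + ‖w‖ ^ (j + 1) * ‖u - w‖ := by
          refine (norm_add_le _ _).trans ?_
          rw [norm_mul, norm_mul, norm_pow]
      _ ≤ r * ((j + 1) * r ^ j * ‖u - w‖) + r ^ (j + 1) * ‖u - w‖ := by gcongr
      _ = _ := by push_cast; ring

/-- The truncated symbol itself may vanish, so truncation is possible only in powers of (B + a)⁻¹.
The remainder keeps one factor B⁻¹ but carries J factors a/(B + a), which supply decay at
frequencies above 1/N. -/
lemma inv_eq_sum_add {B a : ℂ} (hB : B ≠ 0) (hBa : B + a ≠ 0) (J : ℕ) :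
    B⁻¹ = ∑ j ∈ Finset.range J, a ^ j * (B + a)⁻¹ ^ (j + 1) + a ^ J * (B⁻¹ * (B + a)⁻¹ ^ J) := by
  induction J with
  | zero => simp
  | succ J ih =>
    rw [Finset.sum_range_succ]
    have : a ^ J * (B + a)⁻¹ ^ (J + 1) + a ^ (J + 1) * (B⁻¹ * (B + a)⁻¹ ^ (J + 1)) =
        a ^ J * (B⁻¹ * (B + a)⁻¹ ^ J) := by
      have e : (B + a)⁻¹ * (B + a) = 1 := inv_mul_cancel₀ hBa
      have e' : B⁻¹ * B = 1 := inv_mul_cancel₀ hB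
      linear_combination a ^ J * B⁻¹ * (B + a)⁻¹ ^ J * e - a ^ J * (B + a)⁻¹ ^ (J + 1) * e'
    rw [add_assoc, this]; exact ih

/-- Weighted `L¹` control of the high-order part of the symbol. -/
def HighOrderBound {n : ℕ} (CH θ : ℝ) (f : (Fin (n + 1) → ℤ) → ℝ) : Prop :=
  ∀ N : ℕ, 0 < N → ∀ h : (Fin (n + 1) → ℤ) → ℝ, (∀ y, |h y| ≤ |f y|) →
    (∀ y, |h y| ≤ (latNorm y / N) ^ θ * |f y|) →
    ∫ k in torus (n + 1), ‖fourier h k‖ * ((‖k‖ ^ 2 + ((N : ℝ) ^ 2)⁻¹) ^ 2)⁻¹ ≤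
      CH / (N : ℝ) ^ (n + 1 - 2)

namespace IsMassiveSymbol

variable {n N : ℕ} {f : (Fin (n + 1) → ℤ) → ℝ} {K c m : ℝ}

lemma re_fourier_pos (hf : IsMassiveSymbol K c m f) (k : Fin (n + 1) → ℝ) : 0 < (fourier f k).re := by
  refine forall_fourier_of_torus (p := fun w => 0 < w.re) (fun k hk => ?_) k
  have := hf.c_pos
  have := hf.m_pos
  exact lt_of_lt_of_le (by positivity) (hf.lower k hk)

/-- The origin of K + 1: the part K absorbs the tail removed by truncation, and the 1 leaves an
extra mass N^{-2}. -/
lemma re_near_ge (hf : IsMassiveSymbol K c m f) (hN : 0 < N) (k : Fin (n + 1) → ℝ) :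
    (fourier f k).re + ((N : ℝ) ^ 2)⁻¹ ≤
      (fourier (near N 0 f) k + ((K + 1) / (N : ℝ) ^ 2 : ℝ)).re := by
  have h := hf.fourier_eq hN k
  have h1 := (Complex.abs_re_le_norm _).trans (hf.norm_fourier_far_le hN k)
  have h2 := congrArg Complex.re h
  rw [Complex.add_re] at h2 ⊢
  rw [Complex.ofReal_re, add_div, one_div]
  linarith [le_abs_self (fourier (far N f) k).re]

lemma near_ne_zero (hf : IsMassiveSymbol K c m f) (hN : 0 < N) (k : Fin (n + 1) → ℝ) :
    fourier (near N 0 f) k + ((K + 1) / (N : ℝ) ^ 2 : ℝ) ≠ 0 := fun h => by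
  have h1 := hf.re_near_ge hN k
  have h2 := hf.re_fourier_pos k
  have : 0 ≤ ((N : ℝ) ^ 2)⁻¹ := by positivity
  rw [h, Complex.zero_re] at h1
  linarith

lemma add_ne_zero (hf : IsMassiveSymbol K c m f) (k : Fin (n + 1) → ℝ) {a : ℝ} (ha : 0 ≤ a) : fourier f k + a ≠ 0 := fun h => by
  have h2 := hf.re_fourier_pos k
  have := congrArg Complex.re h
  rw [Complex.add_re, Complex.ofReal_re, Complex.zero_re] at this
  linarith

lemma norm_inv_near_le (hf : IsMassiveSymbol K c m f) (hN : 0 < N) {k : Fin (n + 1) → ℝ} (hk : k ∈ torus (n + 1)) :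
    ‖(fourier (near N 0 f) k + ((K + 1) / (N : ℝ) ^ 2 : ℝ))⁻¹‖ ≤
      (c * (‖k‖ ^ 2 + m ^ 2 + ((N : ℝ) ^ 2)⁻¹))⁻¹ := by
  have hN' : (0 : ℝ) < N := by exact_mod_cast hN
  have := hf.c_pos
  rw [norm_inv]
  gcongr
  refine le_trans ?_ ((le_abs_self _).trans (Complex.abs_re_le_norm _))
  refine le_trans ?_ (hf.re_near_ge hN k)
  have h1 := hf.lower k hk
  have h2 : c * ((N : ℝ) ^ 2)⁻¹ ≤ ((N : ℝ) ^ 2)⁻¹ :=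
    mul_le_of_le_one_left (by positivity) hf.c_le_one
  linarith

lemma norm_inv_add_le (hf : IsMassiveSymbol K c m f) (hN : 0 < N) {k : Fin (n + 1) → ℝ} (hk : k ∈ torus (n + 1)) :
    ‖(fourier f k + ((K + 1) / (N : ℝ) ^ 2 : ℝ))⁻¹‖ ≤
      (c * (‖k‖ ^ 2 + m ^ 2 + ((N : ℝ) ^ 2)⁻¹))⁻¹ := by
  have hN' : (0 : ℝ) < N := by exact_mod_cast hN
  have := hf.c_pos
  have := hf.K_pos
  rw [norm_inv]
  gcongr
  refine le_trans ?_ ((le_abs_self _).trans (Complex.abs_re_le_norm _))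
  rw [Complex.add_re, Complex.ofReal_re]
  have h1 := hf.lower k hk
  have h2 : c * ((N : ℝ) ^ 2)⁻¹ ≤ ((N : ℝ) ^ 2)⁻¹ :=
    mul_le_of_le_one_left (by positivity) hf.c_le_one
  have h3 : ((N : ℝ) ^ 2)⁻¹ ≤ (K + 1) / (N : ℝ) ^ 2 := by
    rw [inv_eq_one_div]; gcongr; linarith
  linarith

lemma inv_scale_le (hc : 0 < c) (hN : 0 < N) (hK : 0 < K) (k : Fin (n + 1) → ℝ) :
    (K + 1) / (N : ℝ) ^ 2 * (c * (‖k‖ ^ 2 + m ^ 2 + ((N : ℝ) ^ 2)⁻¹))⁻¹ ≤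
      (K + 1) / c * (1 + (N : ℝ) ^ 2 * ‖k‖ ^ 2)⁻¹ := by
  have hN' : (0 : ℝ) < N := by exact_mod_cast hN
  have e : (K + 1) / (N : ℝ) ^ 2 * (c * (‖k‖ ^ 2 + m ^ 2 + ((N : ℝ) ^ 2)⁻¹))⁻¹ =
      (K + 1) / c * (1 + (N : ℝ) ^ 2 * ‖k‖ ^ 2 + (N : ℝ) ^ 2 * m ^ 2)⁻¹ := by
    have e1 : (1 + (N : ℝ) ^ 2 * ‖k‖ ^ 2 + (N : ℝ) ^ 2 * m ^ 2) =
        (N : ℝ) ^ 2 * (‖k‖ ^ 2 + m ^ 2 + ((N : ℝ) ^ 2)⁻¹) := by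
      field_simp; ring
    rw [e1, mul_inv, mul_inv]
    field_simp
  rw [e]
  gcongr _ * (?_)⁻¹
  linarith [show 0 ≤ (N : ℝ) ^ 2 * m ^ 2 by positivity]

lemma inv_scale_le_const (hc : 0 < c) (hN : 0 < N) (hK : 0 < K) (k : Fin (n + 1) → ℝ) :
    (K + 1) / (N : ℝ) ^ 2 * (c * (‖k‖ ^ 2 + m ^ 2 + ((N : ℝ) ^ 2)⁻¹))⁻¹ ≤ (K + 1) / c := by
  refine (inv_scale_le hc hN hK k).trans (mul_le_of_le_one_right (by positivity) ?_)
  refine inv_le_one_of_one_le₀ ?_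
  linarith [show 0 ≤ (N : ℝ) ^ 2 * ‖k‖ ^ 2 by positivity]

lemma inv_scale_sq_le (hc : 0 < c) (hN : 0 < N) (k : Fin (n + 1) → ℝ) :
    (c * (‖k‖ ^ 2 + m ^ 2 + ((N : ℝ) ^ 2)⁻¹))⁻¹ ^ 2 ≤
      (c ^ 2)⁻¹ * ((‖k‖ ^ 2 + ((N : ℝ) ^ 2)⁻¹) ^ 2)⁻¹ := by
  have hN' : (0 : ℝ) < N := by exact_mod_cast hN
  rw [inv_pow, mul_pow, mul_inv]
  gcongr
  linarith [sq_nonneg m]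

/-- All Taylor coefficients beyond the constant one are relatively small at high frequency. -/
lemma norm_coeff_mul_inv_le (hf : IsMassiveSymbol K c m f) (hN : 0 < N) (k : Fin (n + 1) → ℝ) {i : ℕ}
    (hi : 1 ≤ i) :
    ‖fourier (near N i f) k‖ * (c * (‖k‖ ^ 2 + m ^ 2 + ((N : ℝ) ^ 2)⁻¹))⁻¹ ≤
      K * (n + 3) / c * (√((N : ℝ) ^ 2 * (‖k‖ ^ 2 + m ^ 2 + ((N : ℝ) ^ 2)⁻¹)))⁻¹ := by
  have hN' : (0 : ℝ) < N := by exact_mod_cast hN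
  have hc := hf.c_pos
  have hK := hf.K_pos
  have hm := hf.m_pos
  set ρ := ‖k‖ ^ 2 + m ^ 2 + ((N : ℝ) ^ 2)⁻¹ with hρ
  have hρ0 : 0 < ρ := by positivity
  have hτ : 1 ≤ (N : ℝ) * √ρ := by
    have : (N : ℝ)⁻¹ ≤ √ρ := Real.le_sqrt_of_sq_le (by rw [inv_pow, hρ]; nlinarith [sq_nonneg ‖k‖])
    calc (1 : ℝ) = N * (N : ℝ)⁻¹ := by field_simp
      _ ≤ _ := by gcongr
  rw [Real.sqrt_mul (by positivity), Real.sqrt_sq hN'.le]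
  have hs : √ρ * √ρ = ρ := Real.mul_self_sqrt hρ0.le
  have hs0 : 0 < √ρ := Real.sqrt_pos.2 hρ0
  have hbound : ‖fourier (near N i f) k‖ ≤ K * (n + 3) * √ρ / N := by
    rcases Nat.lt_or_ge 1 i with h2 | h1
    · refine (hf.norm_fourier_near_le hN h2 k).trans ?_
      rw [div_le_div_iff₀ (by positivity) hN']
      have : (1 : ℝ) ≤ n + 3 := by have : (0 : ℝ) ≤ n := by positivity
                                   linarith
      calc K * N = K * 1 * N * 1 := by ring
        _ ≤ K * (n + 3) * N * (N * √ρ) := by gcongr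
        _ = _ := by ring
    · have : i = 1 := by omega
      subst this
      refine (hf.norm_fourier_near_one_le hN k).trans ?_
      rw [mul_assoc K]
      gcongr
      have e1 : m ≤ √ρ := Real.le_sqrt_of_sq_le (by
        rw [hρ]; have : 0 ≤ ((N : ℝ) ^ 2)⁻¹ := by positivity
        nlinarith [sq_nonneg ‖k‖])
      have e2 : ‖k‖ ≤ √ρ := Real.le_sqrt_of_sq_le (by
        rw [hρ]; have : 0 ≤ ((N : ℝ) ^ 2)⁻¹ := by positivity
        nlinarith [sq_nonneg m])
      have e3 : (N : ℝ)⁻¹ ≤ √ρ :=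
        Real.le_sqrt_of_sq_le (by rw [inv_pow, hρ]; nlinarith [sq_nonneg ‖k‖])
      have e4 : (n + 1 : ℝ) * ‖k‖ ≤ (n + 1) * √ρ := by gcongr
      linarith
  calc _ ≤ K * (n + 3) * √ρ / N * (c * ρ)⁻¹ := by gcongr
    _ = K * (n + 3) / c * (√ρ / (N * (√ρ * √ρ))) := by rw [hs]; field_simp
    _ = _ := by field_simp

end IsMassiveSymbol

/-- Pointwise bound on the high derivatives of powers of the truncated inverse symbol. -/
lemma exists_norm_coeff_truncSeries_le (K c : ℝ) (n T : ℕ) (hT : 2 ≤ T) (hK : 0 < K) (hc : 0 < c)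
    (hc1 : c ≤ 1) (j : ℕ) :
    ∃ C > 0, ∀ (m : ℝ) (f : (Fin (n + 1) → ℤ) → ℝ), IsMassiveSymbol K c m f → ∀ N : ℕ, 0 < N →
      ∀ k ∈ torus (n + 1), k ≠ 0 →
      ((K + 1) / (N : ℝ) ^ 2) ^ j * ‖coeff (2 * (n + 1) * (T - 1))
        ((truncSeries N ((K + 1) / (N : ℝ) ^ 2) f k)⁻¹ ^ (j + 1))‖ ≤
      C * ((‖k‖ ^ 2)⁻¹ * ((1 + (N : ℝ) ^ 2 * ‖k‖ ^ 2) ^ (n + 1))⁻¹ +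
        ∑ i ∈ Finset.Icc T (2 * (n + 1) * (T - 1)),
          ‖fourier (near N i f) k‖ * ((‖k‖ ^ 2 + ((N : ℝ) ^ 2)⁻¹) ^ 2)⁻¹) := by
  -- The number of integrations by parts, chosen so that σ^M below is τ^{-(n+1)}, the power in the
  -- integrable profile.
  set M := 2 * (n + 1) * (T - 1) with hM
  set C₀ := K * (n + 3) / c with hC₀
  have hC₀0 : 0 < C₀ := by positivity
  set C := (M + 1) * C₀ with hC
  have hC0 : 0 < C := by positivity
  have hC₀C : C₀ ≤ C := le_mul_of_one_le_left hC₀0.le (by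
    have : (0 : ℝ) ≤ M := by positivity
    linarith)
  set A := (2 + C) ^ M with hA
  have hA0 : 0 < A := by positivity
  refine ⟨A ^ (j + 1) * ((M + 1) * (2 + C)) ^ j * (((K + 1) / c) ^ j * (c ^ 2)⁻¹), by positivity,
    fun m f hf N hN k hk hk0 => ?_⟩
  have hN' : (0 : ℝ) < N := by exact_mod_cast hN
  have hm := hf.m_pos
  have hkp : 0 < ‖k‖ := norm_pos_iff.2 hk0
  set a : ℝ := (K + 1) / (N : ℝ) ^ 2 with ha
  have ha0 : 0 < a := by positivity
  set P := truncSeries N a f k with hP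
  set ρ := ‖k‖ ^ 2 + m ^ 2 + ((N : ℝ) ^ 2)⁻¹ with hρ
  have hρ0 : 0 < ρ := by positivity
  set v := (c * ρ)⁻¹ with hv
  have hv0 : 0 < v := by positivity
  set τ := (N : ℝ) ^ 2 * ρ with hτ
  have hτ0 : 0 < τ := by positivity
  have hτk : 1 + (N : ℝ) ^ 2 * ‖k‖ ^ 2 ≤ τ := by
    have : τ = (N : ℝ) ^ 2 * ‖k‖ ^ 2 + (N : ℝ) ^ 2 * m ^ 2 + 1 := by
      rw [hτ, hρ]; field_simp
    rw [this]
    linarith [show 0 ≤ (N : ℝ) ^ 2 * m ^ 2 by positivity]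
  have hτ1 : 1 ≤ τ := le_trans (by linarith [show 0 ≤ (N : ℝ) ^ 2 * ‖k‖ ^ 2 by positivity]) hτk
  have hT1 : T - 1 ≠ 0 := by omega
  set s := (√τ)⁻¹ with hs
  have hs0 : 0 < s := by positivity
  have hs1 : s ≤ 1 := inv_le_one_of_one_le₀ (Real.one_le_sqrt.2 hτ1)
  -- Every coefficient of positive order is relatively bounded by s = σ^(T-1), hence by σ^i for all
  -- orders i below T.
  set σ := s ^ ((T - 1 : ℕ) : ℝ)⁻¹ with hσ
  have hσ0 : 0 < σ := by positivity
  have hσ1 : σ ≤ 1 := Real.rpow_le_one hs0.le hs1 (by positivity)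
  have hσT : σ ^ (T - 1) = s := Real.rpow_inv_natCast_pow hs0.le hT1
  have hσM : σ ^ M = (τ ^ (n + 1))⁻¹ := by
    rw [hM, mul_comm, pow_mul, hσT, hs, inv_pow, pow_mul, Real.sq_sqrt hτ0.le]
  have hp0 : ‖(constantCoeff P)⁻¹‖ ≤ v := by
    rw [hP, constantCoeff_truncSeries]
    exact hf.norm_inv_near_le hN hk
  have hsmall : ∀ i, 1 ≤ i → ‖coeff i P‖ * ‖(constantCoeff P)⁻¹‖ ≤ C₀ * s := fun i hi => by
    refine le_trans ?_ (hf.norm_coeff_mul_inv_le hN k hi)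
    rw [hP, coeff_truncSeries (by omega)]
    gcongr
  -- The orders from T on are kept as they are, since only their weighted L¹ norm has the required
  -- decay in N.
  set H := ∑ i ∈ Finset.Icc T M, ‖coeff i P‖ * ‖(constantCoeff P)⁻¹‖ with hH
  have hH0 : 0 ≤ H := Finset.sum_nonneg fun i _ => by positivity
  have hHC : H ≤ C := by
    calc H ≤ ∑ _i ∈ Finset.Icc T M, C₀ := by
          refine Finset.sum_le_sum fun i hi => ?_
          have := Finset.mem_Icc.1 hi
          exact (hsmall i (by omega)).trans (mul_le_of_le_one_right hC₀0.le hs1)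
      _ = ((M + 1 - T : ℕ) : ℝ) * C₀ := by simp
      _ ≤ C := by
          rw [hC]; gcongr
          calc ((M + 1 - T : ℕ) : ℝ) ≤ ((M + 1 : ℕ) : ℝ) := by gcongr; omega
            _ = _ := by push_cast; rfl
  have hinv : ∀ i ≤ M, ‖coeff i P⁻¹‖ ≤ A * (‖(constantCoeff P)⁻¹‖ * (σ ^ i + H)) := fun i hi => by
    refine (norm_coeff_inv_le (T := T) (M := M) hC0.le hσ0.le hσ1 hH0 ?_ ?_ hHC i hi).trans ?_
    · intro l hl1 hlT
      refine (hsmall l hl1).trans ?_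
      gcongr
      rw [← hσT]
      exact pow_le_pow_of_le_one hσ0.le hσ1 (by omega)
    · intro l hlT hlM
      exact Finset.single_le_sum (f := fun i => ‖coeff i P‖ * ‖(constantCoeff P)⁻¹‖)
        (fun i _ => by positivity) (Finset.mem_Icc.2 ⟨hlT, hlM⟩)
    · gcongr
      exact pow_le_pow_right₀ (by linarith) hi
  have hpow := norm_coeff_pow_succ_le hC0.le hA0.le (norm_nonneg _) hσ0.le hσ1 hH0 hHC hinv j M le_rfl
  have hav : a * v ≤ (K + 1) / c := IsMassiveSymbol.inv_scale_le_const hc hN hK k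
  have h1 : v * σ ^ M ≤ (c ^ 2)⁻¹ * ((‖k‖ ^ 2)⁻¹ * ((1 + (N : ℝ) ^ 2 * ‖k‖ ^ 2) ^ (n + 1))⁻¹) := by
    rw [hσM, hv, mul_inv, mul_assoc]
    gcongr
    · nlinarith
    · rw [hρ]
      have : 0 ≤ ((N : ℝ) ^ 2)⁻¹ := by positivity
      nlinarith [sq_nonneg m]
  have h2 : v * H ≤ (c ^ 2)⁻¹ * ∑ i ∈ Finset.Icc T M,
      ‖fourier (near N i f) k‖ * ((‖k‖ ^ 2 + ((N : ℝ) ^ 2)⁻¹) ^ 2)⁻¹ := by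
    rw [hH, Finset.mul_sum, Finset.mul_sum]
    refine Finset.sum_le_sum fun i hi => ?_
    have := Finset.mem_Icc.1 hi
    rw [hP, coeff_truncSeries (by omega), ← hP]
    calc v * (‖fourier (near N i f) k‖ * ‖(constantCoeff P)⁻¹‖)
        ≤ v * (‖fourier (near N i f) k‖ * v) := by gcongr
      _ = ‖fourier (near N i f) k‖ * v ^ 2 := by ring
      _ ≤ ‖fourier (near N i f) k‖ * ((c ^ 2)⁻¹ * ((‖k‖ ^ 2 + ((N : ℝ) ^ 2)⁻¹) ^ 2)⁻¹) := by
          gcongr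
          exact IsMassiveSymbol.inv_scale_sq_le hc hN k
      _ = _ := by ring
  -- Each of the j factors a is paired with one v, as a v is bounded; the remaining v multiplies σ^M
  -- + H.
  have e1 : ∀ X a v s h : ℝ, a ^ j * (X * (v ^ (j + 1) * (s + h))) =
      X * ((a * v) ^ j * (v * s + v * h)) := by intros; ring
  have e2 : ∀ X y z s h : ℝ, X * (y * (z * s + z * h)) = X * (y * z) * (s + h) := by intros; ring
  have hX0 : 0 ≤ A ^ (j + 1) * ((M + 1) * (2 + C)) ^ j := by positivity
  generalize A ^ (j + 1) * ((M + 1) * (2 + C)) ^ j = X at hpow hX0 ⊢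
  have hp1 : ‖(constantCoeff P)⁻¹‖ ^ (j + 1) ≤ v ^ (j + 1) :=
    pow_le_pow_left₀ (norm_nonneg _) hp0 _
  have hσH : 0 ≤ σ ^ M + H := by positivity
  refine (mul_le_mul_of_nonneg_left (hpow.trans (mul_le_mul_of_nonneg_left
    (mul_le_mul_of_nonneg_right hp1 hσH) hX0)) (by positivity : 0 ≤ a ^ j)).trans ?_
  rw [e1, ← e2]
  refine mul_le_mul_of_nonneg_left (mul_le_mul (pow_le_pow_left₀ (by positivity) hav j)
    (add_le_add h1 h2) (by positivity) (by positivity)) hX0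


end Deconvolution

end

end NearCritical

namespace NearCritical

open MeasureTheory Filter Topology

noncomputable section

/-! ### The three contributions to the deconvolution bound -/

section Assembly

open PowerSeries

variable {n : ℕ}

lemma ae_ne_zero_torus : ∀ᵐ k ∂(volume.restrict (torus (n + 1))), k ≠ 0 :=
  ae_restrict_of_ae (by simp [ae_iff])

lemma continuous_weight {N : ℕ} (hN : 0 < N) :
    Continuous fun k : Fin (n + 1) → ℝ => ((‖k‖ ^ 2 + ((N : ℝ) ^ 2)⁻¹) ^ 2)⁻¹ := by
  have hN' : (0 : ℝ) < N := by exact_mod_cast hN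
  exact Continuous.inv₀ (by fun_prop) fun k => by positivity

/-- Here the oscillation is used: M integrations by parts at scale N, equal to the first coordinate
of x, followed by the pointwise bound. The profile integrates to order N^{-(d-2)}, and
`HighOrderBound` gives the same for each weighted function `near N i f` with i ≥ T. -/
lemma exists_main_term_le (hn : 2 < n + 1) {K c CH θ : ℝ} {T : ℕ} (hT : 2 ≤ T) (hK : 0 < K)
    (hc : 0 < c) (hc1 : c ≤ 1) (hCH : 0 ≤ CH) (hθ : 0 ≤ θ) (hθT : θ ≤ T) (j : ℕ) :
    ∃ C > 0, ∀ (m : ℝ) (f : (Fin (n + 1) → ℤ) → ℝ), IsMassiveSymbol K c m f →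
      HighOrderBound CH θ f → ∀ (N : ℕ), 0 < N → ∀ x : Fin (n + 1) → ℤ, x 0 = N →
      ‖∫ k in torus (n + 1), Complex.exp (-(Complex.I * (phase k x : ℂ))) *
        (((((K + 1) / (N : ℝ) ^ 2 : ℝ)) : ℂ) ^ j *
          (fourier (near N 0 f) k + ((K + 1) / (N : ℝ) ^ 2 : ℝ))⁻¹ ^ (j + 1))‖ ≤
        C / (N : ℝ) ^ (n + 1 - 2) := by
  obtain ⟨Cp, hCp, hprof⟩ := exists_integral_profile_le hn
  obtain ⟨C₁, hC₁, hpt⟩ := exists_norm_coeff_truncSeries_le K c n T hT hK hc hc1 j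
  set M := 2 * (n + 1) * (T - 1) with hM
  refine ⟨M.factorial * (C₁ * (Cp + (M + 1) * CH)), by positivity,
    fun m f hf hH N hN x hx => ?_⟩
  have hN' : (0 : ℝ) < N := by exact_mod_cast hN
  have hxN : (x 0 : ℝ) = (N : ℝ) := by rw [hx]; simp
  set a : ℝ := (K + 1) / (N : ℝ) ^ 2 with ha
  have ha0 : 0 < a := by positivity
  have hTay : IsTaylorFamily (N : ℝ) fun k => (truncSeries N a f k)⁻¹ ^ (j + 1) :=
    ((isTaylorFamily_truncSeries hN a).inv fun k => by
      rw [constantCoeff_truncSeries]; exact hf.near_ne_zero hN k).pow_succ j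
  have hcc : ∀ k, constantCoeff ((truncSeries N a f k)⁻¹ ^ (j + 1)) =
      (fourier (near N 0 f) k + a)⁻¹ ^ (j + 1) := fun k => by
    rw [map_pow, constantCoeff_inv, constantCoeff_truncSeries]
  have hibp := hTay.norm_integral_exp_mul_constantCoeff_le hxN hN'.ne' M
  simp only [hcc] at hibp
  have hpull : ∫ k in torus (n + 1), Complex.exp (-(Complex.I * (phase k x : ℂ))) *
      ((a : ℂ) ^ j * (fourier (near N 0 f) k + a)⁻¹ ^ (j + 1)) =
      (a : ℂ) ^ j * ∫ k in torus (n + 1), Complex.exp (-(Complex.I * (phase k x : ℂ))) *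
        (fourier (near N 0 f) k + a)⁻¹ ^ (j + 1) := by
    rw [← integral_const_mul]
    congr 1; funext k; ring
  rw [hpull, norm_mul, norm_pow, Complex.norm_real, Real.norm_of_nonneg ha0.le]
  obtain ⟨hpi, hpb⟩ := hprof N hN'
  have hni : ∀ i, IntegrableOn (fun k => ‖fourier (near N i f) k‖ *
      ((‖k‖ ^ 2 + ((N : ℝ) ^ 2)⁻¹) ^ 2)⁻¹) (torus (n + 1)) := fun i =>
    integrableOn_torus_of_continuous
      ((continuous_fourier (hf.summable_near hN i)).norm.mul (continuous_weight hN))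
  have hsi := integrable_finsetSum (μ := volume.restrict (torus (n + 1))) (Finset.Icc T M)
    fun i _ => hni i
  calc a ^ j * ‖∫ k in torus (n + 1), Complex.exp (-(Complex.I * (phase k x : ℂ))) *
        (fourier (near N 0 f) k + a)⁻¹ ^ (j + 1)‖
      ≤ a ^ j * (M.factorial * ∫ k in torus (n + 1),
          ‖coeff M ((truncSeries N a f k)⁻¹ ^ (j + 1))‖) := by gcongr
    _ = M.factorial * ∫ k in torus (n + 1),
          a ^ j * ‖coeff M ((truncSeries N a f k)⁻¹ ^ (j + 1))‖ := by
        rw [integral_const_mul]; ring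
    _ ≤ M.factorial * ∫ k in torus (n + 1),
          C₁ * ((‖k‖ ^ 2)⁻¹ * ((1 + (N : ℝ) ^ 2 * ‖k‖ ^ 2) ^ (n + 1))⁻¹ +
        ∑ i ∈ Finset.Icc T M,
          ‖fourier (near N i f) k‖ * ((‖k‖ ^ 2 + ((N : ℝ) ^ 2)⁻¹) ^ 2)⁻¹) := by
        gcongr 1
        refine integral_mono_ae ?_ ((hpi.add hsi).const_mul _) ?_
        · exact integrableOn_torus_of_continuous (continuous_const.mul (hTay.cont M).norm)
        · filter_upwards [ae_ne_zero_torus, ae_restrict_mem measurableSet_torus] with k hk0 hk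
          exact hpt m f hf N hN k hk hk0
    _ = M.factorial * (C₁ * ((∫ k in torus (n + 1),
          (‖k‖ ^ 2)⁻¹ * ((1 + (N : ℝ) ^ 2 * ‖k‖ ^ 2) ^ (n + 1))⁻¹) +
        ∑ i ∈ Finset.Icc T M, ∫ k in torus (n + 1),
          ‖fourier (near N i f) k‖ * ((‖k‖ ^ 2 + ((N : ℝ) ^ 2)⁻¹) ^ 2)⁻¹)) := by
        rw [integral_const_mul, integral_add hpi hsi, integral_finsetSum _ fun i _ => hni i]
    _ ≤ M.factorial * (C₁ * (Cp / (N : ℝ) ^ (n + 1 - 2) +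
          ∑ _i ∈ Finset.Icc T M, CH / (N : ℝ) ^ (n + 1 - 2))) := by
        gcongr with i hi
        refine hH N hN _ (abs_near_le hN i) (abs_near_le_rpow hN hθ (hθT.trans ?_))
        exact_mod_cast (Finset.mem_Icc.1 hi).1
    _ ≤ M.factorial * (C₁ * (Cp / (N : ℝ) ^ (n + 1 - 2) +
          (M + 1) * (CH / (N : ℝ) ^ (n + 1 - 2)))) := by
        gcongr
        rw [Finset.sum_const, Nat.card_Icc, nsmul_eq_mul]
        gcongr
        calc ((M + 1 - T : ℕ) : ℝ) ≤ ((M + 1 : ℕ) : ℝ) := by gcongr; omega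
          _ = _ := by push_cast; rfl
    _ = _ := by ring

/-- With u and w the two inverses, u - w is minus the tail transform times u w. The difference of
powers is thus linear in the tail, and the factor v² left after pairing each a with a v is the
weight in `HighOrderBound`. No oscillation is needed. -/
lemma difference_term_le {K c CH θ m : ℝ} (hθ : 0 ≤ θ) (j : ℕ)
    {f : (Fin (n + 1) → ℤ) → ℝ} (hf : IsMassiveSymbol K c m f) (hH : HighOrderBound CH θ f)
    {N : ℕ} (hN : 0 < N) (x : Fin (n + 1) → ℤ) :
    ‖∫ k in torus (n + 1), Complex.exp (-(Complex.I * (phase k x : ℂ))) *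
        (((((K + 1) / (N : ℝ) ^ 2 : ℝ)) : ℂ) ^ j *
          ((fourier f k + ((K + 1) / (N : ℝ) ^ 2 : ℝ))⁻¹ ^ (j + 1) -
          (fourier (near N 0 f) k + ((K + 1) / (N : ℝ) ^ 2 : ℝ))⁻¹ ^ (j + 1)))‖ ≤
        ((j + 1) * ((K + 1) / c) ^ j * (c ^ 2)⁻¹ * CH) / (N : ℝ) ^ (n + 1 - 2) := by
  have hK := hf.K_pos
  have hc := hf.c_pos
  have hN' : (0 : ℝ) < N := by exact_mod_cast hN
  set a : ℝ := (K + 1) / (N : ℝ) ^ 2 with ha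
  have ha0 : 0 < a := by positivity
  have hi : IntegrableOn (fun k => ‖fourier (far N f) k‖ *
      ((‖k‖ ^ 2 + ((N : ℝ) ^ 2)⁻¹) ^ 2)⁻¹) (torus (n + 1)) :=
    integrableOn_torus_of_continuous
      ((continuous_fourier hf.summable_far).norm.mul (continuous_weight hN))
  have hb := hH N hN (far N f) abs_far_le (abs_far_le_rpow hN hθ)
  refine (norm_integral_le_of_norm_le (hi.const_mul ((j + 1) * ((K + 1) / c) ^ j * (c ^ 2)⁻¹))
    ?_).trans ?_
  · filter_upwards [ae_restrict_mem measurableSet_torus] with k hk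
    set v := (c * (‖k‖ ^ 2 + m ^ 2 + ((N : ℝ) ^ 2)⁻¹))⁻¹ with hv
    have hv0 : 0 < v := by positivity
    set u := (fourier f k + a)⁻¹ with hu
    set w := (fourier (near N 0 f) k + a)⁻¹ with hw
    have hur : ‖u‖ ≤ v := hf.norm_inv_add_le hN hk
    have hwr : ‖w‖ ≤ v := hf.norm_inv_near_le hN hk
    have huw : ‖u - w‖ ≤ ‖fourier (far N f) k‖ * v ^ 2 := by
      have e : u - w = -(fourier (far N f) k) * (u * w) := by
        have e1 := mul_inv_cancel₀ (hf.add_ne_zero k ha0.le)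
        have e2 := mul_inv_cancel₀ (hf.near_ne_zero hN k)
        rw [← hu] at e1
        rw [← ha, ← hw] at e2
        rw [hf.fourier_eq hN k] at e1
        linear_combination w * e1 - u * e2
      rw [e, norm_mul, norm_neg, norm_mul, pow_two]
      gcongr
    have hav : a * v ≤ (K + 1) / c := IsMassiveSymbol.inv_scale_le_const hc hN hK k
    have hv2 := IsMassiveSymbol.inv_scale_sq_le (m := m) hc hN k
    rw [norm_mul, norm_exp_neg_I_phase, one_mul, norm_mul, norm_pow, Complex.norm_real,
      Real.norm_of_nonneg ha0.le]
    calc a ^ j * ‖u ^ (j + 1) - w ^ (j + 1)‖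
        ≤ a ^ j * ((j + 1) * v ^ j * (‖fourier (far N f) k‖ * v ^ 2)) := by
          gcongr
          refine (norm_pow_sub_pow_le' hur hwr j).trans ?_
          gcongr
      _ = (j + 1) * (a * v) ^ j * (‖fourier (far N f) k‖ * v ^ 2) := by
          rw [mul_pow a v]; ring
      _ ≤ (j + 1) * ((K + 1) / c) ^ j * (‖fourier (far N f) k‖ *
            ((c ^ 2)⁻¹ * ((‖k‖ ^ 2 + ((N : ℝ) ^ 2)⁻¹) ^ 2)⁻¹)) := by
          gcongr
      _ = _ := by ring
  · rw [integral_const_mul, mul_div_assoc]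
    gcongr

/-- Absolute values suffice: d factors a/(f̂ + a) together with |f̂|⁻¹ are dominated by the
scale-invariant profile. -/
lemma exists_remainder_term_le (hn : 2 < n + 1) {K c : ℝ} (hK : 0 < K) (hc : 0 < c) :
    ∃ C > 0, ∀ (m : ℝ) (f : (Fin (n + 1) → ℤ) → ℝ), IsMassiveSymbol K c m f →
      ∀ (N : ℕ), 0 < N → ∀ x : Fin (n + 1) → ℤ,
      ‖∫ k in torus (n + 1), Complex.exp (-(Complex.I * (phase k x : ℂ))) *
        (((((K + 1) / (N : ℝ) ^ 2 : ℝ)) : ℂ) ^ (n + 1) * ((fourier f k)⁻¹ *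
          (fourier f k + ((K + 1) / (N : ℝ) ^ 2 : ℝ))⁻¹ ^ (n + 1)))‖ ≤
        C / (N : ℝ) ^ (n + 1 - 2) := by
  obtain ⟨Cp, hCp, hprof⟩ := exists_integral_profile_le hn
  refine ⟨c⁻¹ * ((K + 1) / c) ^ (n + 1) * Cp, by positivity, fun m f hf N hN x => ?_⟩
  have hN' : (0 : ℝ) < N := by exact_mod_cast hN
  set a : ℝ := (K + 1) / (N : ℝ) ^ 2 with ha
  have ha0 : 0 < a := by positivity
  obtain ⟨hpi, hpb⟩ := hprof N hN'
  refine (norm_integral_le_of_norm_le (hpi.const_mul (c⁻¹ * ((K + 1) / c) ^ (n + 1))) ?_).trans ?_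
  · filter_upwards [ae_ne_zero_torus, ae_restrict_mem measurableSet_torus] with k hk0 hk
    have hkp : 0 < ‖k‖ := norm_pos_iff.2 hk0
    set v := (c * (‖k‖ ^ 2 + m ^ 2 + ((N : ℝ) ^ 2)⁻¹))⁻¹ with hv
    have hv0 : 0 < v := by positivity
    have hur : ‖(fourier f k + a)⁻¹‖ ≤ v := hf.norm_inv_add_le hN hk
    have hB : ‖(fourier f k)⁻¹‖ ≤ (c * ‖k‖ ^ 2)⁻¹ := by
      rw [norm_inv]
      gcongr
      refine le_trans ?_ ((hf.lower k hk).trans ((le_abs_self _).trans (Complex.abs_re_le_norm _)))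
      gcongr
      linarith [sq_nonneg m]
    have hav := IsMassiveSymbol.inv_scale_le (m := m) hc hN hK k
    rw [norm_mul, norm_exp_neg_I_phase, one_mul, norm_mul, norm_pow, Complex.norm_real,
      Real.norm_of_nonneg ha0.le, norm_mul, norm_pow]
    calc a ^ (n + 1) * (‖(fourier f k)⁻¹‖ * ‖(fourier f k + a)⁻¹‖ ^ (n + 1))
        ≤ a ^ (n + 1) * ((c * ‖k‖ ^ 2)⁻¹ * v ^ (n + 1)) := by gcongr
      _ = (c * ‖k‖ ^ 2)⁻¹ * (a * v) ^ (n + 1) := by rw [mul_pow a v]; ring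
      _ ≤ (c * ‖k‖ ^ 2)⁻¹ * ((K + 1) / c * (1 + (N : ℝ) ^ 2 * ‖k‖ ^ 2)⁻¹) ^ (n + 1) := by
          gcongr
      _ = _ := by rw [mul_inv, mul_pow, inv_pow]; ring
  · rw [integral_const_mul, mul_div_assoc]
    gcongr

/-- Deconvolution bound: the inverse Fourier transform of the reciprocal of a massive symbol decays
like the Green function of the Laplacian, uniformly in the mass. -/
theorem exists_integral_inv_le (hn : 2 < n + 1) {K c CH θ : ℝ} {T : ℕ} (hT : 2 ≤ T) (hK : 0 < K)
    (hc : 0 < c) (hc1 : c ≤ 1) (hCH : 0 ≤ CH) (hθ : 0 ≤ θ) (hθT : θ ≤ T) :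
    ∃ C > 0, ∀ (m : ℝ) (f : (Fin (n + 1) → ℤ) → ℝ), IsMassiveSymbol K c m f →
      HighOrderBound CH θ f → ∀ x : Fin (n + 1) → ℤ, 0 < x 0 →
      ‖∫ k in torus (n + 1), Complex.exp (-(Complex.I * (phase k x : ℂ))) / fourier f k‖ ≤
        C / (x 0 : ℝ) ^ (n + 1 - 2) := by
  choose C₁ hC₁ hmain using fun j =>
    exists_main_term_le hn hT hK hc hc1 hCH hθ hθT (n := n) j
  obtain ⟨C₂, hC₂, hrem⟩ := exists_remainder_term_le hn hK hc
  refine ⟨∑ j ∈ Finset.range (n + 1), (C₁ j + (j + 1) * ((K + 1) / c) ^ j * (c ^ 2)⁻¹ * CH) + C₂,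
    ?_, fun m f hf hH x hx => ?_⟩
  · have : 0 ≤ ∑ j ∈ Finset.range (n + 1), (C₁ j + (j + 1) * ((K + 1) / c) ^ j * (c ^ 2)⁻¹ * CH) :=
      Finset.sum_nonneg fun j _ => by have := hC₁ j; positivity
    linarith
  -- The truncation radius is the first coordinate of x itself.
  obtain ⟨N, hxN⟩ := Int.eq_ofNat_of_zero_le hx.le
  have hN : 0 < N := by omega
  have hN' : (0 : ℝ) < N := by exact_mod_cast hN
  have hxr : (x 0 : ℝ) = N := by rw [hxN]; simp
  rw [hxr]
  set a : ℝ := (K + 1) / (N : ℝ) ^ 2 with ha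
  have ha0 : 0 < a := by positivity
  have hcf := continuous_fourier hf.summable
  have hcn := continuous_fourier (hf.summable_near hN 0)
  have hB0 : ∀ k, fourier f k ≠ 0 := fun k => by simpa using hf.add_ne_zero k le_rfl
  have hu : Continuous fun k => (fourier f k + a)⁻¹ :=
    Continuous.inv₀ (by fun_prop) fun k => hf.add_ne_zero k ha0.le
  have hw : Continuous fun k => (fourier (near N 0 f) k + a)⁻¹ :=
    Continuous.inv₀ (by fun_prop) fun k => hf.near_ne_zero hN k
  have hBi : Continuous fun k => (fourier f k)⁻¹ := hcf.inv₀ hB0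
  set e : (Fin (n + 1) → ℝ) → ℂ := fun k => Complex.exp (-(Complex.I * (phase k x : ℂ))) with he
  have hec : Continuous e := by fun_prop
  have hsplit : ∀ k, e k / fourier f k =
      ∑ j ∈ Finset.range (n + 1), (e k * ((a : ℂ) ^ j * (fourier (near N 0 f) k + a)⁻¹ ^ (j + 1)) +
        e k * ((a : ℂ) ^ j * ((fourier f k + a)⁻¹ ^ (j + 1) -
          (fourier (near N 0 f) k + a)⁻¹ ^ (j + 1)))) +
      e k * ((a : ℂ) ^ (n + 1) * ((fourier f k)⁻¹ * (fourier f k + a)⁻¹ ^ (n + 1))) := fun k => by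
    have hinv := congrArg (e k * ·) (inv_eq_sum_add (hB0 k) (hf.add_ne_zero k ha0.le) (n + 1))
    rw [div_eq_mul_inv, hinv, mul_add, Finset.mul_sum]
    congr 1
    exact Finset.sum_congr rfl fun j _ => by ring
  have i1 : ∀ j, IntegrableOn (fun k => e k * ((a : ℂ) ^ j *
      (fourier (near N 0 f) k + a)⁻¹ ^ (j + 1))) (torus (n + 1)) := fun j =>
    integrableOn_torus_of_continuous (by fun_prop)
  have i2 : ∀ j, IntegrableOn (fun k => e k * ((a : ℂ) ^ j * ((fourier f k + a)⁻¹ ^ (j + 1) -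
      (fourier (near N 0 f) k + a)⁻¹ ^ (j + 1)))) (torus (n + 1)) := fun j =>
    integrableOn_torus_of_continuous (by fun_prop)
  have i3 : IntegrableOn (fun k => e k * ((a : ℂ) ^ (n + 1) * ((fourier f k)⁻¹ *
      (fourier f k + a)⁻¹ ^ (n + 1)))) (torus (n + 1)) :=
    integrableOn_torus_of_continuous (by fun_prop)
  have hInt : ∫ k in torus (n + 1), e k / fourier f k =
      ∑ j ∈ Finset.range (n + 1), ((∫ k in torus (n + 1), e k * ((a : ℂ) ^ j *
          (fourier (near N 0 f) k + a)⁻¹ ^ (j + 1))) +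
        ∫ k in torus (n + 1), e k * ((a : ℂ) ^ j * ((fourier f k + a)⁻¹ ^ (j + 1) -
          (fourier (near N 0 f) k + a)⁻¹ ^ (j + 1)))) +
      ∫ k in torus (n + 1), e k * ((a : ℂ) ^ (n + 1) * ((fourier f k)⁻¹ *
        (fourier f k + a)⁻¹ ^ (n + 1))) := by
    have i12 : ∀ j, IntegrableOn (fun k => e k * ((a : ℂ) ^ j *
        (fourier (near N 0 f) k + a)⁻¹ ^ (j + 1)) + e k * ((a : ℂ) ^ j *
        ((fourier f k + a)⁻¹ ^ (j + 1) - (fourier (near N 0 f) k + a)⁻¹ ^ (j + 1))))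
        (torus (n + 1)) := fun j => (i1 j).add (i2 j)
    simp_rw [hsplit]
    rw [integral_add (integrable_finsetSum _ fun j _ => i12 j) i3,
      integral_finsetSum _ fun j _ => i12 j]
    congr 1
    exact Finset.sum_congr rfl fun j _ => integral_add (i1 j) (i2 j)
  rw [hInt, add_div, Finset.sum_div]
  refine (norm_add_le _ _).trans (add_le_add ((norm_sum_le _ _).trans
    (Finset.sum_le_sum fun j _ => (norm_add_le _ _).trans ?_)) (hrem m f hf N hN x))
  rw [add_div]
  exact add_le_add (hmain j m f hf hH N hN x hxN) (difference_term_le hθ j hf hH hN x)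

end Assembly

end

end NearCritical

namespace NearCritical

open MeasureTheory Filter Topology

noncomputable section

/-! ### Elementary Taylor estimates with fractional exponents -/

section Elementary

lemma rpow_two_add_ge_sq {t ε : ℝ} (ht : 1 ≤ |t|) (hε : 0 < ε) : t ^ 2 ≤ |t| ^ (2 + ε) := by
  rw [← sq_abs, ← Real.rpow_two]
  exact Real.rpow_le_rpow_of_exponent_le ht (by linarith)

lemma pow_le_rpow_of_abs_le_one {t r : ℝ} {j : ℕ} (ht : |t| ≤ 1) (hr : 0 ≤ r) (hj : r ≤ j) :
    |t| ^ j ≤ |t| ^ r := by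
  rw [← Real.rpow_natCast]
  exact Real.rpow_le_rpow_of_exponent_ge' (abs_nonneg t) ht hr hj

lemma abs_cos_sub_le {t ε : ℝ} (hε : 0 < ε) (hε1 : ε ≤ 1) :
    |Real.cos t - 1 + t ^ 2 / 2| ≤ |t| ^ (2 + ε) := by
  rcases le_total |t| 1 with ht | ht
  · have h := Real.cos_bound ht
    have h2 : |t| ^ 4 ≤ |t| ^ (2 + ε) :=
      pow_le_rpow_of_abs_le_one ht (by linarith) (by push_cast; linarith)
    have e : Real.cos t - 1 + t ^ 2 / 2 = Real.cos t - (1 - t ^ 2 / 2) := by ring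
    rw [e]
    have : 0 ≤ |t| ^ 4 := by positivity
    linarith
  · have h1 := Real.one_sub_sq_div_two_le_cos (x := t)
    have h2 := Real.cos_le_one t
    have h3 := rpow_two_add_ge_sq ht hε
    rw [abs_le]
    constructor <;> nlinarith [sq_nonneg t]

lemma abs_exp_sub_one_le {t : ℝ} : |Real.exp t - 1| ≤ |t| * (Real.exp t + 1) := by
  have hp := Real.exp_pos t
  rcases le_total 0 t with ht | ht
  · rw [abs_of_nonneg ht, abs_of_nonneg (by linarith [Real.one_le_exp ht])]
    have h := Real.add_one_le_exp (-t)
    have : Real.exp (-t) * Real.exp t = 1 := by rw [← Real.exp_add]; simp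
    nlinarith
  · rw [abs_of_nonpos ht, abs_of_nonpos (by linarith [Real.exp_le_one_iff.2 ht])]
    have h := Real.add_one_le_exp t
    nlinarith

/-- The linear bound for |t| ≤ 1 and the trivial one for |t| ≥ 1. The factor exp t + 1 is what the
tilted and untilted moments control together. -/
lemma abs_exp_sub_one_le_rpow {t ε : ℝ} (hε : 0 < ε) (hε1 : ε ≤ 1) :
    |Real.exp t - 1| ≤ |t| ^ ε * (Real.exp t + 1) := by
  have hp := Real.exp_pos t
  rcases le_total |t| 1 with ht | ht
  · refine abs_exp_sub_one_le.trans ?_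
    gcongr
    simpa using pow_le_rpow_of_abs_le_one (j := 1) ht hε.le (by simpa using hε1)
  · have h1 : 1 ≤ |t| ^ ε := Real.one_le_rpow ht hε.le
    have h2 : |Real.exp t - 1| ≤ Real.exp t + 1 := by rw [abs_le]; constructor <;> linarith
    nlinarith

lemma abs_exp_sub_quadratic_le {t ε : ℝ} (hε : 0 < ε) (hε1 : ε ≤ 1) :
    |Real.exp t - 1 - t - t ^ 2 / 2| ≤ |t| ^ (2 + ε) * (Real.exp t + 1) := by
  have hp := Real.exp_pos t
  rcases le_total |t| 1 with ht | ht
  · have h := Real.exp_bound ht (n := 3) (by norm_num)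
    have h2 : |t| ^ 3 ≤ |t| ^ (2 + ε) :=
      pow_le_rpow_of_abs_le_one ht (by linarith) (by push_cast; linarith)
    have h0 : 0 ≤ |t| ^ 3 := by positivity
    have e : Real.exp t - ∑ i ∈ Finset.range 3, t ^ i / i.factorial =
        Real.exp t - 1 - t - t ^ 2 / 2 := by
      simp [Finset.sum_range_succ, Nat.factorial]; ring
    rw [e] at h
    norm_num [Nat.factorial] at h
    nlinarith
  · have h3 := rpow_two_add_ge_sq ht hε
    have h1 : 1 ≤ |t| ^ (2 + ε) := Real.one_le_rpow ht (by linarith)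
    rcases le_total 0 t with h0 | h0
    · have := Real.quadratic_le_exp_of_nonneg h0
      rw [abs_of_nonneg (by linarith)]
      nlinarith [sq_nonneg t]
    · rw [abs_of_nonpos h0] at ht
      have hle := Real.exp_le_one_iff.2 h0
      rw [abs_le]
      constructor <;> nlinarith [sq_nonneg (t + 1), sq_nonneg t]

end Elementary

/-! ### Lower bounds for the tilted symbol -/

section Family

variable {n : ℕ}

lemma reflect_involutive {d : ℕ} (i : Fin d) : Function.Involutive (reflect i) := fun x => by
  funext j
  by_cases h : j = i
  · subst h; simp [reflect]
  · simp [reflect, h]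

/-- The bounds satisfied by a single member of a near-critical family, with a small mass. -/
structure IsSubcritical (ε K₁ K₂ μ : ℝ) (F : (Fin (n + 1) → ℤ) → ℝ) : Prop where
  eps_pos : 0 < ε
  eps_le_one : ε ≤ 1
  K₁_pos : 0 < K₁
  K₂_pos : 0 < K₂
  mass_pos : 0 < μ
  symm : IsLatticeSymmetric F
  moment : ∀ s ∈ Set.Ico 0 μ,
    Summable (fun y : Fin (n + 1) → ℤ => latNorm y ^ (2 + ε : ℝ) * |tilt s F y|) ∧
    ∑' y : Fin (n + 1) → ℤ, latNorm y ^ (2 + ε : ℝ) * |tilt s F y| ≤ K₁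
  nonneg : ∀ s ∈ Set.Ico 0 μ, 0 ≤ (fourier (tilt s F) 0).re
  infrared : ∀ k ∈ torus (n + 1), K₂ * euclNorm k ^ 2 ≤ (fourier F k).re - (fourier F 0).re
  small : μ ^ ε * ((72 + 2 * (n + 1) ^ 2) * K₁) ≤ K₂

lemma tilt_zero (F : (Fin (n + 1) → ℤ) → ℝ) : tilt 0 F = F := by
  funext y; simp [tilt]

lemma abs_tilt (s : ℝ) (F : (Fin (n + 1) → ℤ) → ℝ) (y : Fin (n + 1) → ℤ) :
    |tilt s F y| = |F y| * Real.exp (s * y 0) := by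
  rw [tilt, abs_mul, abs_of_pos (Real.exp_pos _)]

lemma re_fourier {f : (Fin (n + 1) → ℤ) → ℝ} (hf : Summable fun y => |f y|) (k : Fin (n + 1) → ℝ) :
    (fourier f k).re = ∑' y, f y * Real.cos (phase k y) := by
  rw [fourier, Complex.re_tsum (summable_fourier hf k)]
  refine tsum_congr fun y => ?_
  rw [Complex.re_ofReal_mul, mul_comm Complex.I, Complex.exp_ofReal_mul_I_re]

lemma summable_mul_cos {f : (Fin (n + 1) → ℤ) → ℝ} (hf : Summable fun y => |f y|)
    (k : Fin (n + 1) → ℝ) : Summable fun y => f y * Real.cos (phase k y) := by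
  refine Summable.of_norm (Summable.of_nonneg_of_le (fun _ => norm_nonneg _) (fun y => ?_) hf)
  rw [norm_mul]
  exact mul_le_of_le_one_right (abs_nonneg _) (Real.abs_cos_le_one _)

namespace IsSubcritical

variable {ε K₁ K₂ μ : ℝ} {F : (Fin (n + 1) → ℤ) → ℝ}

lemma summable_tilt (hF : IsSubcritical ε K₁ K₂ μ F) {s : ℝ} (hs : s ∈ Set.Ico 0 μ) :
    Summable fun y => |tilt s F y| :=
  summable_of_summable_weight_mul (fun _ => abs_nonneg _)
    (fun y hy => Real.one_le_rpow (one_le_latNorm hy) (by linarith [hF.eps_pos]))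
    (hF.moment s hs).1

lemma zero_mem (hF : IsSubcritical ε K₁ K₂ μ F) : (0 : ℝ) ∈ Set.Ico 0 μ := ⟨le_rfl, hF.mass_pos⟩

lemma summable (hF : IsSubcritical ε K₁ K₂ μ F) : Summable fun y => |F y| := by
  simpa [tilt_zero] using hF.summable_tilt hF.zero_mem

/-- The weight exp(s y₀) + 1 splits into the moments at tilt s and at tilt 0, each at most K₁. -/
lemma abs_tsum_le (hF : IsSubcritical ε K₁ K₂ μ F) {s b : ℝ} (hs : s ∈ Set.Ico 0 μ) (hb : 0 ≤ b)
    {g : (Fin (n + 1) → ℤ) → ℝ}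
    (hg : ∀ y, |g y| ≤ b * (latNorm y ^ (2 + ε) * (|F y| * (Real.exp (s * y 0) + 1)))) :
    Summable g ∧ |∑' y, g y| ≤ b * (2 * K₁) := by
  obtain ⟨h1, h1'⟩ := hF.moment s hs
  obtain ⟨h0, h0'⟩ := hF.moment 0 hF.zero_mem
  have hadd := (h1.add h0).mul_left b
  have hle : ∀ y, ‖g y‖ ≤ b * (latNorm y ^ (2 + ε) * |tilt s F y| +
      latNorm y ^ (2 + ε) * |tilt 0 F y|) := fun y => by
    refine (hg y).trans_eq ?_
    rw [abs_tilt, tilt_zero]; ring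
  have hs' := Summable.of_nonneg_of_le (fun y => norm_nonneg (g y)) hle hadd
  refine ⟨hs'.of_norm, ?_⟩
  calc |∑' y, g y| ≤ ∑' y, ‖g y‖ := norm_tsum_le_tsum_norm hs'
    _ ≤ ∑' y, b * (latNorm y ^ (2 + ε) * |tilt s F y| + latNorm y ^ (2 + ε) * |tilt 0 F y|) :=
        hs'.tsum_le_tsum hle hadd
    _ = b * ((∑' y, latNorm y ^ (2 + ε) * |tilt s F y|) +
          ∑' y, latNorm y ^ (2 + ε) * |tilt 0 F y|) := by
        rw [tsum_mul_left, h1.tsum_add h0]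
    _ ≤ b * (2 * K₁) := by gcongr; linarith

lemma sq_coord_le (hε : 0 < ε) (y : Fin (n + 1) → ℤ) : (y 0 : ℝ) ^ 2 ≤ latNorm y ^ (2 + ε) := by
  rcases eq_or_ne y 0 with rfl | hy
  · simp; exact Real.rpow_nonneg (latNorm_nonneg _) _
  · rw [← sq_abs]
    calc |(y 0 : ℝ)| ^ 2 ≤ latNorm y ^ 2 := by gcongr; exact abs_coord_le_latNorm y 0
      _ ≤ _ := by
        rw [← Real.rpow_two]
        exact Real.rpow_le_rpow_of_exponent_le (one_le_latNorm hy) (by linarith)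

lemma abs_coord_le_rpow (hε : 0 < ε) (y : Fin (n + 1) → ℤ) :
    |(y 0 : ℝ)| ≤ latNorm y ^ (2 + ε) := by
  refine le_trans ?_ (sq_coord_le hε y)
  have h : |y 0| ≤ (y 0) ^ 2 := by
    rw [← sq_abs]; exact Int.le_self_sq _
  exact_mod_cast h

lemma summable_coord_mul (hF : IsSubcritical ε K₁ K₂ μ F) :
    Summable fun y : Fin (n + 1) → ℤ => (y 0 : ℝ) * F y := by
  refine (hF.abs_tsum_le hF.zero_mem (b := 1) zero_le_one fun y => ?_).1
  rw [abs_mul, one_mul]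
  simp only [zero_mul, Real.exp_zero]
  have := abs_coord_le_rpow hF.eps_pos y
  exact mul_le_mul this (by linarith [abs_nonneg (F y)]) (abs_nonneg _)
    (Real.rpow_nonneg (latNorm_nonneg y) _)

lemma summable_sq_mul (hF : IsSubcritical ε K₁ K₂ μ F) :
    Summable fun y : Fin (n + 1) → ℤ => (y 0 : ℝ) ^ 2 * F y := by
  refine (hF.abs_tsum_le hF.zero_mem (b := 1) zero_le_one fun y => ?_).1
  rw [abs_mul, one_mul, abs_of_nonneg (sq_nonneg _)]
  simp only [zero_mul, Real.exp_zero]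
  have := sq_coord_le hF.eps_pos y
  exact mul_le_mul this (by linarith [abs_nonneg (F y)]) (abs_nonneg _)
    (Real.rpow_nonneg (latNorm_nonneg y) _)

lemma tsum_coord_mul (hF : IsSubcritical ε K₁ K₂ μ F) :
    ∑' y : Fin (n + 1) → ℤ, (y 0 : ℝ) * F y = 0 := by
  have h := (Function.Involutive.toPerm _ (reflect_involutive (0 : Fin (n + 1)))).tsum_eq
    (fun y : Fin (n + 1) → ℤ => (y 0 : ℝ) * F y)
  rw [Function.Involutive.coe_toPerm] at h
  have e : ∀ y : Fin (n + 1) → ℤ, ((reflect 0 y 0 : ℤ) : ℝ) * F (reflect 0 y) =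
      -((y 0 : ℝ) * F y) := fun y => by
    rw [hF.symm.reflect]
    simp [reflect]
  simp_rw [e] at h
  rw [tsum_neg] at h
  linarith

/-- The infrared bound along the first axis, with cos expanded to second order. Letting k tend to 0
would give -2K₂; one small fixed k loses part of this and still leaves -K₂. -/
lemma tsum_sq_mul_le (hF : IsSubcritical ε K₁ K₂ μ F) :
    ∑' y : Fin (n + 1) → ℤ, (y 0 : ℝ) ^ 2 * F y ≤ -K₂ := by
  have hε := hF.eps_pos
  have hK₁ := hF.K₁_pos
  have hK₂ := hF.K₂_pos
  -- Small enough for the cosine error t^{2+ε} K₁ to be at most K₂ t²/4; the bound t ≤ 1 keeps k in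
  -- the torus.
  set t : ℝ := min 1 ((K₂ / (4 * K₁)) ^ (1 / ε)) with ht
  have ht0 : 0 < t := lt_min one_pos (by positivity)
  have htε : t ^ ε * (4 * K₁) ≤ K₂ := by
    have : t ^ ε ≤ K₂ / (4 * K₁) := by
      calc t ^ ε ≤ ((K₂ / (4 * K₁)) ^ (1 / ε)) ^ ε := by gcongr; exact min_le_right _ _
        _ = _ := by rw [← Real.rpow_mul (by positivity), one_div_mul_cancel hε.ne', Real.rpow_one]
    rwa [le_div_iff₀ (by positivity)] at this
  set k : Fin (n + 1) → ℝ := Pi.single 0 t with hk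
  have hkt : k ∈ torus (n + 1) := fun i _ => by
    have hpi := Real.pi_gt_three
    have : t ≤ 1 := min_le_left _ _
    rcases eq_or_ne i 0 with rfl | hi
    · simp only [hk, Pi.single_eq_same]; constructor <;> linarith
    · simp only [hk, Pi.single_eq_of_ne hi]; constructor <;> linarith
  have hph : ∀ y : Fin (n + 1) → ℤ, phase k y = t * y 0 := fun y => by
    rw [phase, Finset.sum_eq_single 0]
    · simp [hk]
    · intro i _ hi; simp [hk, hi]
    · simp
  have hnorm : t ≤ euclNorm k := by
    refine le_trans ?_ (norm_le_euclNorm k)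
    have := norm_le_pi_norm k 0
    rwa [hk, Pi.single_eq_same, Real.norm_of_nonneg ht0.le] at this
  have hir := hF.infrared k hkt
  have hs0 := summable_mul_cos hF.summable
  rw [re_fourier hF.summable, re_fourier hF.summable, ← (hs0 k).tsum_sub (hs0 0)] at hir
  have herr := hF.abs_tsum_le hF.zero_mem (b := t ^ (2 + ε) / 2) (by positivity)
    (g := fun y => F y * (Real.cos (t * y 0) - 1 + (t * y 0) ^ 2 / 2)) fun y => by
      have := latNorm_nonneg y
      rw [abs_mul]
      simp only [zero_mul, Real.exp_zero]
      calc |F y| * |Real.cos (t * y 0) - 1 + (t * y 0) ^ 2 / 2|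
          ≤ |F y| * |t * (y 0 : ℝ)| ^ (2 + ε) := by
            gcongr; exact abs_cos_sub_le hε hF.eps_le_one
        _ ≤ |F y| * (t * latNorm y) ^ (2 + ε) := by
            rw [abs_mul, abs_of_pos ht0]
            gcongr
            exact abs_coord_le_latNorm y 0
        _ = _ := by rw [Real.mul_rpow ht0.le this]; ring
  have heq : ∑' y, (F y * Real.cos (phase k y) - F y * Real.cos (phase 0 y)) =
      (∑' y, F y * (Real.cos (t * y 0) - 1 + (t * y 0) ^ 2 / 2)) -
        t ^ 2 / 2 * ∑' y, (y 0 : ℝ) ^ 2 * F y := by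
    rw [← tsum_mul_left, ← herr.1.tsum_sub (hF.summable_sq_mul.mul_left _)]
    refine tsum_congr fun y => ?_
    rw [hph, phase_zero_left, Real.cos_zero]; ring
  rw [heq] at hir
  have h1 := (abs_le.1 herr.2).2
  have h2 : K₂ * t ^ 2 ≤ K₂ * euclNorm k ^ 2 := by gcongr
  have h3 : t ^ (2 + ε) = t ^ 2 * t ^ ε := by
    rw [Real.rpow_add ht0, Real.rpow_two]
  rw [h3] at h1
  set S := ∑' y : Fin (n + 1) → ℤ, (y 0 : ℝ) ^ 2 * F y
  have h4 : t ^ 2 * (K₂ + S / 2) ≤ t ^ 2 * (t ^ ε * K₁) := by nlinarith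
  have h5 := le_of_mul_le_mul_left h4 (by positivity)
  linarith

/-- As a function of the tilt this is a concave parabola with leading coefficient at most -K₂/2, up
to a small error. It is still nonnegative at a tilt beyond μ/2, so it is of order μ² on [0, μ/2]. -/
lemma re_fourier_tilt_zero_ge (hF : IsSubcritical ε K₁ K₂ μ F) {s : ℝ}
    (hs : s ∈ Set.Icc 0 (μ / 2)) : K₂ / 2 * (μ / 2) ^ 2 ≤ (fourier (tilt s F) 0).re := by
  have hε := hF.eps_pos
  have hK₁ := hF.K₁_pos
  have hK₂ := hF.K₂_pos
  have hμ := hF.mass_pos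
  set S := ∑' y : Fin (n + 1) → ℤ, (y 0 : ℝ) ^ 2 * F y with hS
  have hSle : S ≤ -K₂ := hF.tsum_sq_mul_le
  have hsF : Summable F := hF.summable.of_abs
  have exp : ∀ r ∈ Set.Ico 0 μ,
      |(fourier (tilt r F) 0).re - (∑' y, F y) - r ^ 2 / 2 * S| ≤ r ^ (2 + ε) * (2 * K₁) := by
    intro r hr
    have herr := hF.abs_tsum_le hr (b := r ^ (2 + ε)) (Real.rpow_nonneg hr.1 _)
      (g := fun y => F y * (Real.exp (r * y 0) - 1 - r * y 0 - (r * y 0) ^ 2 / 2)) fun y => by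
        have := latNorm_nonneg y
        have hr0 := hr.1
        rw [abs_mul]
        calc |F y| * |Real.exp (r * y 0) - 1 - r * y 0 - (r * y 0) ^ 2 / 2|
            ≤ |F y| * (|r * (y 0 : ℝ)| ^ (2 + ε) * (Real.exp (r * y 0) + 1)) := by
              gcongr; exact abs_exp_sub_quadratic_le hε hF.eps_le_one
          _ ≤ |F y| * ((r * latNorm y) ^ (2 + ε) * (Real.exp (r * y 0) + 1)) := by
              rw [abs_mul, abs_of_nonneg hr0]
              gcongr
              exact abs_coord_le_latNorm y 0
          _ = _ := by rw [Real.mul_rpow hr0 this]; ring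
    have hst := hF.summable_tilt hr
    rw [re_fourier hst]
    have heq : ∑' y, tilt r F y * Real.cos (phase 0 y) =
        (∑' y, F y * (Real.exp (r * y 0) - 1 - r * y 0 - (r * y 0) ^ 2 / 2)) + (∑' y, F y) +
          r * (∑' y : Fin (n + 1) → ℤ, (y 0 : ℝ) * F y) + r ^ 2 / 2 * S := by
      rw [hS, ← tsum_mul_left, ← tsum_mul_left, ← herr.1.tsum_add hsF,
        ← (herr.1.add hsF).tsum_add (hF.summable_coord_mul.mul_left r),
        ← ((herr.1.add hsF).add (hF.summable_coord_mul.mul_left r)).tsum_add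
          (hF.summable_sq_mul.mul_left _)]
      refine tsum_congr fun y => ?_
      rw [phase_zero_left, Real.cos_zero, tilt]; ring
    rw [heq, hF.tsum_coord_mul]
    refine le_trans (le_of_eq ?_) herr.2
    congr 1; ring
  -- Any point strictly between μ/2 and μ would do. Here (r² - s²)/2 ≥ 5μ²/32, and the two Taylor
  -- errors amount to at most μ²/32 in units of K₂, leaving exactly (μ/2)²/2. The constant 72 = 4 ·
  -- 18 in `small` is chosen for this.
  set r := 3 / 4 * μ with hr
  have hr0 : 0 < r := by positivity
  have e1 := (abs_le.1 (exp s ⟨hs.1, by linarith [hs.2]⟩)).1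
  have e2 := (abs_le.1 (exp r ⟨hr0.le, by linarith⟩)).2
  have hn := hF.nonneg r ⟨hr0.le, by linarith⟩
  have hsr : s ^ (2 + ε) ≤ r ^ (2 + ε) :=
    Real.rpow_le_rpow hs.1 (by linarith [hs.2]) (by linarith)
  have hrε : r ^ (2 + ε) ≤ r ^ 2 * μ ^ ε := by
    rw [Real.rpow_add hr0, Real.rpow_two]
    gcongr
    linarith
  have hsm : μ ^ ε * (72 * K₁) ≤ K₂ := by
    refine le_trans ?_ hF.small
    gcongr
    have : (0 : ℝ) ≤ 2 * (n + 1) ^ 2 := by positivity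
    linarith
  have hs2 : s ^ 2 ≤ (μ / 2) ^ 2 := by have := hs.1; have := hs.2; gcongr
  have h6 : (r ^ 2 - s ^ 2) / 2 * K₂ ≤ (r ^ 2 - s ^ 2) / 2 * (-S) := by
    refine mul_le_mul_of_nonneg_left (by linarith) ?_
    rw [hr]; nlinarith
  have h7 : r ^ (2 + ε) * (4 * K₁) ≤ r ^ 2 * (K₂ / 18) := by
    calc r ^ (2 + ε) * (4 * K₁) ≤ r ^ 2 * μ ^ ε * (4 * K₁) := by gcongr
      _ = r ^ 2 * (μ ^ ε * (72 * K₁) / 18) := by ring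
      _ ≤ _ := by gcongr
  have h8 : s ^ (2 + ε) * (2 * K₁) ≤ r ^ (2 + ε) * (2 * K₁) := by gcongr
  have h9 : (s ^ 2) * K₂ ≤ (μ / 2) ^ 2 * K₂ := by gcongr
  rw [hr] at *
  nlinarith

/-- Tilting changes the difference by the sum of F(y)(exp(s y₀) - 1)(cos(k·y) - 1). This is O(s^ε
|k|²), at most half of the infrared bound by the choice of 2(n+1)² in `small`. -/
lemma re_fourier_tilt_sub_ge (hF : IsSubcritical ε K₁ K₂ μ F) {s : ℝ} (hs : s ∈ Set.Ico 0 μ)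
    {k : Fin (n + 1) → ℝ} (hk : k ∈ torus (n + 1)) :
    K₂ / 2 * ‖k‖ ^ 2 ≤ (fourier (tilt s F) k).re - (fourier (tilt s F) 0).re := by
  have hε := hF.eps_pos
  have hK₁ := hF.K₁_pos
  have hK₂ := hF.K₂_pos
  have hμ := hF.mass_pos
  have hst := hF.summable_tilt hs
  have hir := hF.infrared k hk
  have h0 := summable_mul_cos hF.summable
  have h1 := summable_mul_cos hst
  rw [re_fourier hst, re_fourier hst, ← (h1 k).tsum_sub (h1 0)]
  rw [re_fourier hF.summable, re_fourier hF.summable, ← (h0 k).tsum_sub (h0 0)] at hir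
  have herr := hF.abs_tsum_le hs (b := s ^ ε * ((n + 1) * ‖k‖) ^ 2 / 2)
    (by have := Real.rpow_nonneg hs.1 ε; positivity)
    (g := fun y => F y * ((Real.exp (s * y 0) - 1) * (Real.cos (phase k y) - 1))) fun y => by
      have hl := latNorm_nonneg y
      have hs0 := hs.1
      have hcos : |Real.cos (phase k y) - 1| ≤ ((n + 1) * ‖k‖ * latNorm y) ^ 2 / 2 := by
        rw [abs_of_nonpos (by linarith [Real.cos_le_one (phase k y)])]
        have h1 := Real.one_sub_sq_div_two_le_cos (x := phase k y)
        have h2 := abs_phase_le k y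
        push_cast at h2
        have h3 : (phase k y) ^ 2 ≤ ((n + 1) * ‖k‖ * latNorm y) ^ 2 := by
          rw [← sq_abs]; gcongr
        linarith
      rw [abs_mul, abs_mul]
      calc |F y| * (|Real.exp (s * y 0) - 1| * |Real.cos (phase k y) - 1|)
          ≤ |F y| * ((|s * (y 0 : ℝ)| ^ ε * (Real.exp (s * y 0) + 1)) *
              (((n + 1) * ‖k‖ * latNorm y) ^ 2 / 2)) := by
            gcongr
            exact abs_exp_sub_one_le_rpow hε hF.eps_le_one
        _ ≤ |F y| * (((s * latNorm y) ^ ε * (Real.exp (s * y 0) + 1)) *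
              (((n + 1) * ‖k‖ * latNorm y) ^ 2 / 2)) := by
            rw [abs_mul, abs_of_nonneg hs0]
            gcongr
            exact abs_coord_le_latNorm y 0
        _ = _ := by
            rw [Real.mul_rpow hs0 hl]
            rcases eq_or_lt_of_le hl with h | h
            · rw [← h, Real.zero_rpow hε.ne', Real.zero_rpow (by linarith)]; ring
            · rw [Real.rpow_add h, Real.rpow_two]; ring
  have heq : ∑' y, (tilt s F y * Real.cos (phase k y) - tilt s F y * Real.cos (phase 0 y)) =
      (∑' y, (F y * Real.cos (phase k y) - F y * Real.cos (phase 0 y))) +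
        ∑' y, F y * ((Real.exp (s * y 0) - 1) * (Real.cos (phase k y) - 1)) := by
    rw [← ((h0 k).sub (h0 0)).tsum_add herr.1]
    refine tsum_congr fun y => ?_
    rw [phase_zero_left, Real.cos_zero, tilt]; ring
  rw [heq]
  have e1 := (abs_le.1 herr.2).1
  have e2 : K₂ * ‖k‖ ^ 2 ≤ K₂ * euclNorm k ^ 2 := by gcongr; exact norm_le_euclNorm k
  have hsε : s ^ ε ≤ μ ^ ε := Real.rpow_le_rpow hs.1 hs.2.le hε.le
  have hsm : μ ^ ε * (2 * (n + 1) ^ 2 * K₁) ≤ K₂ := by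
    refine le_trans ?_ hF.small
    gcongr
    linarith
  have e3 : s ^ ε * ((n + 1) * ‖k‖) ^ 2 / 2 * (2 * K₁) ≤ K₂ / 2 * ‖k‖ ^ 2 := by
    calc s ^ ε * ((n + 1) * ‖k‖) ^ 2 / 2 * (2 * K₁) ≤ μ ^ ε * ((n + 1) * ‖k‖) ^ 2 / 2 * (2 * K₁) := by
          gcongr
      _ = (μ ^ ε * (2 * (n + 1) ^ 2 * K₁)) / 2 * ‖k‖ ^ 2 := by ring
      _ ≤ _ := by gcongr
  linarith

lemma re_fourier_tilt_ge (hF : IsSubcritical ε K₁ K₂ μ F) {s : ℝ} (hs : s ∈ Set.Icc 0 (μ / 2))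
    {k : Fin (n + 1) → ℝ} (hk : k ∈ torus (n + 1)) :
    K₂ / 2 * (‖k‖ ^ 2 + (μ / 2) ^ 2) ≤ (fourier (tilt s F) k).re := by
  have h1 := hF.re_fourier_tilt_zero_ge hs
  have h2 := hF.re_fourier_tilt_sub_ge ⟨hs.1, by linarith [hs.2, hF.mass_pos]⟩ hk
  linarith

lemma re_fourier_tilt_pos (hF : IsSubcritical ε K₁ K₂ μ F) {s : ℝ} (hs : s ∈ Set.Icc 0 (μ / 2))
    (k : Fin (n + 1) → ℝ) : 0 < (fourier (tilt s F) k).re := by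
  refine forall_fourier_of_torus (p := fun w => 0 < w.re) (fun k hk => ?_) k
  have := hF.K₂_pos
  have := hF.mass_pos
  exact lt_of_lt_of_le (by positivity) (hF.re_fourier_tilt_ge hs hk)

/-- The drift bound holds because the untilted first moment vanishes by symmetry, so only exp(μ
y₀/2) - 1 contributes, with one factor μ/2. The two moments in `abs_tsum_le` account for 2 * K₁. -/
lemma isMassiveSymbol (hF : IsSubcritical ε K₁ K₂ μ F) :
    IsMassiveSymbol (2 * K₁) (min 1 (K₂ / 2)) (μ / 2) (tilt (μ / 2) F) := by
  have hε := hF.eps_pos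
  have hK₁ := hF.K₁_pos
  have hK₂ := hF.K₂_pos
  have hμ := hF.mass_pos
  have hs : μ / 2 ∈ Set.Ico 0 μ := ⟨by positivity, by linarith⟩
  obtain ⟨hm1, hm2⟩ := hF.moment _ hs
  have hle : ∀ y : Fin (n + 1) → ℤ, latNorm y ^ 2 * |tilt (μ / 2) F y| ≤
      latNorm y ^ (2 + ε) * |tilt (μ / 2) F y| := fun y => by
    gcongr
    rcases eq_or_ne y 0 with rfl | hy
    · rw [latNorm_zero, Real.zero_rpow (by linarith)]; simp
    · rw [← Real.rpow_two]
      exact Real.rpow_le_rpow_of_exponent_le (one_le_latNorm hy) (by linarith)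
  have hsum := Summable.of_nonneg_of_le
    (fun y => mul_nonneg (sq_nonneg (latNorm y)) (abs_nonneg (tilt (μ / 2) F y))) hle hm1
  refine ⟨by positivity, by positivity, min_le_left _ _, by positivity, hsum, ?_, ?_, ?_⟩
  · exact ((hsum.tsum_le_tsum hle hm1).trans hm2).trans (by linarith)
  · have herr := hF.abs_tsum_le hs (b := μ / 2) (by positivity)
      (g := fun y => (y 0 : ℝ) * F y * (Real.exp (μ / 2 * y 0) - 1)) fun y => by
        rw [abs_mul, abs_mul]
        calc |(y 0 : ℝ)| * |F y| * |Real.exp (μ / 2 * y 0) - 1|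
            ≤ |(y 0 : ℝ)| * |F y| * (|μ / 2 * (y 0 : ℝ)| * (Real.exp (μ / 2 * y 0) + 1)) := by
              gcongr; exact abs_exp_sub_one_le
          _ = μ / 2 * ((y 0 : ℝ) ^ 2 * (|F y| * (Real.exp (μ / 2 * y 0) + 1))) := by
              rw [abs_mul, abs_of_pos (by positivity : 0 < μ / 2), ← sq_abs]; ring
          _ ≤ _ := by
              gcongr
              exact sq_coord_le hε y
    have heq : ∑' y : Fin (n + 1) → ℤ, (y 0 : ℝ) * tilt (μ / 2) F y =
        (∑' y, (y 0 : ℝ) * F y * (Real.exp (μ / 2 * y 0) - 1)) +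
          ∑' y : Fin (n + 1) → ℤ, (y 0 : ℝ) * F y := by
      rw [← herr.1.tsum_add hF.summable_coord_mul]
      refine tsum_congr fun y => ?_
      rw [tilt]; ring
    rw [heq, hF.tsum_coord_mul, add_zero]
    exact herr.2.trans_eq (by ring)
  · intro k hk
    refine le_trans ?_ (hF.re_fourier_tilt_ge ⟨by positivity, le_rfl⟩ hk)
    gcongr
    exact min_le_right _ _

end IsSubcritical

end Family

end

end NearCritical

namespace NearCritical

open MeasureTheory Filter Topology

noncomputable section

/-! ### Contour shift in the first momentum component -/

section Shift

variable {n : ℕ}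

lemma exp_mul_le_one_add {s m t : ℝ} (hs : 0 ≤ s) (hsm : s ≤ m) :
    Real.exp (s * t) ≤ 1 + Real.exp (m * t) := by
  rcases le_total t 0 with ht | ht
  · have : Real.exp (s * t) ≤ 1 := Real.exp_le_one_iff.2 (mul_nonpos_of_nonneg_of_nonpos hs ht)
    linarith [Real.exp_pos (m * t)]
  · have : Real.exp (s * t) ≤ Real.exp (m * t) := Real.exp_le_exp.2 (by gcongr)
    linarith

/-- The analytic continuation of the Fourier transform in the first coordinate. -/
def fourierStrip (F : (Fin (n + 1) → ℤ) → ℝ) (k' : Fin n → ℝ) (w : ℂ) : ℂ :=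
  ∑' y, (F y : ℂ) * Complex.exp (Complex.I * (w * (y 0 : ℤ) + (∑ i, k' i * (y i.succ : ℝ) : ℝ)))

lemma fourierStrip_eq (F : (Fin (n + 1) → ℤ) → ℝ) (k' : Fin n → ℝ) (t s : ℝ) :
    fourierStrip F k' (t + ((-s : ℝ) : ℂ) * Complex.I) =
      fourier (tilt s F) (Matrix.vecCons t k') := by
  refine tsum_congr fun y => ?_
  rw [tilt, phase_vecCons, Complex.ofReal_mul, Complex.ofReal_exp, mul_assoc, ← Complex.exp_add]
  congr 2
  push_cast
  linear_combination (-(s : ℂ) * (y 0 : ℂ)) * Complex.I_mul_I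

lemma norm_fourierStrip_term (F : (Fin (n + 1) → ℤ) → ℝ) (k' : Fin n → ℝ) (w : ℂ)
    (y : Fin (n + 1) → ℤ) :
    ‖(F y : ℂ) * Complex.exp (Complex.I * (w * (y 0 : ℤ) +
      (∑ i, k' i * (y i.succ : ℝ) : ℝ)))‖ = |F y| * Real.exp (-w.im * y 0) := by
  rw [norm_mul, Complex.norm_real, Complex.norm_exp, Real.norm_eq_abs]
  congr 2
  simp

namespace IsSubcritical

variable {ε K₁ K₂ μ : ℝ} {F : (Fin (n + 1) → ℤ) → ℝ}

/-- Cauchy's theorem on the rectangle between Im w = -μ/2 and Im w = 0. On the line Im w = -s the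
continued symbol is the transform of F tilted by s, which has positive real part, so there are no
poles. The series converges uniformly on the strip, being dominated termwise by the sum of its two
edge values. -/
lemma integral_slice_shift (hF : IsSubcritical ε K₁ K₂ μ F) (x : Fin (n + 1) → ℤ)
    (k' : Fin n → ℝ) :
    ∫ t in (-Real.pi)..Real.pi, Complex.exp (-(Complex.I * (phase (Matrix.vecCons t k') x : ℂ))) /
        fourier F (Matrix.vecCons t k') =
      Real.exp (-(μ / 2) * x 0) * ∫ t in (-Real.pi)..Real.pi,
        Complex.exp (-(Complex.I * (phase (Matrix.vecCons t k') x : ℂ))) /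
          fourier (tilt (μ / 2) F) (Matrix.vecCons t k') := by
  have hμ := hF.mass_pos
  set m := μ / 2 with hm
  have hm0 : 0 < m := by positivity
  set Φ := fourierStrip F k' with hΦ
  set κ : ℝ := ∑ i, k' i * (x i.succ : ℝ) with hκ
  set h : ℂ → ℂ := fun w => Complex.exp (-(Complex.I * (w * (x 0 : ℤ) + κ))) / Φ w with hh
  have hu : Summable fun y => |F y| * (1 + Real.exp (m * y 0)) := by
    have h1 := hF.summable_tilt (s := m) ⟨hm0.le, by linarith⟩
    refine (hF.summable.add h1).congr fun y => ?_
    rw [abs_tilt]; ring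
  have hbd : ∀ w : ℂ, w.im ∈ Set.Icc (-m) 0 → ∀ y : Fin (n + 1) → ℤ,
      ‖(F y : ℂ) * Complex.exp (Complex.I * (w * (y 0 : ℤ) +
      (∑ i, k' i * (y i.succ : ℝ) : ℝ)))‖ ≤ |F y| * (1 + Real.exp (m * y 0)) := fun w hw y => by
    rw [norm_fourierStrip_term]
    gcongr
    exact exp_mul_le_one_add (by linarith [hw.2]) (by linarith [hw.1])
  have hΦ0 : ∀ w : ℂ, w.im ∈ Set.Icc (-m) 0 → Φ w ≠ 0 := fun w hw h0 => by
    have e := fourierStrip_eq F k' w.re (-w.im)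
    rw [neg_neg, Complex.re_add_im, ← hΦ, h0] at e
    have := hF.re_fourier_tilt_pos (s := -w.im) ⟨by linarith [hw.2], by linarith [hw.1]⟩
      (Matrix.vecCons w.re k')
    rw [← e] at this
    simp at this
  have hΦc : ContinuousOn Φ {w : ℂ | w.im ∈ Set.Icc (-m) 0} :=
    continuousOn_tsum (fun y => by fun_prop) hu fun y w hw => hbd w hw y
  have hΦd : DifferentiableOn ℂ Φ {w : ℂ | w.im ∈ Set.Ioo (-m) 0} := by
    refine Complex.differentiableOn_tsum_of_summable_norm hu (fun y => ?_) ?_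
      fun y w hw => hbd w ⟨hw.1.le, hw.2.le⟩ y
    · exact Differentiable.differentiableOn (by fun_prop)
    · exact isOpen_Ioo.preimage Complex.continuous_im
  -- Periodicity makes the two vertical sides cancel; x has an integer first coordinate.
  have hper : ∀ s : ℝ, h ((Real.pi : ℝ) + ((-s : ℝ) : ℂ) * Complex.I) =
      h (((-Real.pi : ℝ) : ℂ) + ((-s : ℝ) : ℂ) * Complex.I) := fun s => by
    simp only [hh, hΦ]
    rw [fourierStrip_eq, fourierStrip_eq, fourier_vecCons_pi]
    congr 1
    rw [Complex.exp_eq_exp_iff_exists_int]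
    exact ⟨-(x 0), by push_cast; ring⟩
  have hrect := Complex.integral_boundary_rect_eq_zero_of_continuousOn_of_differentiableOn h
    ⟨-Real.pi, -m⟩ ⟨Real.pi, 0⟩ ?_ ?_
  · simp only at hrect
    have hv : ∫ y in (-m)..0, h ((Real.pi : ℝ) + (y : ℂ) * Complex.I) =
        ∫ y in (-m)..0, h (((-Real.pi : ℝ) : ℂ) + (y : ℂ) * Complex.I) := by
      refine intervalIntegral.integral_congr fun y _ => ?_
      have := hper (-y)
      rwa [neg_neg] at this
    rw [hv, add_sub_cancel_right, sub_eq_zero] at hrect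
    have e0 : ∀ t : ℝ, h (t + ((0 : ℝ) : ℂ) * Complex.I) =
        Complex.exp (-(Complex.I * (phase (Matrix.vecCons t k') x : ℂ))) /
        fourier F (Matrix.vecCons t k') := fun t => by
      have := fourierStrip_eq F k' t 0
      rw [neg_zero, tilt_zero] at this
      simp only [hh, hΦ]
      rw [this, phase_vecCons, ← hκ]
      congr 2
      push_cast; ring
    have e1 : ∀ t : ℝ, h (t + ((-m : ℝ) : ℂ) * Complex.I) = Real.exp (-m * x 0) *
        (Complex.exp (-(Complex.I * (phase (Matrix.vecCons t k') x : ℂ))) /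
        fourier (tilt m F) (Matrix.vecCons t k')) := fun t => by
      simp only [hh, hΦ]
      rw [fourierStrip_eq, phase_vecCons, ← hκ, ← mul_div_assoc, Complex.ofReal_exp, ← Complex.exp_add]
      congr 2
      push_cast
      linear_combination ((m : ℂ) * (x 0 : ℂ)) * Complex.I_mul_I
    simp_rw [e0, e1] at hrect
    rw [← hrect, intervalIntegral.integral_const_mul]
  · have hset : ∀ w ∈ Set.uIcc (⟨-Real.pi, -m⟩ : ℂ).re (⟨Real.pi, 0⟩ : ℂ).re ×ℂ
        Set.uIcc (⟨-Real.pi, -m⟩ : ℂ).im (⟨Real.pi, 0⟩ : ℂ).im,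
        w.im ∈ Set.Icc (-m) 0 := fun w hw => by
      have := (Complex.mem_reProdIm.1 hw).2
      rwa [Set.uIcc_of_le (by simpa using hm0.le)] at this
    refine ContinuousOn.div (by fun_prop) (hΦc.mono hset) fun w hw => hΦ0 w (hset w hw)
  · have hset : ∀ w ∈ Set.Ioo (min (⟨-Real.pi, -m⟩ : ℂ).re (⟨Real.pi, 0⟩ : ℂ).re)
        (max (⟨-Real.pi, -m⟩ : ℂ).re (⟨Real.pi, 0⟩ : ℂ).re) ×ℂ
        Set.Ioo (min (⟨-Real.pi, -m⟩ : ℂ).im (⟨Real.pi, 0⟩ : ℂ).im)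
        (max (⟨-Real.pi, -m⟩ : ℂ).im (⟨Real.pi, 0⟩ : ℂ).im), w.im ∈ Set.Ioo (-m) 0 := fun w hw => by
      have := (Complex.mem_reProdIm.1 hw).2
      rwa [min_eq_left (by simpa using hm0.le), max_eq_right (by simpa using hm0.le)] at this
    refine DifferentiableOn.div (Differentiable.differentiableOn (by fun_prop)) (hΦd.mono hset)
      fun w hw => hΦ0 w ⟨(hset w hw).1.le, (hset w hw).2.le⟩

lemma integral_shift (hF : IsSubcritical ε K₁ K₂ μ F) (x : Fin (n + 1) → ℤ) :
    ∫ k in torus (n + 1), Complex.exp (-(Complex.I * (phase k x : ℂ))) / fourier F k =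
      Real.exp (-(μ / 2) * x 0) * ∫ k in torus (n + 1),
        Complex.exp (-(Complex.I * (phase k x : ℂ))) / fourier (tilt (μ / 2) F) k := by
  have hμ := hF.mass_pos
  have hne : ∀ s ∈ Set.Icc 0 (μ / 2), ∀ k, fourier (tilt s F) k ≠ 0 := fun s hs k h => by
    have := hF.re_fourier_tilt_pos hs k
    rw [h] at this; simp at this
  have hi : ∀ s ∈ Set.Icc 0 (μ / 2), IntegrableOn
      (fun k => Complex.exp (-(Complex.I * (phase k x : ℂ))) / fourier (tilt s F) k)
      (torus (n + 1)) := fun s hs => by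
    refine integrableOn_torus_of_continuous (Continuous.div (by fun_prop) ?_ (hne s hs))
    exact continuous_fourier (hF.summable_tilt ⟨hs.1, by linarith [hs.2]⟩)
  have h0 := hi 0 ⟨le_rfl, by positivity⟩
  rw [tilt_zero] at h0
  rw [integral_torus_succ h0, integral_torus_succ (hi _ ⟨by positivity, le_rfl⟩),
    ← integral_const_mul]
  exact integral_congr_ae (Eventually.of_forall fun k' => hF.integral_slice_shift x k')

end IsSubcritical

end Shift

/-! ### The high-order bound from the ℓ^p and the moment hypotheses -/

section HighOrder

variable {n : ℕ}

/-- With θ = d - 2, the function N^{d-2} h is dominated by |y|^{d-2} |f|, so it inherits the ℓ^q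
bound; the weight is at most |k|^{-4}. -/
lemma exists_highOrderBound_of_lq {q S : ℝ} (hq : 1 ≤ q) (hq2 : q ≤ 2)
    (hqd : q < ((n + 1 : ℕ) : ℝ) / 4) (hS : 0 ≤ S) :
    ∃ C > 0, ∀ f : (Fin (n + 1) → ℤ) → ℝ, (Summable fun y => |f y|) →
      (Summable fun y => |latNorm y ^ (n + 1 - 2) * f y| ^ q) →
      ∑' y, |latNorm y ^ (n + 1 - 2) * f y| ^ q ≤ S →
      HighOrderBound C ((n + 1 - 2 : ℕ) : ℝ) f := by
  obtain ⟨C, hC, hb⟩ := exists_integral_fourier_mul_norm_inv_le hq hq2 hqd hS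
  refine ⟨C, hC, fun f hf hfq hfS N hN h hh1 hh2 => ?_⟩
  have hN' : (0 : ℝ) < N := by exact_mod_cast hN
  have hhs : Summable fun y => |h y| := Summable.of_nonneg_of_le (fun _ => abs_nonneg _) hh1 hf
  set D : ℝ := (N : ℝ) ^ (n + 1 - 2) with hD
  have hD0 : 0 < D := by positivity
  set g : (Fin (n + 1) → ℤ) → ℝ := fun y => D * h y with hg
  have hgs : Summable fun y => |g y| := by
    simp only [hg, abs_mul]; exact hhs.mul_left _
  have hgle : ∀ y, |g y| ≤ |latNorm y ^ (n + 1 - 2) * f y| := fun y => by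
    have hl := latNorm_nonneg y
    simp only [hg]
    rw [abs_mul D, abs_of_pos hD0, abs_mul (latNorm y ^ _), abs_of_nonneg (pow_nonneg hl _)]
    calc D * |h y| ≤ D * ((latNorm y / N) ^ ((n + 1 - 2 : ℕ) : ℝ) * |f y|) := by
          gcongr; exact hh2 y
      _ = _ := by rw [Real.rpow_natCast, div_pow, ← hD]; field_simp
  have hgle' : ∀ y, |g y| ^ q ≤ |latNorm y ^ (n + 1 - 2) * f y| ^ q := fun y =>
    Real.rpow_le_rpow (abs_nonneg _) (hgle y) (by linarith)
  have hgq := Summable.of_nonneg_of_le (fun y => Real.rpow_nonneg (abs_nonneg (g y)) q) hgle' hfq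
  obtain ⟨hi, hle⟩ := hb g hgs hgq ((hgq.tsum_le_tsum hgle' hfq).trans hfS)
  have hfour : ∀ k, ‖fourier g k‖ = D * ‖fourier h k‖ := fun k => by
    have : fourier g k = D * fourier h k := by
      simp only [fourier, hg]
      rw [← tsum_mul_left]
      exact tsum_congr fun y => by push_cast; ring
    rw [this, norm_mul, Complex.norm_real, Real.norm_of_nonneg hD0.le]
  rw [le_div_iff₀ hD0, mul_comm, ← integral_const_mul]
  refine le_trans ?_ hle
  refine integral_mono_ae ?_ hi ?_
  · exact (integrableOn_torus_of_continuous
      ((continuous_fourier hhs).norm.mul (continuous_weight hN))).const_mul _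
  · filter_upwards [ae_ne_zero_torus] with k hk
    have hkp : 0 < ‖k‖ := norm_pos_iff.2 hk
    rw [hfour, ← mul_assoc]
    gcongr
    calc ‖k‖ ^ 4 = (‖k‖ ^ 2) ^ 2 := by ring
      _ ≤ _ := by gcongr; linarith [show 0 ≤ ((N : ℝ) ^ 2)⁻¹ by positivity]

/-- The sup of ĥ is O(N^{-(2+ε)}), and the weight is at most N^{4-s} |k|^{-s} with s = d - ε. This s
is just integrable, satisfies s ≤ 4 because d ≤ 4, and makes the powers of N combine to N^{-(d-2)}.
-/
lemma exists_highOrderBound_of_moment {ε K : ℝ} (hn : 2 < n + 1) (hn4 : n + 1 ≤ 4) (hε : 0 < ε)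
    (hε1 : ε ≤ 1) (hK : 0 < K) :
    ∃ C > 0, ∀ f : (Fin (n + 1) → ℤ) → ℝ, (Summable fun y => |f y|) →
      (Summable fun y => latNorm y ^ (2 + ε) * |f y|) →
      ∑' y, latNorm y ^ (2 + ε) * |f y| ≤ K → HighOrderBound C (2 + ε) f := by
  set s : ℝ := (n + 1 : ℕ) - ε with hs
  have hn' : (2 : ℝ) < ((n + 1 : ℕ) : ℝ) := by exact_mod_cast hn
  have hn4' : ((n + 1 : ℕ) : ℝ) ≤ 4 := by exact_mod_cast hn4
  have hi := integrableOn_torus_norm_rpow (d := n + 1) (by omega) (s := s) (by rw [hs]; linarith)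
  set I := ∫ k in torus (n + 1), ‖k‖ ^ (-s) with hI
  have hI0 : 0 ≤ I := integral_nonneg fun k => by positivity
  refine ⟨K * (I + 1), by positivity, fun f hf hfm hfK N hN h hh1 hh2 => ?_⟩
  have hN' : (0 : ℝ) < N := by exact_mod_cast hN
  have hhs : Summable fun y => |h y| := Summable.of_nonneg_of_le (fun _ => abs_nonneg _) hh1 hf
  have hsup : ∀ k, ‖fourier h k‖ ≤ (N : ℝ) ^ (-(2 + ε)) * K := fun k => by
    have hle : ∀ y, |h y| ≤ (N : ℝ) ^ (-(2 + ε)) * (latNorm y ^ (2 + ε) * |f y|) := fun y => by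
      refine (hh2 y).trans_eq ?_
      rw [Real.div_rpow (latNorm_nonneg y) hN'.le, Real.rpow_neg hN'.le]; ring
    refine (norm_fourier_le hhs k).trans ((hhs.tsum_le_tsum hle (hfm.mul_left _)).trans ?_)
    rw [tsum_mul_left]
    gcongr
  calc ∫ k in torus (n + 1), ‖fourier h k‖ * ((‖k‖ ^ 2 + ((N : ℝ) ^ 2)⁻¹) ^ 2)⁻¹
      ≤ ∫ k in torus (n + 1), ((N : ℝ) ^ (-(2 + ε)) * K * (N : ℝ) ^ (4 - s)) * ‖k‖ ^ (-s) := by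
        refine integral_mono_ae (integrableOn_torus_of_continuous
          ((continuous_fourier hhs).norm.mul (continuous_weight hN))) (hi.const_mul _) ?_
        filter_upwards [ae_ne_zero_torus] with k hk
        have hkp : 0 < ‖k‖ := norm_pos_iff.2 hk
        rw [mul_assoc _ _ (‖k‖ ^ (-s))]
        refine mul_le_mul (hsup k) ?_ (by positivity) (by positivity)
        set X := ‖k‖ ^ 2 + ((N : ℝ) ^ 2)⁻¹ with hX
        have hX0 : 0 < X := by positivity
        have e1 : (X ^ 2)⁻¹ = X ^ (-((4 - s) / 2)) * X ^ (-(s / 2)) := by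
          rw [← Real.rpow_add hX0, ← Real.rpow_two, ← Real.rpow_neg hX0.le]
          congr 1; ring
        have e2 : X ^ (-((4 - s) / 2)) ≤ (N : ℝ) ^ (4 - s) := by
          calc X ^ (-((4 - s) / 2)) ≤ (((N : ℝ) ^ 2)⁻¹) ^ (-((4 - s) / 2)) :=
                Real.rpow_le_rpow_of_nonpos (by positivity) (by rw [hX]; nlinarith [sq_nonneg ‖k‖])
                  (by rw [hs]; linarith)
            _ = (N : ℝ) ^ (4 - s) := by
                rw [← Real.rpow_two, ← Real.rpow_neg hN'.le, ← Real.rpow_mul hN'.le]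
                congr 1; ring
        have e3 : X ^ (-(s / 2)) ≤ ‖k‖ ^ (-s) := by
          calc X ^ (-(s / 2)) ≤ (‖k‖ ^ 2) ^ (-(s / 2)) :=
                Real.rpow_le_rpow_of_nonpos (by positivity)
                  (by rw [hX]; linarith [show 0 ≤ ((N : ℝ) ^ 2)⁻¹ by positivity])
                  (by rw [hs]; linarith)
            _ = ‖k‖ ^ (-s) := by
                rw [← Real.rpow_two, ← Real.rpow_mul hkp.le]
                congr 1; ring
        rw [e1]
        gcongr
    _ = K * I * ((N : ℝ) ^ (-(2 + ε)) * (N : ℝ) ^ (4 - s)) := by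
        rw [integral_const_mul]; ring
    _ = K * I / (N : ℝ) ^ (n + 1 - 2) := by
        rw [← Real.rpow_add hN', div_eq_mul_inv, ← Real.rpow_natCast, ← Real.rpow_neg hN'.le]
        congr 2
        rw [hs, Nat.cast_sub (by omega)]; push_cast; ring
    _ ≤ _ := by gcongr; linarith

end HighOrder

end

end NearCritical

namespace NearCritical

open MeasureTheory Filter Topology

noncomputable section

/-! ### Symmetries of the transform and of the Green function -/

section Symmetry

variable {d : ℕ} {f : (Fin d → ℤ) → ℝ}

lemma IsLatticeSymmetric.apply_neg (hf : IsLatticeSymmetric f) (x : Fin d → ℤ) :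
    f (-x) = f x := by
  have key : ∀ s : Finset (Fin d), f (fun i => if i ∈ s then -x i else x i) = f x := fun s => by
    induction s using Finset.induction_on with
    | empty => simp
    | insert a s ha ih =>
      rw [← ih, ← hf.reflect a]
      congr 1
      funext i
      rcases eq_or_ne i a with rfl | h
      · simp [NearCritical.reflect, ha]
      · simp [NearCritical.reflect, h]
  have h := key Finset.univ
  simp only [Finset.mem_univ, if_true] at h
  exact h

/-- A rotation by π/2 followed by a reflection is a transposition of coordinates. -/
lemma IsLatticeSymmetric.apply_swap (hf : IsLatticeSymmetric f) (i j : Fin d) (x : Fin d → ℤ) :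
    f (fun l => x (Equiv.swap i j l)) = f x := by
  rcases eq_or_ne i j with rfl | hij
  · simp
  rw [← hf.rotate i j hij x, ← hf.reflect i (NearCritical.rotate i j x)]
  congr 1
  funext l
  rcases eq_or_ne l i with rfl | hi
  · simp [NearCritical.reflect, NearCritical.rotate, hij]
  rcases eq_or_ne l j with rfl | hj
  · simp [NearCritical.reflect, NearCritical.rotate, hi]
  · simp [NearCritical.reflect, NearCritical.rotate, hi, hj, Equiv.swap_apply_of_ne_of_ne]

lemma conj_fourier (f : (Fin d → ℤ) → ℝ) (k : Fin d → ℝ) :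
    starRingEnd ℂ (fourier f k) = fourier f (-k) := by
  rw [fourier, Complex.conj_tsum, fourier]
  refine tsum_congr fun y => ?_
  rw [map_mul, Complex.conj_ofReal, ← Complex.exp_conj, map_mul, Complex.conj_I,
    Complex.conj_ofReal, phase_neg_left]
  push_cast; ring_nf

lemma IsLatticeSymmetric.fourier_neg (hf : IsLatticeSymmetric f) (k : Fin d → ℝ) :
    fourier f (-k) = fourier f k := by
  rw [fourier, ← (Equiv.neg (Fin d → ℤ)).tsum_eq]
  refine tsum_congr fun y => ?_
  rw [Equiv.neg_apply, hf.apply_neg, phase_neg, phase_neg_left, neg_neg]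

lemma phase_comp_perm (σ : Equiv.Perm (Fin d)) (k : Fin d → ℝ) (x : Fin d → ℤ) :
    phase (fun i => k (σ i)) (fun i => x (σ i)) = phase k x :=
  Equiv.sum_comp σ fun i => k i * (x i : ℝ)

lemma fourier_comp_perm (σ : Equiv.Perm (Fin d)) (hσ : ∀ x, f (fun i => x (σ i)) = f x)
    (k : Fin d → ℝ) : fourier f (fun i => k (σ i)) = fourier f k := by
  rw [fourier, ← (Equiv.arrowCongr σ.symm (Equiv.refl ℤ)).tsum_eq]
  refine tsum_congr fun y => ?_
  have e : (Equiv.arrowCongr σ.symm (Equiv.refl ℤ)) y = fun i => y (σ i) := rfl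
  rw [e, hσ, phase_comp_perm]

lemma integral_torus_neg (g : (Fin d → ℝ) → ℂ) :
    ∫ k in torus d, g (-k) = ∫ k in torus d, g k := by
  -- The half-open torus is not invariant under negation; the closed cube is, and it differs by a
  -- null set.
  have hae : torus d =ᵐ[volume] Set.Icc (fun _ => -Real.pi) (fun _ => Real.pi) :=
    Measure.univ_pi_Ioc_ae_eq_Icc
  rw [setIntegral_congr_set hae, setIntegral_congr_set hae,
    ← (Measure.measurePreserving_neg (volume : Measure (Fin d → ℝ))).setIntegral_preimage_emb
      (MeasurableEquiv.neg _).measurableEmbedding g]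
  congr 2
  ext k
  simp only [Set.mem_Icc, Set.mem_preimage, Pi.le_def, Pi.neg_apply]
  constructor <;> rintro ⟨h1, h2⟩ <;>
    exact ⟨fun i => by linarith [h2 i], fun i => by linarith [h1 i]⟩

lemma integral_torus_comp_perm (σ : Equiv.Perm (Fin d)) (g : (Fin d → ℝ) → ℂ) :
    ∫ k in torus d, g (fun i => k (σ i)) = ∫ k in torus d, g k := by
  have e : ∀ k, MeasurableEquiv.piCongrLeft (fun _ : Fin d => ℝ) σ.symm k = fun i => k (σ i) :=
    fun k => by
      funext i
      have := MeasurableEquiv.piCongrLeft_apply_apply (β := fun _ : Fin d => ℝ) σ.symm k (σ i)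
      simpa using this
  rw [← (volume_measurePreserving_piCongrLeft (fun _ : Fin d => ℝ)
    σ.symm).setIntegral_preimage_emb (MeasurableEquiv.measurableEmbedding _) g]
  simp_rw [e]
  congr 2
  ext k
  simp only [torus, Set.mem_preimage, Set.mem_univ_pi, e]
  exact ⟨fun h i => h _, fun h i => by simpa using h (σ.symm i)⟩

lemma greenIntegral_comp_perm (σ : Equiv.Perm (Fin d)) (hσ : ∀ x, f (fun i => x (σ i)) = f x)
    (x : Fin d → ℤ) : greenIntegral f (fun i => x (σ i)) = greenIntegral f x := by
  rw [greenIntegral, greenIntegral, ← integral_torus_comp_perm σ]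
  simp_rw [phase_comp_perm, fourier_comp_perm σ hσ]

lemma IsLatticeSymmetric.greenIntegral_neg (hf : IsLatticeSymmetric f) (x : Fin d → ℤ) :
    greenIntegral f (-x) = greenIntegral f x := by
  rw [greenIntegral, greenIntegral, ← integral_torus_neg]
  simp_rw [phase_neg, phase_neg_left, neg_neg, hf.fourier_neg]

lemma IsLatticeSymmetric.greenIntegral_im (hf : IsLatticeSymmetric f) (x : Fin d → ℤ) :
    (greenIntegral f x).im = 0 := by
  rw [← Complex.conj_eq_iff_im]
  rw [← hf.greenIntegral_neg x]
  nth_rewrite 2 [hf.greenIntegral_neg x]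
  rw [greenIntegral, greenIntegral, map_mul, ← integral_conj]
  congr 1
  · rw [map_inv₀, map_pow, Complex.conj_ofReal]
  · refine integral_congr_ae (Eventually.of_forall fun k => ?_)
    simp only [map_div₀]
    rw [conj_fourier, hf.fourier_neg, ← Complex.exp_conj, map_neg, map_mul, Complex.conj_I,
      Complex.conj_ofReal, phase_neg]
    push_cast; ring_nf

end Symmetry

/-! ### Integrability and the convolution equation -/

section Green

variable {n : ℕ} {f : (Fin (n + 1) → ℤ) → ℝ} {K : ℝ}

lemma norm_fourier_inv_le (hK : 0 < K) (hf : ∀ k ∈ torus (n + 1), K * ‖k‖ ^ 2 ≤ (fourier f k).re)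
    {k : Fin (n + 1) → ℝ} (hk : k ∈ torus (n + 1)) (hk0 : k ≠ 0) :
    ‖(fourier f k)⁻¹‖ ≤ K⁻¹ * ‖k‖ ^ (-(2 : ℝ)) := by
  have hkp : 0 < ‖k‖ := norm_pos_iff.2 hk0
  rw [norm_inv, Real.rpow_neg hkp.le, Real.rpow_two, ← mul_inv]
  gcongr
  exact (hf k hk).trans ((le_abs_self _).trans (Complex.abs_re_le_norm _))

lemma ae_norm_fourier_inv_le (hK : 0 < K)
    (hf : ∀ k ∈ torus (n + 1), K * ‖k‖ ^ 2 ≤ (fourier f k).re) :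
    ∀ᵐ k ∂(volume.restrict (torus (n + 1))), ‖(fourier f k)⁻¹‖ ≤ K⁻¹ * ‖k‖ ^ (-(2 : ℝ)) := by
  filter_upwards [ae_ne_zero_torus, ae_restrict_mem measurableSet_torus] with k hk0 hk
  exact norm_fourier_inv_le hK hf hk hk0

lemma integrableOn_fourier_inv (hn : 2 < n + 1) (hK : 0 < K) (hs : Summable fun y => |f y|)
    (hf : ∀ k ∈ torus (n + 1), K * ‖k‖ ^ 2 ≤ (fourier f k).re) :
    IntegrableOn (fun k => (fourier f k)⁻¹) (torus (n + 1)) := by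
  have hi := integrableOn_torus_norm_rpow (d := n + 1) (by omega) (s := 2) (by exact_mod_cast hn)
  exact (hi.const_mul K⁻¹).mono' (continuous_fourier hs).measurable.inv.aestronglyMeasurable
    (ae_norm_fourier_inv_le hK hf)

lemma norm_greenIntegral_le (hn : 2 < n + 1) (hK : 0 < K)
    (hf : ∀ k ∈ torus (n + 1), K * ‖k‖ ^ 2 ≤ (fourier f k).re) (x : Fin (n + 1) → ℤ) :
    ‖greenIntegral f x‖ ≤
      ((2 * Real.pi) ^ (n + 1))⁻¹ * (K⁻¹ * ∫ k in torus (n + 1), ‖k‖ ^ (-(2 : ℝ))) := by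
  have hi := integrableOn_torus_norm_rpow (d := n + 1) (by omega) (s := 2) (by exact_mod_cast hn)
  rw [greenIntegral, norm_mul, norm_inv, norm_pow, Complex.norm_real,
    Real.norm_of_nonneg Real.two_pi_pos.le, ← integral_const_mul]
  gcongr
  refine norm_integral_le_of_norm_le (hi.const_mul _) ?_
  filter_upwards [ae_norm_fourier_inv_le hK hf] with k hk
  rwa [div_eq_mul_inv, norm_mul, norm_exp_neg_I_phase, one_mul]

lemma hasSum_mul_greenIntegral (hn : 2 < n + 1) (hK : 0 < K) (hs : Summable fun y => |f y|)
    (hf : ∀ k ∈ torus (n + 1), K * ‖k‖ ^ 2 ≤ (fourier f k).re) (x : Fin (n + 1) → ℤ) :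
    HasSum (fun y => (f y : ℂ) * greenIntegral f (x - y)) (if x = 0 then 1 else 0) := by
  have hφ : IntegrableOn (fun k => Complex.exp (-(Complex.I * (phase k x : ℂ))) / fourier f k)
      (torus (n + 1)) := by
    refine (integrableOn_fourier_inv hn hK hs hf).bdd_mul (c := 1)
      (Continuous.aestronglyMeasurable (by fun_prop)) (Eventually.of_forall fun k => ?_)
    rw [norm_exp_neg_I_phase]
  have h := (hasSum_mul_integral hs hφ).mul_left (((2 * Real.pi : ℝ) ^ (n + 1) : ℂ)⁻¹)
  have e : ∫ k in torus (n + 1), fourier f k *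
      (Complex.exp (-(Complex.I * (phase k x : ℂ))) / fourier f k) =
      if x = 0 then ((2 * Real.pi : ℝ) ^ (n + 1) : ℂ) else 0 := by
    have hx := integral_torus_exp (-x)
    simp only [neg_eq_zero] at hx
    rw [← hx]
    refine integral_congr_ae ?_
    -- The symbol can vanish only at k = 0, so cancelling it is legitimate almost everywhere.
    filter_upwards [ae_ne_zero_torus, ae_restrict_mem measurableSet_torus] with k hk0 hk
    have hne : fourier f k ≠ 0 := fun h0 => by
      have := hf k hk
      have hkp : 0 < ‖k‖ := norm_pos_iff.2 hk0
      rw [h0, Complex.zero_re] at this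
      exact absurd this (not_le.2 (by positivity))
    rw [mul_div_cancel₀ _ hne, phase_neg]
    push_cast; ring_nf
  have e' : ((2 * Real.pi : ℝ) ^ (n + 1) : ℂ)⁻¹ *
      (if x = 0 then ((2 * Real.pi : ℝ) ^ (n + 1) : ℂ) else 0) = if x = 0 then 1 else 0 := by
    have hπ : ((2 * Real.pi : ℝ) : ℂ) ≠ 0 := Complex.ofReal_ne_zero.2 Real.two_pi_pos.ne'
    split_ifs
    · exact inv_mul_cancel₀ (pow_ne_zero _ hπ)
    · simp
  rw [e, e'] at h
  have hG : ∀ y, (f y : ℂ) * greenIntegral f (x - y) = ((2 * Real.pi : ℝ) ^ (n + 1) : ℂ)⁻¹ *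
      ((f y : ℂ) * ∫ k in torus (n + 1), Complex.exp (Complex.I * (phase k y : ℂ)) *
        (Complex.exp (-(Complex.I * (phase k x : ℂ))) / fourier f k)) := fun y => by
    rw [greenIntegral, mul_left_comm]
    congr 3
    funext k
    rw [← mul_div_assoc, ← Complex.exp_add, phase_sub]
    push_cast; ring_nf
  simp_rw [hG]
  exact h

end Green

/-! ### From the first coordinate to the Euclidean norm -/

section Bound

variable {n : ℕ} {ε K₁ K₂ μ : ℝ} {F : (Fin (n + 1) → ℤ) → ℝ}

/-- A transposition, preceded by negation if needed, brings a coordinate of largest modulus to the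
front with nonnegative sign. -/
lemma IsLatticeSymmetric.exists_greenIntegral_eq (hF : IsLatticeSymmetric F)
    (x : Fin (n + 1) → ℤ) : ∃ y : Fin (n + 1) → ℤ, greenIntegral F y = greenIntegral F x ∧
      ∀ i, |x i| ≤ y 0 := by
  obtain ⟨i, hi⟩ := Finite.exists_max fun i => |x i|
  have hs : ∀ z, greenIntegral F (fun l => z (Equiv.swap 0 i l)) = greenIntegral F z :=
    greenIntegral_comp_perm _ (hF.apply_swap 0 i)
  rcases le_total 0 (x i) with h | h
  · refine ⟨_, hs x, fun j => ?_⟩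
    rw [Equiv.swap_apply_left, ← abs_of_nonneg h]
    exact hi j
  · refine ⟨_, (hs (-x)).trans (hF.greenIntegral_neg x), fun j => ?_⟩
    rw [Equiv.swap_apply_left, Pi.neg_apply, ← abs_of_nonpos h]
    exact hi j

/-- A dominant first coordinate is at least |x|/√d. This turns both factors into functions of |x|
and gives the decay rate 1/(2√d) relative to the mass. -/
lemma IsSubcritical.norm_greenIntegral_le (hF : IsSubcritical ε K₁ K₂ μ F) {C : ℝ} (hC : 0 < C)
    (h : ∀ x : Fin (n + 1) → ℤ, 0 < x 0 → ‖∫ k in torus (n + 1),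
      Complex.exp (-(Complex.I * (phase k x : ℂ))) / fourier (tilt (μ / 2) F) k‖ ≤
        C / (x 0 : ℝ) ^ (n + 1 - 2)) {x : Fin (n + 1) → ℤ} (hx : x ≠ 0) :
    ‖greenIntegral F x‖ ≤ ((2 * Real.pi) ^ (n + 1))⁻¹ * (C * √((n + 1 : ℕ) : ℝ) ^ (n + 1 - 2)) /
      latNorm x ^ (n + 1 - 2) *
      Real.exp (-(2 * √((n + 1 : ℕ) : ℝ))⁻¹ * μ * latNorm x) := by
  obtain ⟨y, hy, hxy⟩ := hF.symm.exists_greenIntegral_eq x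
  have hμ := hF.mass_pos
  have hle : latNorm x ≤ √((n + 1 : ℕ) : ℝ) * (y 0 : ℝ) :=
    latNorm_le_sqrt_mul fun i => by exact_mod_cast hxy i
  have hpos : 0 < latNorm x := zero_lt_one.trans_le (one_le_latNorm hx)
  set r := √((n + 1 : ℕ) : ℝ) with hr
  have hr0 : 0 < r := Real.sqrt_pos.2 (by positivity)
  have hy0 : (0 : ℝ) < y 0 := by
    by_contra! hneg
    nlinarith
  have hd : latNorm x / r ≤ y 0 := by rw [div_le_iff₀ hr0, mul_comm]; exact hle
  rw [← hy, greenIntegral, hF.integral_shift, norm_mul, norm_mul, norm_inv, norm_pow,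
    Complex.norm_real, Complex.norm_real, Real.norm_of_nonneg Real.two_pi_pos.le,
    Real.norm_of_nonneg (Real.exp_pos _).le]
  calc ((2 * Real.pi) ^ (n + 1))⁻¹ * (Real.exp (-(μ / 2) * y 0) * ‖∫ k in torus (n + 1),
        Complex.exp (-(Complex.I * (phase k y : ℂ))) / fourier (tilt (μ / 2) F) k‖)
      ≤ ((2 * Real.pi) ^ (n + 1))⁻¹ * (Real.exp (-(μ / 2) * (latNorm x / r)) *
        (C / (latNorm x / r) ^ (n + 1 - 2))) := by
        gcongr ?_ * (?_ * ?_)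
        · exact Real.exp_le_exp.2 (by nlinarith)
        · refine (h y (by exact_mod_cast hy0)).trans ?_
          gcongr
    _ = _ := by
        have e : -(μ / 2) * (latNorm x / r) = -(2 * r)⁻¹ * μ * latNorm x := by
          rw [mul_inv]; ring
        rw [e, div_pow, div_div_eq_mul_div]; ring

/-- The moment bound of order `2 + ε` persists for smaller exponents. -/
lemma moment_bound_mono {d : ℕ} {g : (Fin d → ℤ) → ℝ} {ε ε' K : ℝ} (hε' : 0 < ε')
    (hle : ε' ≤ ε) (hs : Summable fun y => latNorm y ^ (2 + ε) * |g y|)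
    (hK : ∑' y, latNorm y ^ (2 + ε) * |g y| ≤ K) :
    (Summable fun y => latNorm y ^ (2 + ε') * |g y|) ∧
      ∑' y, latNorm y ^ (2 + ε') * |g y| ≤ K := by
  have h : ∀ y, latNorm y ^ (2 + ε') * |g y| ≤ latNorm y ^ (2 + ε) * |g y| := fun y => by
    gcongr ?_ * _
    rcases eq_or_ne y 0 with rfl | hy
    · rw [latNorm_zero, Real.zero_rpow (by linarith), Real.zero_rpow (by linarith)]
    · exact Real.rpow_le_rpow_of_exponent_le (one_le_latNorm hy) (by linarith)
  have hs' := Summable.of_nonneg_of_le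
    (fun y => mul_nonneg (Real.rpow_nonneg (latNorm_nonneg y) _) (abs_nonneg (g y))) h hs
  exact ⟨hs', (hs'.tsum_le_tsum h hs).trans hK⟩

end Bound

/-! ### Uniform constants for the near-critical family -/

section Family

variable {n : ℕ} {zc δ : ℝ} {F : ℝ → (Fin (n + 1) → ℤ) → ℝ} {mass : ℝ → ℝ}

namespace NearCriticalFamily

lemma exists_moment (hF : NearCriticalFamily zc δ F mass) :
    ∃ ε > 0, ε ≤ 1 ∧ ∃ K₁ > 0, ∀ z ∈ Set.Ico (zc - δ) zc, ∀ m ∈ Set.Ico 0 (mass z),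
    Summable (fun x : Fin (n + 1) → ℤ => latNorm x ^ (2 + ε : ℝ) * |tilt m (F z) x|) ∧
    ∑' x : Fin (n + 1) → ℤ, latNorm x ^ (2 + ε : ℝ) * |tilt m (F z) x| ≤ K₁ := by
  obtain ⟨ε, hε, K₁, hK₁, h⟩ := hF.moment
  exact ⟨min ε 1, lt_min hε one_pos, min_le_right _ _, K₁, hK₁, fun z hz m hm =>
    moment_bound_mono (lt_min hε one_pos) (min_le_left _ _) (h z hz m hm).1 (h z hz m hm).2⟩

lemma summable_tilt (hF : NearCriticalFamily zc δ F mass) {z : ℝ} (hz : z ∈ Set.Ico (zc - δ) zc)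
    {m : ℝ} (hm : m ∈ Set.Ico 0 (mass z)) : Summable fun y => |tilt m (F z) y| := by
  obtain ⟨ε, hε, K₁, -, h⟩ := hF.moment
  exact summable_of_summable_weight_mul (fun _ => abs_nonneg _)
    (fun y hy => Real.one_le_rpow (one_le_latNorm hy) (by linarith)) (h z hz m hm).1

lemma summable (hF : NearCriticalFamily zc δ F mass) {z : ℝ} (hz : z ∈ Set.Ico (zc - δ) zc) :
    Summable fun y => |F z y| := by
  simpa [tilt_zero] using hF.summable_tilt hz ⟨le_rfl, hF.mass_pos z hz⟩

lemma exists_re_fourier_ge (hF : NearCriticalFamily zc δ F mass) :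
    ∃ K₂ > 0, ∀ z ∈ Set.Ico (zc - δ) zc, ∀ k ∈ torus (n + 1),
      K₂ * euclNorm k ^ 2 ≤ (fourier (F z) k).re - (fourier (F z) 0).re ∧
      K₂ * ‖k‖ ^ 2 ≤ (fourier (F z) k).re := by
  obtain ⟨K₂, hK₂, h⟩ := hF.infrared
  refine ⟨K₂, hK₂, fun z hz k hk => ⟨h z hz k hk, ?_⟩⟩
  have h0 := hF.fourier_zero_nonneg z hz 0 ⟨le_rfl, hF.mass_pos z hz⟩
  rw [tilt_zero] at h0
  have h1 : K₂ * ‖k‖ ^ 2 ≤ K₂ * euclNorm k ^ 2 := by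
    gcongr; exact norm_le_euclNorm k
  linarith [h z hz k hk]

lemma exists_highOrderBound (hF : NearCriticalFamily zc δ F mass) (hn : 2 < n + 1) :
    ∃ C > 0, ∃ θ : ℝ, 0 ≤ θ ∧ ∃ T : ℕ, 2 ≤ T ∧ θ ≤ T ∧ ∀ z ∈ Set.Ico (zc - δ) zc,
      ∀ m ∈ Set.Ico 0 (mass z), HighOrderBound C θ (tilt m (F z)) := by
  rcases lt_or_ge 4 (n + 1) with h4 | h4
  · obtain ⟨p, hp1, hpd, K₃, h⟩ := hF.lp_bound h4
    have hq : 1 ≤ min p 2 := le_min hp1 one_le_two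
    obtain ⟨C, hC, hb⟩ := exists_highOrderBound_of_lq (n := n) (S := max K₃ 0 ^ min p 2) hq
      (min_le_right _ _) ((min_le_left _ _).trans_lt hpd) (by positivity)
    refine ⟨C, hC, ((n + 1 - 2 : ℕ) : ℝ), by positivity, n + 1 - 2, by omega, le_rfl,
      fun z hz m hm => hb _ (hF.summable_tilt hz hm) (h z hz m hm).1 ?_⟩
    set A := ∑' x : Fin (n + 1) → ℤ, |latNorm x ^ (n + 1 - 2) * tilt m (F z) x| ^ min p 2 with hA
    have hA0 : 0 ≤ A := tsum_nonneg fun x => by positivity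
    have hle : A ^ (1 / min p 2) ≤ max K₃ 0 := (h z hz m hm).2.trans (le_max_left _ _)
    calc A = (A ^ (1 / min p 2)) ^ min p 2 := by
          rw [← Real.rpow_mul hA0, one_div_mul_cancel (by linarith), Real.rpow_one]
      _ ≤ _ := Real.rpow_le_rpow (by positivity) hle (by linarith)
  · obtain ⟨ε, hε, hε1, K₁, hK₁, h⟩ := hF.exists_moment
    obtain ⟨C, hC, hb⟩ := exists_highOrderBound_of_moment hn h4 hε hε1 hK₁
    -- T = 3 suffices for θ = 2 + ε because ε has been reduced to at most 1.
    exact ⟨C, hC, 2 + ε, by linarith, 3, by norm_num, by push_cast; linarith,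
      fun z hz m hm => hb _ (hF.summable_tilt hz hm) (h z hz m hm).1 (h z hz m hm).2⟩

lemma exists_mass_small (hF : NearCriticalFamily zc δ F mass) {ε A B : ℝ} (hε : 0 < ε)
    (hB : 0 < B) : ∃ δ' ∈ Set.Ioc 0 δ, ∀ z ∈ Set.Ico (zc - δ') zc, mass z ^ ε * A ≤ B := by
  have ht : Tendsto (fun z => mass z ^ ε * A) (𝓝[<] zc) (𝓝 0) := by
    have h := (hF.mass_tendsto.rpow_const (p := ε) (Or.inr hε.le)).mul_const A
    rwa [Real.zero_rpow hε.ne', zero_mul] at h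
  obtain ⟨l, hl, hsub⟩ := mem_nhdsLT_iff_exists_Ioo_subset.1 (ht.eventually_le_const hB)
  have hl' : 0 < zc - l := sub_pos.2 hl
  refine ⟨min δ ((zc - l) / 2), ⟨lt_min hF.delta_pos (by linarith), min_le_left _ _⟩,
    fun z hz => hsub ⟨?_, hz.2⟩⟩
  linarith [hz.1, min_le_right δ ((zc - l) / 2)]

/-- The near-critical bound on the Green function. -/
theorem exists_norm_greenIntegral_le (hF : NearCriticalFamily zc δ F mass) (hn : 2 < n + 1) :
    ∃ c₀ > 0, ∃ c₁ ∈ Set.Ioo (0 : ℝ) 1, ∃ δ' ∈ Set.Ioc 0 δ, ∀ z ∈ Set.Ico (zc - δ') zc,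
      ∀ x : Fin (n + 1) → ℤ, ‖greenIntegral (F z) x‖ ≤
        c₀ / max (latNorm x) 1 ^ (n + 1 - 2) * Real.exp (-c₁ * mass z * latNorm x) := by
  obtain ⟨ε, hε, hε1, K₁, hK₁, hmom⟩ := hF.exists_moment
  obtain ⟨K₂, hK₂, hlow⟩ := hF.exists_re_fourier_ge
  obtain ⟨CH, hCH, θ, hθ, T, hT, hθT, hhigh⟩ := hF.exists_highOrderBound hn
  obtain ⟨δ', hδ', hsmall⟩ := hF.exists_mass_small (A := (72 + 2 * (n + 1) ^ 2) * K₁) hε hK₂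
  obtain ⟨C, hC, hb⟩ := exists_integral_inv_le hn (K := 2 * K₁) (c := min 1 (K₂ / 2)) hT
    (by positivity) (by positivity) (min_le_left _ _) hCH.le hθ hθT
  set r := √((n + 1 : ℕ) : ℝ) with hr
  have hr1 : 1 ≤ r := Real.one_le_sqrt.2 (by push_cast; linarith [Nat.cast_nonneg (α := ℝ) n])
  set c := ((2 * Real.pi) ^ (n + 1))⁻¹ * (C * r ^ (n + 1 - 2)) with hc
  set c' := ((2 * Real.pi) ^ (n + 1))⁻¹ * (K₂⁻¹ * ∫ k in torus (n + 1), ‖k‖ ^ (-(2 : ℝ))) with hc'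
  have hpi := Real.pi_pos
  have hc0 : 0 < c := by positivity
  have hc'0 : 0 ≤ c' := by
    have : 0 ≤ ∫ k in torus (n + 1), ‖k‖ ^ (-(2 : ℝ)) := integral_nonneg fun k => by positivity
    positivity
  -- The term c' is needed only at x = 0, where integrability of |k|^{-2} gives the bound.
  refine ⟨c + c', by positivity, (2 * r)⁻¹, ⟨by positivity, inv_lt_one_of_one_lt₀ (by linarith)⟩,
    δ', hδ', fun z hz x => ?_⟩
  have hz' : z ∈ Set.Ico (zc - δ) zc := ⟨by linarith [hz.1, hδ'.2], hz.2⟩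
  rcases eq_or_ne x 0 with rfl | hx
  · rw [latNorm_zero, max_eq_right zero_le_one, one_pow, div_one, mul_zero, Real.exp_zero, mul_one]
    exact (NearCritical.norm_greenIntegral_le hn hK₂ (fun k hk => (hlow z hz' k hk).2) 0).trans
      (by linarith)
  have hsub : IsSubcritical ε K₁ K₂ (mass z) (F z) :=
    { eps_pos := hε
      eps_le_one := hε1
      K₁_pos := hK₁
      K₂_pos := hK₂
      mass_pos := hF.mass_pos z hz'
      symm := hF.symm z hz'
      moment := hmom z hz'
      nonneg := hF.fourier_zero_nonneg z hz'
      infrared := fun k hk => (hlow z hz' k hk).1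
      small := hsmall z hz }
  have hm := hsub.mass_pos
  refine (hsub.norm_greenIntegral_le hC (hb _ _ hsub.isMassiveSymbol
    (hhigh z hz' _ ⟨by positivity, by linarith⟩)) hx).trans ?_
  have h1 := one_le_latNorm hx
  rw [max_eq_left h1, ← hr, ← hc]
  gcongr
  linarith

end NearCriticalFamily

end Family

end

end NearCritical

open NearCritical MeasureTheory in
theorem theorem1p1 (d : ℕ) [NeZero d] (hd : 2 < d) (zc δ : ℝ)
    (F : ℝ → (Fin d → ℤ) → ℝ) (mass : ℝ → ℝ)
    (hF : NearCriticalFamily zc δ F mass) :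
    -- `G z = greenIntegral (F z)` is well defined, real valued and solves `F z * G z = δ₀`
    (∀ z ∈ Set.Ico (zc - δ) zc,
      IntegrableOn (fun k => (fourier (F z) k)⁻¹) (torus d) ∧
      ∀ x : Fin d → ℤ, (greenIntegral (F z) x).im = 0 ∧
        HasSum (fun y => (F z y : ℂ) * greenIntegral (F z) (x - y)) (if x = 0 then 1 else 0)) ∧
    -- the near-critical bound
    ∃ c₀ > 0, ∃ c₁ ∈ Set.Ioo (0 : ℝ) 1, ∃ δ' ∈ Set.Ioc 0 δ,
      ∀ z ∈ Set.Ico (zc - δ') zc, ∀ x : Fin d → ℤ,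
        (greenIntegral (F z) x).re ≤
          c₀ / max (latNorm x) 1 ^ (d - 2) * Real.exp (-c₁ * mass z * latNorm x) := by
  obtain ⟨n, rfl⟩ : ∃ n, d = n + 1 := ⟨d - 1, by omega⟩
  refine ⟨fun z hz => ?_, ?_⟩
  · obtain ⟨K₂, hK₂, hlow⟩ := hF.exists_re_fourier_ge
    have hs := hF.summable hz
    have hge := fun k hk => (hlow z hz k hk).2
    exact ⟨integrableOn_fourier_inv hd hK₂ hs hge, fun x =>
      ⟨(hF.symm z hz).greenIntegral_im x, hasSum_mul_greenIntegral hd hK₂ hs hge x⟩⟩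
  · obtain ⟨c₀, hc₀, c₁, hc₁, δ', hδ', h⟩ := hF.exists_norm_greenIntegral_le hd
    exact ⟨c₀, hc₀, c₁, hc₁, δ', hδ', fun z hz x => (Complex.re_le_norm _).trans (h z hz x)⟩
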